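/- **Theorem 48.** Let $\gamma$ be the product on $\mathbf R^{\mathbf N}$ of countably many copies of the standard Gaussian measure, and let $\rho(a,b)=(\sum_n|a_n-b_n|^2)^{1/2}\in[0,\infty]$ be the $l^2$ metric with infinite distances. Scalars are real, and $L^\infty=L^\infty(\mathbf R^{\mathbf N},\gamma)$. *Definitions.* For measurable sets $A,B$ of positive measure let $\rho(A,B)$ be the supremum of $\inf\{\rho(x,y):x\in A',y\in B'\}$ over all measurable $A',B'$ that differ from $A,B$ by null sets. For $f\in L^\infty$ let $\rho_f(A,B)$ be the distance in $\mathbf R$ between the essential ranges of $f|_A$ and $f|_B$, let $L(f)=\sup\{\rho_f(A,B)/\rho(A,B):\rho(A,B)>0\}$, and let $\mathrm{Lip}$ be the algebra of all $f\in L^\infty$ with $L(f)<\infty$, with norm $\max(L(f),\|f\|_\infty)$ and the weak* topology that on bounded sets is the restriction of the weak* topology of $L^\infty$. Let $\mathcal X(\mathbf R^{\mathbf N})$ be the $L^\infty$-module of all bounded, weak*-continuous linear maps $\delta:\mathrm{Lip}\to L^\infty$ with $\delta(fg)=f\delta(g)+g\delta(f)$, with the operator norm and the action $(a\delta)(f)=a\,\delta(f)$.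 Let $\Omega(\mathbf R^{\mathbf N})$ be the dual module of all bounded $L^\infty$-module homomorphisms $\mathcal X(\mathbf R^{\mathbf N})\to L^\infty$, with the operator norm, and let $d:\mathrm{Lip}\to\Omega(\mathbf R^{\mathbf N})$ be the exterior derivative, $(df)(\delta)=\delta(f)$. Let $l^2(L^\infty)$ be the $L^\infty$-module of all sequences $(g_n)$ in $L^\infty$ for which the partial sums $\sum_{n<N}|g_n|^2$ are uniformly bounded in $L^\infty$, with norm $\|(\sum_n|g_n|^2)^{1/2}\|_\infty$. The Gross–Sobolev derivative is the closure, as an operator from $L^2(\gamma)$ to $L^2(\gamma;l^2(\mathbf N))$, of the gradient $\varphi(x_0,\dots,x_{n-1})\mapsto(\partial_0\varphi,\dots,\partial_{n-1}\varphi,0,0,\dots)$ on cylinder functions with $\varphi$ smooth on $\mathbf R^n$ and bounded together with all its derivatives. *Claim.* There is an isometric isomorphism of $L^\infty$-modules $$\mathcal X(\mathbf R^{\mathbf N})\cong l^2(L^\infty),$$ and $l^2(L^\infty)$ is isometrically isomorphic, as an $L^\infty$-module, by $(g_n)\mapsto(x\mapsto(g_n(x))_n)$, to the module $L^\infty(\mathbf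 R^{\mathbf N};l^2(\mathbf N))$ of bounded measurable sections, modulo null sets, of the Hilbert bundle $\mathbf R^{\mathbf N}\times l^2(\mathbf N)$. Through the fiberwise inner product with these sections, $\Omega(\mathbf R^{\mathbf N})$ is isometrically isomorphic to the same module of sections, and under this identification the exterior derivative is the Gross–Sobolev derivative: every $f\in\mathrm{Lip}$ lies in the domain of the latter, and its Gross–Sobolev derivative, which is unique up to null sets, is the section that represents $df$. -/

import Mathlib

open MeasureTheory ProbabilityTheory Filter Topology
open scoped ENNReal NNReal ContDiff InnerProductSpace

namespace MetricCalculus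

/-! ### Measurable metrics and Lipschitz numbers -/

section General

variable {α : Type*} [MeasurableSpace α]

/-- The distance between measurable sets that a pointwise (extended) metric `d` induces: the
supremum of `inf {d x y | x ∈ A', y ∈ B'}` over all measurable `A'`, `B'` that differ from `A`, `B`
by null sets. -/
noncomputable def setDist (μ : Measure α) (d : α → α → ℝ≥0∞) (A B : Set α) : ℝ≥0∞ :=
  ⨆ (A' : Set α) (B' : Set α) (_ : MeasurableSet A') (_ : MeasurableSet B')
    (_ : A' =ᵐ[μ] A) (_ : B' =ᵐ[μ] B), ⨅ (x ∈ A') (y ∈ B'), d x y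

/-- The essential range of `f` restricted to `A`. -/
def essRange (μ : Measure α) (f : α → ℝ) (A : Set α) : Set ℝ :=
  {a | ∀ U ∈ 𝓝 a, 0 < μ (A ∩ f ⁻¹' U)}

/-- The distance, in `ℝ`, between the essential ranges of `f|_A` and `f|_B`. -/
noncomputable def essRangeDist (μ : Measure α) (f : α → ℝ) (A B : Set α) : ℝ≥0∞ :=
  ⨅ (a ∈ essRange μ f A) (b ∈ essRange μ f B), edist a b

/-- The Lipschitz number of `f`, a supremum over sets of positive measure at positive distance.
(A quotient with denominator `∞` is `0`.) -/
noncomputable def lipNumber (μ : Measure α) (d : α → α → ℝ≥0∞) (f : α → ℝ) : ℝ≥0∞ :=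
  ⨆ (A : Set α) (B : Set α) (_ : MeasurableSet A) (_ : MeasurableSet B)
    (_ : 0 < μ A) (_ : 0 < μ B) (_ : 0 < setDist μ d A B),
    essRangeDist μ f A B / setDist μ d A B

theorem le_setDist_of_partition {μ : Measure α} {d : α → α → ℝ≥0∞} {A B : Set α}
    {ι : Type*} [Countable ι] [Nonempty ι] (U : ι → Set α) (hcov : ⋃ i, U i = Set.univ)
    (r : ℝ≥0∞) (h : ∀ i j, r ≤ setDist μ d (A ∩ U i) (B ∩ U j)) : r ≤ setDist μ d A B := by
  refine le_of_forall_lt fun s hs => ?_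
  obtain ⟨s', hss', hs'r⟩ := exists_between hs
  have h' : ∀ i j, ∃ A' B', MeasurableSet A' ∧ MeasurableSet B' ∧ A' =ᵐ[μ] (A ∩ U i : Set α) ∧
      B' =ᵐ[μ] (B ∩ U j : Set α) ∧ ∀ x ∈ A', ∀ y ∈ B', s' ≤ d x y := by
    intro i j
    have := hs'r.trans_le (h i j)
    simp only [setDist, lt_iSup_iff] at this
    obtain ⟨A', B', h1, h2, h3, h4, h5⟩ := this
    exact ⟨A', B', h1, h2, h3, h4, fun x hx y hy => h5.le.trans
      ((iInf₂_le x hx).trans (iInf₂_le y hy))⟩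
  choose A' B' hA hB hAe hBe hd using h'
  refine hss'.trans_le ?_
  have eA : (⋃ i, A ∩ U i) = A := by rw [← Set.inter_iUnion, hcov, Set.inter_univ]
  have eB : (⋃ i, B ∩ U i) = B := by rw [← Set.inter_iUnion, hcov, Set.inter_univ]
  have h3 : (⋃ i, ⋂ j, A' i j : Set α) =ᵐ[μ] A := by
    conv_rhs => rw [← eA]
    refine Filter.EventuallyEq.countable_iUnion fun i => ?_
    have : (⋂ j, A' i j : Set α) =ᵐ[μ] (⋂ _ : ι, A ∩ U i : Set α) :=
      Filter.EventuallyEq.countable_iInter fun j => hAe i j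
    rwa [Set.iInter_const] at this
  have h4 : (⋃ j, ⋂ i, B' i j : Set α) =ᵐ[μ] B := by
    conv_rhs => rw [← eB]
    refine Filter.EventuallyEq.countable_iUnion fun j => ?_
    have : (⋂ i, B' i j : Set α) =ᵐ[μ] (⋂ _ : ι, B ∩ U j : Set α) :=
      Filter.EventuallyEq.countable_iInter fun i => hBe i j
    rwa [Set.iInter_const] at this
  refine le_trans ?_ (le_iSup₂_of_le (⋃ i, ⋂ j, A' i j) (⋃ j, ⋂ i, B' i j)
    (le_iSup₂_of_le (MeasurableSet.iUnion fun i => MeasurableSet.iInter fun j => hA i j)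
      (MeasurableSet.iUnion fun j => MeasurableSet.iInter fun i => hB i j)
      (le_iSup₂_of_le h3 h4 le_rfl)))
  refine le_iInf₂ fun x hx => le_iInf₂ fun y hy => ?_
  obtain ⟨i, hi⟩ := Set.mem_iUnion.1 hx
  obtain ⟨j, hj⟩ := Set.mem_iUnion.1 hy
  exact hd i j x (Set.mem_iInter.1 hi j) y (Set.mem_iInter.1 hj i)

theorem setDist_mono {μ : Measure α} {d : α → α → ℝ≥0∞} {A B C D : Set α}
    (hA : MeasurableSet C) (hB : MeasurableSet D) (hCA : C ⊆ A) (hDB : D ⊆ B) :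
    setDist μ d A B ≤ setDist μ d C D := by
  refine iSup₂_le fun A' B' => iSup₂_le fun h1 h2 => iSup₂_le fun h3 h4 => ?_
  have e3 : (A' ∩ C : Set α) =ᵐ[μ] C := by
    have := h3.inter (ae_eq_refl C)
    rwa [Set.inter_eq_right.2 hCA] at this
  have e4 : (B' ∩ D : Set α) =ᵐ[μ] D := by
    have := h4.inter (ae_eq_refl D)
    rwa [Set.inter_eq_right.2 hDB] at this
  refine le_trans ?_ (le_iSup₂_of_le (A' ∩ C) (B' ∩ D)
    (le_iSup₂_of_le (h1.inter hA) (h2.inter hB) (le_iSup₂_of_le e3 e4 le_rfl)))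
  exact le_iInf₂ fun x hx => le_iInf₂ fun y hy => (iInf₂_le x hx.1).trans (iInf₂_le y hy.1)

theorem setDist_null_left {μ : Measure α} {d : α → α → ℝ≥0∞} {A B : Set α}
    (hB : MeasurableSet B) (h : μ A = 0) : setDist μ d A B = ⊤ := by
  refine top_le_iff.1 (le_trans ?_ (le_iSup₂_of_le ∅ B (le_iSup₂_of_le MeasurableSet.empty hB
    (le_iSup₂_of_le (ae_eq_empty.2 h).symm (ae_eq_refl B) le_rfl))))
  simp

theorem setDist_null_right {μ : Measure α} {d : α → α → ℝ≥0∞} {A B : Set α}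
    (hA : MeasurableSet A) (h : μ B = 0) : setDist μ d A B = ⊤ := by
  refine top_le_iff.1 (le_trans ?_ (le_iSup₂_of_le A ∅ (le_iSup₂_of_le hA MeasurableSet.empty
    (le_iSup₂_of_le (ae_eq_refl A) (ae_eq_empty.2 h).symm le_rfl))))
  simp

theorem essRange_nonempty {μ : Measure α} {f : α → ℝ} (hf : Measurable f) {A : Set α}
    (hA : 0 < μ A) : (essRange μ f A).Nonempty := by
  have h : (μ.restrict A).map f Set.univ ≠ 0 := by
    rw [Measure.map_apply hf MeasurableSet.univ]; simpa using hA.ne'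
  obtain ⟨a, -, ha⟩ := exists_mem_forall_mem_nhdsWithin_pos_measure h
  refine ⟨a, fun U hU => ?_⟩
  obtain ⟨V, hVU, hV, haV⟩ := mem_nhds_iff.1 hU
  have := ha V (by rw [nhdsWithin_univ]; exact hV.mem_nhds haV)
  rw [Measure.map_apply hf hV.measurableSet,
    Measure.restrict_apply (hf hV.measurableSet)] at this
  refine this.trans_le (measure_mono fun x hx => ⟨hx.2, hVU hx.1⟩)

theorem lipNumber_le_of_combination {μ : Measure α} {d : α → α → ℝ≥0∞} {f g h : α → ℝ}
    (hf : Measurable f) (hg : Measurable g) (hh : Measurable h)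
    (hLf : lipNumber μ d f < ⊤) (hLg : lipNumber μ d g < ⊤) (K : ℝ≥0) (S : Set α)
    (hS : μ Sᶜ = 0)
    (H : ∀ x ∈ S, ∀ y ∈ S, edist (h x) (h y) ≤ K * (edist (f x) (f y) + edist (g x) (g y))) :
    lipNumber μ d h ≤ K * (lipNumber μ d f + lipNumber μ d g) := by
  have key : ∀ {u : α → ℝ} {A B : Set α}, MeasurableSet A → MeasurableSet B → 0 < μ A → 0 < μ B →
      0 < setDist μ d A B → setDist μ d A B ≠ ⊤ →
      essRangeDist μ u A B ≤ lipNumber μ d u * setDist μ d A B := by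
    intro u A B hA hB h1 h2 h3 h4
    rw [← ENNReal.div_le_iff h3.ne' h4]
    exact le_iSup₂_of_le A B (le_iSup₂_of_le hA hB (le_iSup₂_of_le h1 h2 (le_iSup_of_le h3 le_rfl)))
  refine iSup₂_le fun A B => iSup₂_le fun hA hB => iSup₂_le fun hA0 hB0 => iSup_le fun hρ => ?_
  by_cases hρt : setDist μ d A B = ⊤
  · simp [hρt]
  rw [ENNReal.div_le_iff hρ.ne' hρt]
  lift setDist μ d A B to ℝ≥0 using hρt with ρ hρe
  lift lipNumber μ d f to ℝ≥0 using hLf.ne with Lf hLfe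
  lift lipNumber μ d g to ℝ≥0 using hLg.ne with Lg hLge
  refine ENNReal.le_of_forall_pos_le_add fun ε hε _ => ?_
  set C : ℝ≥0 := 2 + K * (Lf + Lg + 10) with hC
  have hC0 : 0 < C := by positivity
  set η : ℝ≥0 := ε / C with hη
  have hη0 : 0 < η := by positivity
  set U : ℤ × ℤ → Set α := fun p => {x | ⌊f x / η⌋ = p.1 ∧ ⌊g x / η⌋ = p.2} with hU
  have hUm : ∀ p, MeasurableSet (U p) := fun p =>
    (measurableSet_eq_fun (hf.div_const _).floor measurable_const).inter
      (measurableSet_eq_fun (hg.div_const _).floor measurable_const)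
  have hcov : ⋃ p, U p = Set.univ := by
    refine Set.eq_univ_of_forall fun x => Set.mem_iUnion.2 ⟨(⌊f x / η⌋, ⌊g x / η⌋), rfl, rfl⟩
  obtain ⟨p, q, hpq⟩ : ∃ p q, setDist μ d (A ∩ U p) (B ∩ U q) < (ρ + η : ℝ≥0) := by
    by_contra! hcon
    have := le_setDist_of_partition U hcov _ hcon
    rw [← hρe, ENNReal.coe_le_coe] at this
    exact absurd this (not_le.2 (lt_add_of_pos_right _ hη0))
  have mA := hA.inter (hUm p)
  have mB := hB.inter (hUm q)
  have hρ' : 0 < setDist μ d (A ∩ U p) (B ∩ U q) := by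
    refine lt_of_lt_of_le ?_ (setDist_mono mA mB Set.inter_subset_left Set.inter_subset_left)
    rw [← hρe]; exact hρ
  have hA' : 0 < μ (A ∩ U p) := by
    refine pos_iff_ne_zero.2 fun h0 => ?_
    rw [setDist_null_left mB h0] at hpq
    exact absurd hpq (by simp)
  have hB' : 0 < μ (B ∩ U q) := by
    refine pos_iff_ne_zero.2 fun h0 => ?_
    rw [setDist_null_right mA h0] at hpq
    exact absurd hpq (by simp)
  have hρt' := hpq.ne_top
  have floor_close : ∀ {u v : ℝ}, ⌊u / η⌋ = ⌊v / η⌋ → edist u v ≤ η := by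
    intro u v huv
    have := Int.abs_sub_lt_one_of_floor_eq_floor huv
    rw [← sub_div, abs_div, div_lt_one (by positivity), abs_of_pos (a := (η : ℝ))
      (by exact_mod_cast hη0)] at this
    rw [edist_dist, Real.dist_eq]
    refine (ENNReal.ofReal_le_ofReal this.le).trans ?_
    rw [ENNReal.ofReal_coe_nnreal]
  have bound : ∀ {u : α → ℝ} {L : ℝ≥0}, Measurable u → (L : ℝ≥0∞) = lipNumber μ d u →
      (∀ x ∈ A ∩ U p, ∀ y ∈ A ∩ U p, edist (u x) (u y) ≤ η) →
      (∀ x ∈ B ∩ U q, ∀ y ∈ B ∩ U q, edist (u x) (u y) ≤ η) →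
      ∀ x ∈ A ∩ U p, ∀ y ∈ B ∩ U q,
        edist (u x) (u y) ≤ L * (ρ + η) + 5 * η := by
    intro u L hu hL h1 h2 x hx y hy
    have h3 : essRangeDist μ u (A ∩ U p) (B ∩ U q) < L * (ρ + η) + η := by
      refine lt_of_le_of_lt ((key mA mB hA' hB' hρ' hρt').trans
        (mul_le_mul_right hpq.le _)) ?_
      rw [← hL]
      exact_mod_cast lt_add_of_pos_right _ hη0
    simp only [essRangeDist, iInf_lt_iff] at h3
    obtain ⟨a, ha, b, hb, hab⟩ := h3
    obtain ⟨x₀, hx₀, hx₀a⟩ := nonempty_of_measure_ne_zero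
      (ha _ (Metric.eball_mem_nhds a (ENNReal.coe_pos.2 hη0))).ne'
    obtain ⟨y₀, hy₀, hy₀b⟩ := nonempty_of_measure_ne_zero
      (hb _ (Metric.eball_mem_nhds b (ENNReal.coe_pos.2 hη0))).ne'
    have hx₀a' : edist (u x₀) a < η := hx₀a
    have hy₀b' : edist (u y₀) b < η := hy₀b
    calc edist (u x) (u y) ≤ edist (u x) (u x₀) + edist (u x₀) a + edist a b + edist b (u y₀)
          + edist (u y₀) (u y) := by
            refine (edist_triangle _ (u y₀) _).trans (add_le_add_left ?_ _)
            refine (edist_triangle _ b _).trans (add_le_add_left ?_ _)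
            exact edist_triangle4 _ _ _ _
      _ ≤ η + η + (L * (ρ + η) + η) + η + η := by
            gcongr
            · exact h1 _ hx _ hx₀
            · rw [edist_comm]; exact hy₀b'.le
            · exact h2 _ hy₀ _ hy
      _ = L * (ρ + η) + 5 * η := by ring
  obtain ⟨s, hs⟩ := essRange_nonempty (μ := μ) hh hA'
  obtain ⟨t, ht⟩ := essRange_nonempty (μ := μ) hh hB'
  have pick : ∀ {D : Set α} {a : ℝ}, a ∈ essRange μ h D → ∃ x ∈ D, x ∈ S ∧ edist (h x) a ≤ η := by
    intro D a ha
    have h0 := ha _ (Metric.eball_mem_nhds a (ENNReal.coe_pos.2 hη0))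
    have h1 : μ ((D ∩ h ⁻¹' Metric.eball a η) ∩ S) ≠ 0 := by
      rw [measure_inter_conull hS]; exact h0.ne'
    obtain ⟨x, ⟨hx, hxa⟩, hxS⟩ := nonempty_of_measure_ne_zero h1
    exact ⟨x, hx, hxS, (show edist (h x) a < η from hxa).le⟩
  obtain ⟨x, hx, hxS, hxs⟩ := pick hs
  obtain ⟨y, hy, hyS, hyt⟩ := pick ht
  have mono : ∀ {D E : Set α}, D ⊆ E → essRange μ h D ⊆ essRange μ h E := fun hDE a ha V hV =>
    (ha V hV).trans_le (measure_mono (Set.inter_subset_inter_left _ hDE))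
  have e1 : essRangeDist μ h A B ≤ edist s t :=
    (iInf₂_le s (mono Set.inter_subset_left hs)).trans
      (iInf₂_le t (mono Set.inter_subset_left ht))
  have bf := bound hf hLfe
    (fun x hx y hy => floor_close (hx.2.1.trans hy.2.1.symm))
    (fun x hx y hy => floor_close (hx.2.1.trans hy.2.1.symm)) x hx y hy
  have bg := bound hg hLge
    (fun x hx y hy => floor_close (hx.2.2.trans hy.2.2.symm))
    (fun x hx y hy => floor_close (hx.2.2.trans hy.2.2.symm)) x hx y hy
  have hCη : C * η = ε := by rw [hη]; field_simp
  calc essRangeDist μ h A B ≤ edist s t := e1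
    _ ≤ edist s (h x) + edist (h x) (h y) + edist (h y) t := edist_triangle4 _ _ _ _
    _ ≤ η + K * ((Lf * (ρ + η) + 5 * η) + (Lg * (ρ + η) + 5 * η)) + η := by
        gcongr
        · rw [edist_comm]; exact hxs
        · refine (H x hxS y hyS).trans ?_
          gcongr
    _ = K * (Lf + Lg) * ρ + (C * η : ℝ≥0) := by
        rw [hC]; push_cast; ring
    _ = K * (Lf + Lg) * ρ + ε := by rw [hCη]

theorem lipNumber_zero (μ : Measure α) (d : α → α → ℝ≥0∞) :
    lipNumber μ d (fun _ => 0) = 0 := by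
  refine le_antisymm ?_ bot_le
  refine iSup₂_le fun A B => iSup₂_le fun hA hB => iSup₂_le fun hA0 hB0 => iSup_le fun hρ => ?_
  have mem : ∀ {D : Set α}, 0 < μ D → (0 : ℝ) ∈ essRange μ (fun _ => (0 : ℝ)) D := by
    intro D hD U hU
    have : (fun _ : α => (0 : ℝ)) ⁻¹' U = Set.univ :=
      Set.eq_univ_of_forall fun _ => show (0 : ℝ) ∈ U from mem_of_mem_nhds hU
    rwa [this, Set.inter_univ]
  have : essRangeDist μ (fun _ => (0 : ℝ)) A B ≤ 0 :=
    ((iInf₂_le 0 (mem hA0)).trans (iInf₂_le 0 (mem hB0))).trans (by simp)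
  rw [nonpos_iff_eq_zero.1 this, ENNReal.zero_div]

/-! ### Lipschitz algebras -/

/-- `Lip(M)`: the elements of `L^∞` with finite Lipschitz number. -/
noncomputable def Lip (μ : Measure α) (d : α → α → ℝ≥0∞) : Submodule ℝ (Lp ℝ ⊤ μ) where
  carrier := {f | lipNumber μ d f < ⊤}
  zero_mem' := by
    have hS : μ {x | (0 : Lp ℝ ⊤ μ) x = 0}ᶜ = 0 := by
      have := Lp.coeFn_zero ℝ ⊤ μ
      simpa [Set.compl_ofPred] using (ae_iff.1 this)
    have := lipNumber_le_of_combination (μ := μ) (d := d) (f := fun _ => 0) (g := fun _ => 0)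
      measurable_const measurable_const (Lp.stronglyMeasurable (0 : Lp ℝ ⊤ μ)).measurable
      (by simp [lipNumber_zero]) (by simp [lipNumber_zero]) 0 _ hS
      (fun x hx y hy => by rw [show (0 : Lp ℝ ⊤ μ) x = 0 from hx, show (0 : Lp ℝ ⊤ μ) y = 0 from hy]; simp)
    exact this.trans_lt (by simp)
  add_mem' := by
    intro f g hf hg
    have := lipNumber_le_of_combination (μ := μ) (d := d)
      (Lp.stronglyMeasurable f).measurable (Lp.stronglyMeasurable g).measurable
      (Lp.stronglyMeasurable (f + g)).measurable hf hg 1 {x | (f + g : Lp ℝ ⊤ μ) x = f x + g x}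
      (ae_iff.1 (Lp.coeFn_add f g))
      (fun x hx y hy => by
        rw [show (f + g : Lp ℝ ⊤ μ) x = f x + g x from hx,
          show (f + g : Lp ℝ ⊤ μ) y = f y + g y from hy]
        simpa using edist_add_add_le _ _ _ _)
    exact this.trans_lt (ENNReal.mul_lt_top (by simp) (ENNReal.add_lt_top.2 ⟨hf, hg⟩))
  smul_mem' := by
    intro c f hf
    have := lipNumber_le_of_combination (μ := μ) (d := d)
      (Lp.stronglyMeasurable f).measurable (Lp.stronglyMeasurable f).measurable
      (Lp.stronglyMeasurable (c • f)).measurable hf hf ‖c‖₊ {x | (c • f : Lp ℝ ⊤ μ) x = c • f x}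
      (ae_iff.1 (Lp.coeFn_smul c f))
      (fun x hx y hy => by
        rw [show (c • f : Lp ℝ ⊤ μ) x = c • f x from hx,
          show (c • f : Lp ℝ ⊤ μ) y = c • f y from hy, edist_smul₀, ENNReal.smul_def, smul_eq_mul]
        gcongr
        exact le_self_add)
    exact this.trans_lt (ENNReal.mul_lt_top (by simp) (ENNReal.add_lt_top.2 ⟨hf, hf⟩))

theorem mul_mem_lip {μ : Measure α} {d : α → α → ℝ≥0∞} {f g : Lp ℝ ⊤ μ}
    (hf : f ∈ Lip μ d) (hg : g ∈ Lip μ d) : (f • g : Lp ℝ ⊤ μ) ∈ Lip μ d := by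
  have bd : ∀ u : Lp ℝ ⊤ μ, ∀ᵐ x ∂μ, ‖u x‖ₑ ≤ ‖u‖ₑ := fun u => by
    rw [Lp.enorm_def, eLpNorm_exponent_top]; exact ae_le_eLpNormEssSup
  have h0 : ∀ᵐ x ∂μ, (f • g : Lp ℝ ⊤ μ) x = f x * g x ∧ ‖f x‖ₑ ≤ ‖f‖ₑ ∧ ‖g x‖ₑ ≤ ‖g‖ₑ := by
    filter_upwards [Lp.coeFn_lpSMul (r := ⊤) f g, bd f, bd g] with x h1 h2 h3
    exact ⟨h1, h2, h3⟩
  have := lipNumber_le_of_combination (μ := μ) (d := d)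
    (Lp.stronglyMeasurable f).measurable (Lp.stronglyMeasurable g).measurable
    (Lp.stronglyMeasurable (f • g : Lp ℝ ⊤ μ)).measurable hf hg (‖f‖₊ + ‖g‖₊) _ (ae_iff.1 h0)
    (fun x hx y hy => by
      rw [hx.1, hy.1]
      have e : f x * g x - f y * g y = (f x - f y) * g x + f y * (g x - g y) := by ring
      rw [edist_eq_enorm_sub, edist_eq_enorm_sub, edist_eq_enorm_sub, e]
      refine (enorm_add_le _ _).trans ?_
      rw [enorm_mul, enorm_mul, mul_add]
      have e1 : ‖g x‖ₑ ≤ ((‖f‖₊ + ‖g‖₊ : ℝ≥0) : ℝ≥0∞) :=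
        hx.2.2.trans (by push_cast; exact le_add_self)
      have e2 : ‖f y‖ₑ ≤ ((‖f‖₊ + ‖g‖₊ : ℝ≥0) : ℝ≥0∞) :=
        hy.2.1.trans (by push_cast; exact le_self_add)
      rw [mul_comm ‖f x - f y‖ₑ]
      gcongr)
  exact this.trans_lt (ENNReal.mul_lt_top (by simp) (ENNReal.add_lt_top.2 ⟨hf, hg⟩))

/-- The product of the ring `Lip(M)`. -/
noncomputable def lipMul {μ : Measure α} {d : α → α → ℝ≥0∞} (f g : Lip μ d) : Lip μ d :=
  ⟨(f : Lp ℝ ⊤ μ) • (g : Lp ℝ ⊤ μ), mul_mem_lip f.2 g.2⟩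

/-- The norm `max (L(f), ‖f‖_∞)` of `Lip(M)`. -/
noncomputable def lipNorm {μ : Measure α} {d : α → α → ℝ≥0∞} (f : Lip μ d) : ℝ≥0∞ :=
  max (lipNumber μ d (f : Lp ℝ ⊤ μ)) ‖(f : Lp ℝ ⊤ μ)‖ₑ

/-! ### Metric derivations, vector fields and 1-forms -/

/-- The weak* topology of `L^∞` as the dual of `L^1`. -/
noncomputable abbrev weakStar (μ : Measure α) : TopologicalSpace (Lp ℝ ⊤ μ) :=
  TopologicalSpace.induced (fun (f : Lp ℝ ⊤ μ) (g : Lp ℝ 1 μ) => ∫ x, f x * g x ∂μ) inferInstance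

/-- The weak* topology on a ball of the dual space `Lip(M)`: it is the restriction of the weak*
topology of `L^∞`. -/
noncomputable abbrev lipBallWeakStar (μ : Measure α) (d : α → α → ℝ≥0∞) (r : ℝ≥0) :
    TopologicalSpace {f : Lip μ d // lipNorm f ≤ r} :=
  TopologicalSpace.induced (fun f => ((f : Lip μ d) : Lp ℝ ⊤ μ)) (weakStar μ)

/-- Weak* continuity of a linear map from `Lip(M)` to `L^∞`. A linear map between dual spaces is
weak* continuous as soon as it is so on every ball (Krein-Smulian). -/
def IsWeakStarContinuous {μ : Measure α} {d : α → α → ℝ≥0∞}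
    (δ : Lip μ d →ₗ[ℝ] Lp ℝ ⊤ μ) : Prop :=
  ∀ r : ℝ≥0, @Continuous _ _ (lipBallWeakStar μ d r) (weakStar μ)
    (fun f : {f : Lip μ d // lipNorm f ≤ r} => δ f)

theorem isWeakStarContinuous_iff {μ : Measure α} {d : α → α → ℝ≥0∞}
    {δ : Lip μ d →ₗ[ℝ] Lp ℝ ⊤ μ} : IsWeakStarContinuous δ ↔
      ∀ (r : ℝ≥0) (g : Lp ℝ 1 μ), @Continuous _ _ (lipBallWeakStar μ d r) inferInstance
        (fun f : {f : Lip μ d // lipNorm f ≤ r} => ∫ x, δ f x * g x ∂μ) := by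
  refine forall_congr' fun r => ?_
  let _ := lipBallWeakStar μ d r
  rw [weakStar, continuous_induced_rng, continuous_pi_iff]
  rfl

/-- The norm of a linear map from `Lip(M)` to `L^∞`. -/
noncomputable def opNorm {μ : Measure α} {d : α → α → ℝ≥0∞}
    (δ : Lip μ d →ₗ[ℝ] Lp ℝ ⊤ μ) : ℝ≥0∞ :=
  ⨆ (f : Lip μ d) (_ : lipNorm f ≤ 1), ‖δ f‖ₑ

theorem integrable_pairing {μ : Measure α} (f : Lp ℝ ⊤ μ) (g : Lp ℝ 1 μ) :
    Integrable (fun x => f x * g x) μ :=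
  (memLp_one_iff_integrable.1 (Lp.memLp ((f • g : Lp ℝ 1 μ)))).congr (Lp.coeFn_lpSMul f g)

/-- The module `X(M)` of measurable vector fields: all metric derivations, i.e. bounded weak*
continuous linear maps from `Lip(M)` to `L^∞(M)` with the derivation identity. -/
noncomputable def VectorField (μ : Measure α) (d : α → α → ℝ≥0∞) :
    Submodule ℝ (Lip μ d →ₗ[ℝ] Lp ℝ ⊤ μ) where
  carrier := {δ | (∀ f g : Lip μ d, δ (lipMul f g) =
      (f : Lp ℝ ⊤ μ) • δ g + (g : Lp ℝ ⊤ μ) • δ f) ∧ opNorm δ < ⊤ ∧ IsWeakStarContinuous δ}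
  zero_mem' := by
    refine ⟨fun f g => ?_, by simp [opNorm], isWeakStarContinuous_iff.2 fun r g => ?_⟩
    · simp [Lp.smul_zero]
    · let _ := lipBallWeakStar μ d r
      refine (continuous_const (y := (0 : ℝ))).congr fun f => ?_
      symm
      refine integral_eq_zero_of_ae ?_
      filter_upwards [Lp.coeFn_zero ℝ ⊤ μ] with x hx
      rw [LinearMap.zero_apply, hx]
      simp
  add_mem' := by
    rintro δ ε ⟨h1, h2, h3⟩ ⟨k1, k2, k3⟩
    refine ⟨fun f g => ?_, ?_, isWeakStarContinuous_iff.2 fun r g => ?_⟩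
    · simp only [LinearMap.add_apply, h1, k1, Lp.add_smul]
      abel
    · refine lt_of_le_of_lt ?_ (ENNReal.add_lt_top.2 ⟨h2, k2⟩)
      exact iSup₂_le fun f hf => (enorm_add_le _ _).trans
        (add_le_add (le_iSup₂_of_le f hf le_rfl) (le_iSup₂_of_le f hf le_rfl))
    · let _ := lipBallWeakStar μ d r
      have := ((isWeakStarContinuous_iff.1 h3) r g).add ((isWeakStarContinuous_iff.1 k3) r g)
      refine this.congr fun f => ?_
      rw [Pi.add_apply, ← integral_add (integrable_pairing _ _) (integrable_pairing _ _)]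
      refine integral_congr_ae ?_
      filter_upwards [Lp.coeFn_add (δ f) (ε f)] with x hx
      simp only [LinearMap.add_apply, hx, Pi.add_apply]
      ring
  smul_mem' := by
    rintro c δ ⟨h1, h2, h3⟩
    refine ⟨fun f g => ?_, ?_, isWeakStarContinuous_iff.2 fun r g => ?_⟩
    · simp only [LinearMap.smul_apply, h1, smul_add, Lp.smul_comm]
    · refine lt_of_le_of_lt ?_ (ENNReal.mul_lt_top (enorm_lt_top (x := c)) h2)
      refine iSup₂_le fun f hf => ?_
      rw [LinearMap.smul_apply, enorm_smul]
      refine mul_le_mul_right ?_ _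
      exact le_iSup₂_of_le f hf le_rfl
    · let _ := lipBallWeakStar μ d r
      have := ((isWeakStarContinuous_iff.1 h3) r g).const_mul c
      refine this.congr fun f => ?_
      rw [← integral_const_mul]
      refine integral_congr_ae ?_
      filter_upwards [Lp.coeFn_smul c (δ f)] with x hx
      simp only [LinearMap.smul_apply, hx, Pi.smul_apply, smul_eq_mul]
      ring

theorem lp_smul_left_comm {μ : Measure α} (a b c : Lp ℝ ⊤ μ) :
    (a • (b • c : Lp ℝ ⊤ μ) : Lp ℝ ⊤ μ) = b • (a • c : Lp ℝ ⊤ μ) := by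
  refine Lp.ext ?_
  filter_upwards [Lp.coeFn_lpSMul (r := ⊤) a (b • c : Lp ℝ ⊤ μ),
    Lp.coeFn_lpSMul (r := ⊤) b (a • c : Lp ℝ ⊤ μ), Lp.coeFn_lpSMul (r := ⊤) b c,
    Lp.coeFn_lpSMul (r := ⊤) a c] with x h1 h2 h3 h4
  simp only [Pi.smul_apply', smul_eq_mul] at h1 h2 h3 h4
  rw [h1, h2, h3, h4]; ring

theorem enorm_lp_smul_le {μ : Measure α} (a b : Lp ℝ ⊤ μ) :
    ‖(a • b : Lp ℝ ⊤ μ)‖ₑ ≤ ‖a‖ₑ * ‖b‖ₑ := by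
  rw [enorm_eq_nnnorm, enorm_eq_nnnorm, enorm_eq_nnnorm, ← ENNReal.coe_mul, ENNReal.coe_le_coe]
  exact Lp.norm_smul_le a b

/-- The action of `L^∞(M)` on `X(M)`: `(a · δ)(f) = a δ(f)`. -/
noncomputable def fieldSMul {μ : Measure α} {d : α → α → ℝ≥0∞} (a : Lp ℝ ⊤ μ)
    (δ : VectorField μ d) : VectorField μ d :=
  ⟨{ toFun := fun f => (a • (δ : Lip μ d →ₗ[ℝ] Lp ℝ ⊤ μ) f : Lp ℝ ⊤ μ)
     map_add' := fun f g => by rw [map_add, Lp.add_smul]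
     map_smul' := fun c f => by simp only [map_smul, Lp.smul_comm, RingHom.id_apply] }, by
    obtain ⟨δ, h1, h2, h3⟩ := δ
    refine ⟨fun f g => ?_, ?_, isWeakStarContinuous_iff.2 fun r g => ?_⟩
    · change (a • (δ (lipMul f g)) : Lp ℝ ⊤ μ) = _ • (a • δ g : Lp ℝ ⊤ μ) + _ • (a • δ f : Lp ℝ ⊤ μ)
      rw [h1, Lp.add_smul, lp_smul_left_comm a, lp_smul_left_comm a]
    · refine lt_of_le_of_lt ?_ (ENNReal.mul_lt_top (enorm_lt_top (x := a)) h2)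
      refine iSup₂_le fun f hf => (enorm_lp_smul_le _ _).trans ?_
      refine mul_le_mul_right ?_ _
      exact le_iSup₂_of_le f hf le_rfl
    · let _ := lipBallWeakStar μ d r
      have := (isWeakStarContinuous_iff.1 h3) r (a • g)
      refine this.congr fun f => integral_congr_ae ?_
      filter_upwards [Lp.coeFn_lpSMul (r := 1) a g,
        Lp.coeFn_lpSMul (r := ⊤) a (δ (f : Lip μ d))] with x h4 h5
      simp only [Pi.smul_apply', smul_eq_mul] at h4 h5
      change δ f x * (a • g : Lp ℝ 1 μ) x = (a • δ f : Lp ℝ ⊤ μ) x * g x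
      rw [h4, h5]; ring⟩

/-- The norm of a linear map from `X(M)` to `L^∞`. -/
noncomputable def formNorm {μ : Measure α} {d : α → α → ℝ≥0∞}
    (θ : VectorField μ d →ₗ[ℝ] Lp ℝ ⊤ μ) : ℝ≥0∞ :=
  ⨆ (δ : VectorField μ d) (_ : opNorm (δ : Lip μ d →ₗ[ℝ] Lp ℝ ⊤ μ) ≤ 1), ‖θ δ‖ₑ

/-- The module `Ω(M)` of measurable 1-forms: the bounded `L^∞(M)`-module homomorphisms from `X(M)`
to `L^∞(M)`. -/
noncomputable def OneForm (μ : Measure α) (d : α → α → ℝ≥0∞) :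
    Submodule ℝ (VectorField μ d →ₗ[ℝ] Lp ℝ ⊤ μ) where
  carrier := {θ | (∀ (a : Lp ℝ ⊤ μ) (δ : VectorField μ d), θ (fieldSMul a δ) = a • θ δ) ∧
    formNorm θ < ⊤}
  zero_mem' := ⟨fun a δ => by simp [Lp.smul_zero], by simp [formNorm]⟩
  add_mem' := by
    rintro θ η ⟨h1, h2⟩ ⟨k1, k2⟩
    refine ⟨fun a δ => by simp only [LinearMap.add_apply, h1, k1, Lp.add_smul], ?_⟩
    refine lt_of_le_of_lt ?_ (ENNReal.add_lt_top.2 ⟨h2, k2⟩)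
    exact iSup₂_le fun f hf => (enorm_add_le _ _).trans
      (add_le_add (le_iSup₂_of_le f hf le_rfl) (le_iSup₂_of_le f hf le_rfl))
  smul_mem' := by
    rintro c θ ⟨h1, h2⟩
    refine ⟨fun a δ => by simp only [LinearMap.smul_apply, h1, Lp.smul_comm], ?_⟩
    refine lt_of_le_of_lt ?_ (ENNReal.mul_lt_top (enorm_lt_top (x := c)) h2)
    refine iSup₂_le fun f hf => ?_
    rw [LinearMap.smul_apply, enorm_smul]
    refine mul_le_mul_right ?_ _
    exact le_iSup₂_of_le f hf le_rfl

/-- The action of `L^∞(M)` on `Ω(M)`: `(a · θ)(δ) = a θ(δ)`. -/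
noncomputable def formSMul {μ : Measure α} {d : α → α → ℝ≥0∞} (a : Lp ℝ ⊤ μ)
    (θ : OneForm μ d) : OneForm μ d :=
  ⟨{ toFun := fun δ => (a • (θ : VectorField μ d →ₗ[ℝ] Lp ℝ ⊤ μ) δ : Lp ℝ ⊤ μ)
     map_add' := fun f g => by rw [map_add, Lp.add_smul]
     map_smul' := fun c f => by simp only [map_smul, Lp.smul_comm, RingHom.id_apply] }, by
    obtain ⟨θ, h1, h2⟩ := θ
    refine ⟨fun b δ => ?_, ?_⟩
    · change (a • (θ (fieldSMul b δ)) : Lp ℝ ⊤ μ) = b • (a • θ δ : Lp ℝ ⊤ μ)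
      rw [h1, lp_smul_left_comm a]
    · refine lt_of_le_of_lt ?_ (ENNReal.mul_lt_top (enorm_lt_top (x := a)) h2)
      refine iSup₂_le fun f hf => (enorm_lp_smul_le _ _).trans ?_
      refine mul_le_mul_right ?_ _
      exact le_iSup₂_of_le f hf le_rfl⟩

theorem exists_lipNorm_smul_le_one {μ : Measure α} {d : α → α → ℝ≥0∞} (f : Lip μ d) :
    ∃ c : ℝ, c ≠ 0 ∧ lipNorm (c • f) ≤ 1 := by
  obtain ⟨f, hf⟩ := f
  have hf' : lipNumber μ d f < ⊤ := hf
  have hbd : ∀ c : ℝ, lipNumber μ d (c • f : Lp ℝ ⊤ μ) ≤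
      ‖c‖₊ * (lipNumber μ d f + lipNumber μ d f) := fun c =>
    lipNumber_le_of_combination (μ := μ) (d := d)
      (Lp.stronglyMeasurable f).measurable (Lp.stronglyMeasurable f).measurable
      (Lp.stronglyMeasurable (c • f)).measurable hf hf ‖c‖₊ {x | (c • f : Lp ℝ ⊤ μ) x = c • f x}
      (ae_iff.1 (Lp.coeFn_smul c f))
      (fun x hx y hy => by
        rw [show (c • f : Lp ℝ ⊤ μ) x = c • f x from hx,
          show (c • f : Lp ℝ ⊤ μ) y = c • f y from hy, edist_smul₀, ENNReal.smul_def, smul_eq_mul]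
        gcongr
        exact le_self_add)
  lift lipNumber μ d f to ℝ≥0 using hf'.ne with L hL
  set c : ℝ≥0 := (1 + 2 * L + ‖f‖₊)⁻¹ with hc
  have hc0 : 0 < 1 + 2 * L + ‖f‖₊ := by positivity
  refine ⟨c, by positivity, max_le ((hbd c).trans ?_) ?_⟩
  · rw [show ‖(c : ℝ)‖₊ = c by simp, ← ENNReal.coe_add, ← ENNReal.coe_mul, ← ENNReal.coe_one,
      ENNReal.coe_le_coe, hc, inv_mul_le_iff₀ hc0, mul_one]
    rw [two_mul, add_comm 1, add_assoc]
    exact le_self_add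
  · change ‖(c : ℝ) • f‖ₑ ≤ 1
    rw [enorm_smul, enorm_eq_nnnorm, enorm_eq_nnnorm, show ‖(c : ℝ)‖₊ = c by simp,
      ← ENNReal.coe_mul, ← ENNReal.coe_one, ENNReal.coe_le_coe, hc, inv_mul_le_iff₀ hc0, mul_one]
    exact le_add_self

/-- The exterior derivative `d : Lip(M) → Ω(M)`, `(df)(δ) = δ(f)`. -/
noncomputable def exteriorDeriv {μ : Measure α} {d : α → α → ℝ≥0∞} (f : Lip μ d) : OneForm μ d :=
  ⟨{ toFun := fun δ => (δ : Lip μ d →ₗ[ℝ] Lp ℝ ⊤ μ) f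
     map_add' := fun _ _ => rfl
     map_smul' := fun _ _ => rfl }, by
    refine ⟨fun a δ => rfl, ?_⟩
    obtain ⟨c, hc0, hc⟩ := exists_lipNorm_smul_le_one f
    have hlt : ‖c⁻¹‖ₑ * 1 < ⊤ := ENNReal.mul_lt_top (enorm_lt_top (x := c⁻¹)) (by simp)
    refine lt_of_le_of_lt (iSup₂_le fun δ hδ => ?_) hlt
    have e : (δ : Lip μ d →ₗ[ℝ] Lp ℝ ⊤ μ) f = c⁻¹ • (δ : Lip μ d →ₗ[ℝ] Lp ℝ ⊤ μ) (c • f) := by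
      rw [map_smul, smul_smul, inv_mul_cancel₀ hc0, one_smul]
    change ‖(δ : Lip μ d →ₗ[ℝ] Lp ℝ ⊤ μ) f‖ₑ ≤ _
    rw [e, enorm_smul]
    refine mul_le_mul_right (le_trans ?_ hδ) _
    exact le_iSup₂_of_le (c • f) hc le_rfl⟩

/-! ### Weakly 2-summable sequences -/

/-- `l²(L^∞)`: the sequences in `L^∞` that are weakly 2-summable, i.e. the partial sums of the
squares are uniformly bounded in `L^∞`. -/
noncomputable def WeakL2 (μ : Measure α) : Submodule ℝ (ℕ → Lp ℝ ⊤ μ) where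
  carrier := {g | ∃ C : ℝ, ∀ N : ℕ, ∀ᵐ x ∂μ, ∑ n ∈ Finset.range N, g n x ^ 2 ≤ C}
  zero_mem' := ⟨0, fun N => by
    filter_upwards [Lp.coeFn_zero ℝ ⊤ μ] with x hx
    refine (Finset.sum_eq_zero fun n _ => ?_).le
    rw [Pi.zero_apply, hx]
    simp⟩
  add_mem' := by
    rintro g h ⟨C, hC⟩ ⟨D, hD⟩
    refine ⟨2 * C + 2 * D, fun N => ?_⟩
    filter_upwards [hC N, hD N, ae_all_iff.2 fun n => Lp.coeFn_add (g n) (h n)] with x h1 h2 h3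
    calc ∑ n ∈ Finset.range N, ((g + h) n) x ^ 2
        ≤ ∑ n ∈ Finset.range N, (2 * g n x ^ 2 + 2 * h n x ^ 2) := by
          refine Finset.sum_le_sum fun n _ => ?_
          rw [show ((g + h) n) x = g n x + h n x from h3 n]
          nlinarith [sq_nonneg (g n x - h n x)]
      _ ≤ 2 * C + 2 * D := by
          rw [Finset.sum_add_distrib, ← Finset.mul_sum, ← Finset.mul_sum]
          linarith
  smul_mem' := by
    rintro c g ⟨C, hC⟩
    refine ⟨c ^ 2 * C, fun N => ?_⟩
    filter_upwards [hC N, ae_all_iff.2 fun n => Lp.coeFn_smul c (g n)] with x h1 h3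
    calc ∑ n ∈ Finset.range N, ((c • g) n) x ^ 2
        = c ^ 2 * ∑ n ∈ Finset.range N, g n x ^ 2 := by
          rw [Finset.mul_sum]
          refine Finset.sum_congr rfl fun n _ => ?_
          rw [show ((c • g) n) x = c * g n x from h3 n]
          ring
      _ ≤ c ^ 2 * C := mul_le_mul_of_nonneg_left h1 (sq_nonneg c)

/-- The action of `L^∞` on `l²(L^∞)`: `a · (g_n) = (a g_n)`. -/
noncomputable def weakL2SMul {μ : Measure α} (a : Lp ℝ ⊤ μ) (g : WeakL2 μ) : WeakL2 μ :=
  ⟨fun n => a • (g : ℕ → Lp ℝ ⊤ μ) n, by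
    obtain ⟨g, C, hC⟩ := g
    refine ⟨‖a‖ ^ 2 * C, fun N => ?_⟩
    have hC' := hC N
    have bd : ∀ᵐ x ∂μ, ‖a x‖ₑ ≤ ‖a‖ₑ := by
      rw [Lp.enorm_def, eLpNorm_exponent_top]; exact ae_le_eLpNormEssSup
    filter_upwards [hC N, ae_all_iff.2 fun n => Lp.coeFn_lpSMul (r := ⊤) a (g n), bd]
      with x h1 h3 h4
    have h4' : |a x| ≤ ‖a‖ := by
      rw [enorm_eq_nnnorm, enorm_eq_nnnorm, ENNReal.coe_le_coe] at h4
      exact h4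
    have h5 : a x ^ 2 ≤ ‖a‖ ^ 2 := by
      rw [← sq_abs]; exact pow_le_pow_left₀ (abs_nonneg _) h4' 2
    calc ∑ n ∈ Finset.range N, ((a • g n : Lp ℝ ⊤ μ) : α → ℝ) x ^ 2
        = a x ^ 2 * ∑ n ∈ Finset.range N, g n x ^ 2 := by
          rw [Finset.mul_sum]
          refine Finset.sum_congr rfl fun n _ => ?_
          rw [h3 n, Pi.smul_apply', smul_eq_mul]
          ring
      _ ≤ ‖a‖ ^ 2 * C := mul_le_mul h5 h1 (Finset.sum_nonneg fun n _ => sq_nonneg _) (by positivity)⟩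

/-- The norm of `(g_n)` in `l²(L^∞)`: the essential supremum of `(∑ |g_n|²)^{1/2}`. -/
noncomputable def weakL2Norm {μ : Measure α} (g : WeakL2 μ) : ℝ≥0∞ :=
  essSup (fun x => (∑' n, ‖(g : ℕ → Lp ℝ ⊤ μ) n x‖ₑ ^ 2) ^ (1 / 2 : ℝ)) μ

end General

/-! ### The Wiener space model -/

/-- The Hilbert space `l²(ℕ)`. -/
abbrev HilbertL2 : Type := lp (fun _ : ℕ => ℝ) 2

/-- The product of countably many copies of the standard Gaussian measure. -/
noncomputable def gaussianProduct : Measure (ℕ → ℝ) :=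
  Measure.infinitePi fun _ => gaussianReal 0 1

/-- The `l²` metric of `ℝ^ℕ`, with infinite distances. -/
noncomputable def l2Dist (a b : ℕ → ℝ) : ℝ≥0∞ := (∑' n, ‖a n - b n‖ₑ ^ 2) ^ (1 / 2 : ℝ)

/-- `φ` is smooth and bounded with bounded derivatives of all orders. -/
def IsSmoothBounded {n : ℕ} (φ : EuclideanSpace ℝ (Fin n) → ℝ) : Prop :=
  ContDiff ℝ ∞ φ ∧ ∀ k : ℕ, ∃ C : ℝ, ∀ x, ‖iteratedFDeriv ℝ k φ x‖ ≤ C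

/-- The first `n` coordinates of a point. -/
noncomputable def firstCoords (n : ℕ) (x : ℕ → ℝ) : EuclideanSpace ℝ (Fin n) :=
  WithLp.toLp 2 fun i => x i

/-- The gradient at `x` of the cylinder function `φ (x_0, …, x_{n-1})`, with values in `l²(ℕ)`. -/
noncomputable def cylinderGradient {n : ℕ} (φ : EuclideanSpace ℝ (Fin n) → ℝ) (x : ℕ → ℝ) :
    HilbertL2 :=
  ∑ i : Fin n, lp.single 2 (i : ℕ) (fderiv ℝ φ (firstCoords n x) (EuclideanSpace.single i 1))

/-- The graph of the gradient on smooth cylinder functions, in `L²(ℝ^ℕ) × L²(ℝ^ℕ; l²)`. -/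
def cylinderGradientGraph : Set (Lp ℝ 2 gaussianProduct × Lp HilbertL2 2 gaussianProduct) :=
  {p | ∃ (n : ℕ) (φ : EuclideanSpace ℝ (Fin n) → ℝ), IsSmoothBounded φ ∧
    p.1 =ᵐ[gaussianProduct] (fun x => φ (firstCoords n x)) ∧
    p.2 =ᵐ[gaussianProduct] cylinderGradient φ}

/-- `G` is the Gross-Sobolev derivative of `f`: the pair `(f, G)` belongs to the closure, in
`L²(ℝ^ℕ) × L²(ℝ^ℕ; l²)`, of the gradient on smooth cylinder functions. -/
def IsGrossSobolevDerivative (f : (ℕ → ℝ) → ℝ) (G : (ℕ → ℝ) → HilbertL2) : Prop :=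
  ∃ p ∈ closure cylinderGradientGraph, p.1 =ᵐ[gaussianProduct] f ∧ p.2 =ᵐ[gaussianProduct] G

end MetricCalculus

namespace MetricCalculus

/-! ### The Gaussian product measure -/

/-! The Lipschitz number is defined through sets modulo null sets. What makes it usable is that the
Gaussian product is quasi-invariant under shifts by finitely supported vectors. A set of positive
measure and its translate by `h` are at distance at most `‖h‖`, so Lipschitz number at most `L`
forces `|f (x + h) - f x| ≤ L ‖h‖` almost everywhere for each such `h` (`ae_abs_translate_sub_le`).
Averaging out all but `N` coordinates and mollifying the rest preserves both this bound and the sup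
bound, which gives smooth cylinder functions converging to `f` in `L²` with gradients bounded by `L`
(`exists_smooth_approx`). Weak compactness then puts `f` in the domain of the closed gradient, with
derivative `Df` bounded by the Lipschitz number (`exists_grossDerivative`).

Gaussian integration by parts makes `Df` unique and makes its pairings weak* continuous on balls.
Hence each bounded section `G` defines a derivation `f ↦ ⟨G, Df⟩` of norm at most `‖G‖`
(`sectionField`).

Conversely, let `δ` be a derivation. The coordinate `x_n` is unbounded, so `g_n = cos x_n δ(sin x_n)
- sin x_n δ(cos x_n)` plays the part of `δ(x_n)`. Subtracting a section field with the same
components leaves a field that annihilates `sin x_n` and `cos x_n`. The annihilated functions form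
an algebra closed under bounded pointwise limits with uniform Lipschitz constants. Half-angle
formulas, square roots and lattice operations show that they include every bounded Lipschitz
function of finitely many coordinates (`kills_of_coord`). Evaluating `δ` on `sin (⟨c, x⟩ - q)` with
`‖c‖ ≤ 1` and letting `q` approach `⟨c, x⟩` yields `|∑ c_n g_n| ≤ ‖δ‖`, so `(g_n)` lies in `l²(L^∞)`
with norm at most `‖δ‖`. By approximation and weak* continuity `δ` is the field of `(g_n)`
(`exists_sectionField_eq`), and the two norm inequalities together give the isometry.

For the dual, multiplication by indicators localizes a bounded module map: `|Λ G (x)| ≤ F ‖G x‖`. So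
`Λ` acts fiberwise and is the inner product with `(Λ e_n)` (`exists_sectionInner_eq`). Since every
field is `⟨G, D·⟩`, the section that represents `df` is `Df`. -/

theorem pi_absolutelyContinuous {n : ℕ} {μ ν : Measure ℝ} [SigmaFinite μ] [SigmaFinite ν]
    (h : μ ≪ ν) : Measure.pi (fun _ : Fin n => μ) ≪ Measure.pi (fun _ : Fin n => ν) := by
  induction n with
  | zero => rw [Measure.pi_of_empty, Measure.pi_of_empty]
  | succ n ih =>
    have h1 := (measurePreserving_piFinSuccAbove (fun _ : Fin (n + 1) => μ) 0).symm
    have h2 := (measurePreserving_piFinSuccAbove (fun _ : Fin (n + 1) => ν) 0).symm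
    rw [← h1.map_eq, ← h2.map_eq]
    exact (h.prod ih).map (MeasurableEquiv.measurable _)

instance isProbabilityMeasure_gaussianProduct : IsProbabilityMeasure gaussianProduct := by
  unfold gaussianProduct; infer_instance

theorem measurable_piecewise_prod (s : Set ℕ) [DecidablePred (· ∈ s)] :
    Measurable (fun p : (ℕ → ℝ) × (ℕ → ℝ) => s.piecewise p.1 p.2) := by
  refine measurable_pi_iff.2 fun i => ?_
  by_cases hi : i ∈ s <;> simp only [Set.piecewise, hi, if_true, if_false] <;> fun_prop

/-- Coordinates inside and outside `s` are independent: the preimage of a finite-dimensional box is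
the product of one box for each group, and such boxes determine the product measure. -/
theorem measurePreserving_piecewise (s : Set ℕ) [DecidablePred (· ∈ s)] :
    MeasurePreserving (fun p : (ℕ → ℝ) × (ℕ → ℝ) => s.piecewise p.1 p.2)
      (gaussianProduct.prod gaussianProduct) gaussianProduct := by
  refine ⟨measurable_piecewise_prod s, ?_⟩
  refine Measure.eq_infinitePi _ fun I t ht => ?_
  have e : (fun p : (ℕ → ℝ) × (ℕ → ℝ) => s.piecewise p.1 p.2) ⁻¹' (Set.pi (I : Set ℕ) t) =
      (Set.pi (I.filter (· ∈ s) : Finset ℕ) t) ×ˢ (Set.pi (I.filter (· ∉ s) : Finset ℕ) t) := by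
    ext p
    simp only [Set.mem_preimage, Set.mem_pi, Finset.mem_coe, Set.mem_prod, Finset.mem_filter]
    constructor
    · intro h
      refine ⟨fun i hi => ?_, fun i hi => ?_⟩
      · simpa [hi.2] using h i hi.1
      · simpa [hi.2] using h i hi.1
    · rintro ⟨h1, h2⟩ i hi
      by_cases his : i ∈ s
      · simpa [his] using h1 i ⟨hi, his⟩
      · simpa [his] using h2 i ⟨hi, his⟩
  rw [Measure.map_apply (measurable_piecewise_prod s)
    (MeasurableSet.pi I.countable_toSet fun i _ => ht i), e, Measure.prod_prod, gaussianProduct,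
    Measure.infinitePi_pi _ (fun i _ => ht i), Measure.infinitePi_pi _ (fun i _ => ht i)]
  exact Finset.prod_filter_mul_prod_filter_not I (· ∈ s) _

theorem map_eval_gaussianProduct (n : ℕ) :
    gaussianProduct.map (fun x => x n) = gaussianReal 0 1 :=
  Measure.infinitePi_map_eval _ n

/-- Disintegration along one coordinate, the case `s = {n}` of `measurePreserving_piecewise`. It
reduces shifts and integration by parts to the real line. -/
theorem measurePreserving_update (n : ℕ) :
    MeasurePreserving (fun p : ℝ × (ℕ → ℝ) => Function.update p.2 n p.1)
      ((gaussianReal 0 1).prod gaussianProduct) gaussianProduct := by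
  have hm : Measurable (fun p : ℝ × (ℕ → ℝ) => Function.update p.2 n p.1) := by
    refine measurable_pi_iff.2 fun i => ?_
    by_cases hi : i = n
    · subst hi; simpa using measurable_fst
    · simp only [Function.update_of_ne hi]; fun_prop
  refine ⟨hm, ?_⟩
  have h1 := (measurePreserving_piecewise {n}).map_eq
  rw [← map_eval_gaussianProduct n]
  conv_lhs => rw [← Measure.map_id (μ := gaussianProduct)]
  rw [Measure.map_id]
  have h2 : (gaussianProduct.map (fun x => x n)).prod gaussianProduct =
      (gaussianProduct.prod gaussianProduct).map (Prod.map (fun x : ℕ → ℝ => x n) id) := by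
    rw [← Measure.map_prod_map _ _ (measurable_pi_apply n) measurable_id, Measure.map_id]
  rw [h2, Measure.map_map hm (by fun_prop)]
  conv_rhs => rw [← h1]
  congr 1
  ext p i
  by_cases hi : i = n
  · subst hi; simp
  · simp [hi]

theorem gaussianProduct_map_add_single_absolutelyContinuous (n : ℕ) (t : ℝ) :
    gaussianProduct.map (fun x => x + Pi.single n t) ≪ gaussianProduct := by
  have h := measurePreserving_update n
  have hm : Measurable fun x : ℕ → ℝ => x + Pi.single n t := by fun_prop
  conv_lhs => rw [← h.map_eq]
  conv_rhs => rw [← h.map_eq]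
  rw [Measure.map_map hm h.measurable]
  -- Under the disintegration the shift acts on the real factor alone, where two Gaussians of
  -- nonzero variance are both equivalent to Lebesgue measure.
  have e : (fun x : ℕ → ℝ => x + Pi.single n t) ∘
      (fun p : ℝ × (ℕ → ℝ) => Function.update p.2 n p.1) =
      (fun p : ℝ × (ℕ → ℝ) => Function.update p.2 n p.1) ∘ Prod.map (fun s => s + t) id := by
    ext p i
    by_cases hi : i = n
    · subst hi; simp
    · simp [hi]
  rw [e, ← Measure.map_map h.measurable (by fun_prop),
    ← Measure.map_prod_map _ _ (by fun_prop) measurable_id, Measure.map_id,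
    gaussianReal_map_add_const]
  refine Measure.AbsolutelyContinuous.map ?_ h.measurable
  exact ((gaussianReal_absolutelyContinuous _ one_ne_zero).trans
    (gaussianReal_absolutelyContinuous' _ one_ne_zero)).prod .rfl

/-- The extension by zero of a vector of finitely many coordinates. -/
noncomputable def extendZero (N : ℕ) (h : EuclideanSpace ℝ (Fin N)) : ℕ → ℝ :=
  fun i => if hi : i < N then h ⟨i, hi⟩ else 0

theorem extendZero_of_lt {N : ℕ} (h : EuclideanSpace ℝ (Fin N)) {i : ℕ} (hi : i < N) :
    extendZero N h i = h ⟨i, hi⟩ := dif_pos hi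

@[simp] theorem extendZero_val {N : ℕ} (h : EuclideanSpace ℝ (Fin N)) (i : Fin N) :
    extendZero N h i = h i := dif_pos i.2

theorem extendZero_of_le {N : ℕ} (h : EuclideanSpace ℝ (Fin N)) {i : ℕ} (hi : N ≤ i) :
    extendZero N h i = 0 := dif_neg hi.not_gt

theorem measurable_extendZero (N : ℕ) : Measurable (extendZero N) := by
  refine measurable_pi_iff.2 fun i => ?_
  by_cases hi : i < N
  · simp only [extendZero, hi, dite_true]; fun_prop
  · simp only [extendZero, hi, dite_false]; fun_prop

theorem extendZero_eq_sum {N : ℕ} (h : EuclideanSpace ℝ (Fin N)) :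
    extendZero N h = ∑ i : Fin N, Pi.single (i : ℕ) (h i) := by
  ext j
  rw [Finset.sum_apply]
  by_cases hj : j < N
  · rw [extendZero_of_lt h hj, Finset.sum_eq_single ⟨j, hj⟩]
    · simp
    · intro i _ hi
      rw [Pi.single_eq_of_ne]
      rintro rfl
      exact hi rfl
    · simp
  · rw [extendZero_of_le h (not_lt.1 hj), Finset.sum_eq_zero]
    intro i _
    rw [Pi.single_eq_of_ne]
    rintro rfl
    exact hj i.2

theorem gaussianProduct_map_add_absolutelyContinuous {N : ℕ} (h : EuclideanSpace ℝ (Fin N)) :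
    gaussianProduct.map (fun x => x + extendZero N h) ≪ gaussianProduct := by
  rw [extendZero_eq_sum]
  generalize (Finset.univ : Finset (Fin N)) = s
  induction s using Finset.induction_on with
  | empty => simp only [Finset.sum_empty, add_zero, Measure.map_id']; exact .rfl
  | insert i s hi ih =>
    rw [Finset.sum_insert hi]
    have e : (fun x : ℕ → ℝ => x + (Pi.single (i : ℕ) (h i) + ∑ x ∈ s, Pi.single (x : ℕ) (h x))) =
        (fun x => x + ∑ x ∈ s, Pi.single (x : ℕ) (h x)) ∘ fun x => x + Pi.single (i : ℕ) (h i) := by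
      ext x; simp [add_assoc]
    rw [e, ← Measure.map_map (by fun_prop) (by fun_prop)]
    exact ((gaussianProduct_map_add_single_absolutelyContinuous i (h i)).map (by fun_prop)).trans ih

/-! ### Laws of finitely many coordinates, gluing and cylinder sets -/

theorem measurable_firstCoords (N : ℕ) : Measurable (firstCoords N) := by
  unfold firstCoords; fun_prop

@[simp] theorem firstCoords_apply (N : ℕ) (x : ℕ → ℝ) (i : Fin N) : firstCoords N x i = x i := rfl

/-- The law of the first `N` coordinates. -/
noncomputable def gaussianLaw (N : ℕ) : Measure (EuclideanSpace ℝ (Fin N)) :=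
  gaussianProduct.map (firstCoords N)

instance isProbabilityMeasure_gaussianLaw (N : ℕ) : IsProbabilityMeasure (gaussianLaw N) :=
  Measure.isProbabilityMeasure_map (measurable_firstCoords N).aemeasurable

/-- Mollification integrates against Lebesgue measure, while the shift estimates hold almost
everywhere for the Gaussian law; this transfers them. -/
theorem volume_absolutelyContinuous_gaussianLaw (N : ℕ) :
    (volume : Measure (EuclideanSpace ℝ (Fin N))) ≪ gaussianLaw N := by
  have e : gaussianLaw N =
      (Measure.pi fun _ : Fin N => gaussianReal 0 1).map (WithLp.toLp 2) := by
    have h : gaussianProduct.map (fun x (i : Fin N) => x i) =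
        Measure.pi fun _ : Fin N => gaussianReal 0 1 := by
      refine (Measure.pi_eq fun t ht => ?_).symm
      rw [Measure.map_apply (by fun_prop) (MeasurableSet.univ_pi ht)]
      -- The default `∅` is never used, because only indices below `N` are constrained.
      have e2 : (fun (x : ℕ → ℝ) (i : Fin N) => x i) ⁻¹' Set.univ.pi t =
          Set.pi (Finset.range N : Set ℕ) (fun i => if hi : i < N then t ⟨i, hi⟩ else ∅) := by
        ext x
        simp only [Set.mem_preimage, Set.mem_pi, Set.mem_univ, true_implies, Finset.coe_range,
          Set.mem_Iio]
        exact ⟨fun h i hi => by simpa [hi] using h ⟨i, hi⟩,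
          fun h i => by simpa using h i i.2⟩
      rw [e2, gaussianProduct, Measure.infinitePi_pi, Finset.prod_range]
      · refine Finset.prod_congr rfl fun i _ => ?_
        simp
      · intro i hi
        simp only [Finset.mem_range.1 hi, dite_true]
        exact ht _
    rw [← h, Measure.map_map (by fun_prop) (by fun_prop)]
    rfl
  rw [e, ← (PiLp.volume_preserving_toLp (Fin N)).map_eq]
  exact (pi_absolutelyContinuous (gaussianReal_absolutelyContinuous' 0 one_ne_zero)).map
    (by fun_prop)

/-- The sequence with first `N` coordinates `y`, continued by the coordinates of `z`. -/
noncomputable def glue (N : ℕ) (y : EuclideanSpace ℝ (Fin N)) (z : ℕ → ℝ) : ℕ → ℝ :=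
  (Set.Iio N).piecewise (extendZero N y) z

theorem measurable_glue (N : ℕ) :
    Measurable (fun p : EuclideanSpace ℝ (Fin N) × (ℕ → ℝ) => glue N p.1 p.2) :=
  (measurable_piecewise_prod (Set.Iio N)).comp
    (((measurable_extendZero N).comp measurable_fst).prodMk measurable_snd)

@[simp] theorem firstCoords_glue (N : ℕ) (y : EuclideanSpace ℝ (Fin N)) (z : ℕ → ℝ) :
    firstCoords N (glue N y z) = y := by
  ext i
  simp [glue]

theorem glue_add (N : ℕ) (y h : EuclideanSpace ℝ (Fin N)) (z : ℕ → ℝ) :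
    glue N (y + h) z = glue N y z + extendZero N h := by
  ext i
  by_cases hi : i < N
  · simp [glue, hi, extendZero_of_lt]
  · simp [glue, hi, extendZero_of_le _ (not_lt.1 hi)]

theorem measurePreserving_glue (N : ℕ) :
    MeasurePreserving (fun p : EuclideanSpace ℝ (Fin N) × (ℕ → ℝ) => glue N p.1 p.2)
      ((gaussianLaw N).prod gaussianProduct) gaussianProduct := by
  refine ⟨measurable_glue N, ?_⟩
  have h2 : (gaussianLaw N).prod gaussianProduct =
      (gaussianProduct.prod gaussianProduct).map (Prod.map (firstCoords N) id) := by
    rw [← Measure.map_prod_map _ _ (measurable_firstCoords N) measurable_id, Measure.map_id]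
    rfl
  rw [h2, Measure.map_map (measurable_glue N) ((measurable_firstCoords N).prodMap measurable_id)]
  conv_rhs => rw [← (measurePreserving_piecewise (Set.Iio N)).map_eq]
  congr 1
  ext p i
  by_cases hi : i < N
  · simp [glue, hi, extendZero_of_lt]
  · simp [glue, hi]

/-- Averages over all coordinates but the first `N`. -/
noncomputable def average (N : ℕ) (f : (ℕ → ℝ) → ℝ) (y : EuclideanSpace ℝ (Fin N)) : ℝ :=
  ∫ z, f (glue N y z) ∂gaussianProduct

/-- Fubini for gluing: `average N f` is the conditional expectation of `f` given the first `N`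
coordinates, as a function of those coordinates. -/
theorem integral_firstCoords_smul {N : ℕ} {f : (ℕ → ℝ) → ℝ} (hf : Integrable f gaussianProduct)
    {g : EuclideanSpace ℝ (Fin N) → ℝ} (hg : Measurable g) {C : ℝ} (hC : ∀ y, |g y| ≤ C) :
    ∫ x, g (firstCoords N x) * f x ∂gaussianProduct = ∫ y, g y * average N f y ∂gaussianLaw N := by
  have hm := measurePreserving_glue N
  have hint : Integrable (fun x => g (firstCoords N x) * f x) gaussianProduct :=
    hf.bdd_mul (hg.comp (measurable_firstCoords N)).aestronglyMeasurable
      (Eventually.of_forall fun x => hC _)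
  rw [← hm.map_eq] at hint ⊢
  rw [integral_map hm.measurable.aemeasurable hint.1]
  have h2 := hint.comp_measurable hm.measurable
  refine (integral_prod _ h2).trans (integral_congr_ae (Eventually.of_forall fun y => ?_))
  simp only [Function.comp_apply, firstCoords_glue]
  rw [integral_const_mul, average]

theorem integrable_average {N : ℕ} {f : (ℕ → ℝ) → ℝ} (hf : Integrable f gaussianProduct) :
    Integrable (average N f) (gaussianLaw N) := by
  have hm := measurePreserving_glue N
  rw [← hm.map_eq] at hf
  exact (hf.comp_measurable hm.measurable).integral_prod_left

/-- The first `N` coordinates determine the first `M`. -/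
noncomputable def restrictCoords {M N : ℕ} (h : M ≤ N) :
    EuclideanSpace ℝ (Fin N) →L[ℝ] EuclideanSpace ℝ (Fin M) :=
  LinearMap.toContinuousLinearMap
    { toFun := fun y => WithLp.toLp 2 fun i => y (Fin.castLE h i)
      map_add' := fun _ _ => rfl
      map_smul' := fun _ _ => rfl }

theorem restrictCoords_apply {M N : ℕ} (h : M ≤ N) (y : EuclideanSpace ℝ (Fin N)) (i : Fin M) :
    restrictCoords h y i = y (Fin.castLE h i) := rfl

/-- Sets that are determined by finitely many coordinates. -/
def cylinderSets : Set (Set (ℕ → ℝ)) :=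
  {A | ∃ (N : ℕ) (B : Set (EuclideanSpace ℝ (Fin N))), MeasurableSet B ∧ A = firstCoords N ⁻¹' B}

theorem isPiSystem_cylinderSets : IsPiSystem cylinderSets := by
  rintro _ ⟨M, B, hB, rfl⟩ _ ⟨N, C, hC, rfl⟩ -
  refine ⟨max M N, restrictCoords (le_max_left M N) ⁻¹' B ∩ restrictCoords (le_max_right M N) ⁻¹' C,
    ((restrictCoords _).measurable hB).inter ((restrictCoords _).measurable hC), rfl⟩

theorem generateFrom_cylinderSets :
    (inferInstance : MeasurableSpace (ℕ → ℝ)) = MeasurableSpace.generateFrom cylinderSets := by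
  refine le_antisymm ?_ (MeasurableSpace.generateFrom_le ?_)
  · refine iSup_le fun i => ?_
    rintro _ ⟨S, hS, rfl⟩
    refine MeasurableSpace.measurableSet_generateFrom
      ⟨i + 1, (fun y => y (Fin.last i)) ⁻¹' S, ?_, rfl⟩
    exact (by fun_prop : Measurable fun y : EuclideanSpace ℝ (Fin (i + 1)) => y (Fin.last i)) hS
  · rintro _ ⟨N, B, hB, rfl⟩
    exact measurable_firstCoords N hB

/-- An integrable function that is orthogonal to all compactly supported smooth cylinder functions
vanishes. -/
theorem ae_eq_zero_of_forall_integral_cylinder {f : (ℕ → ℝ) → ℝ}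
    (hf : Integrable f gaussianProduct)
    (h : ∀ (N : ℕ) (g : EuclideanSpace ℝ (Fin N) → ℝ), ContDiff ℝ ∞ g → HasCompactSupport g →
      ∫ x, g (firstCoords N x) * f x ∂gaussianProduct = 0) : f =ᵐ[gaussianProduct] 0 := by
  -- In finite dimensions smooth compactly supported functions suffice as tests, so every average
  -- vanishes. Hence so do the integrals of `f` over cylinder sets, and a π-λ argument extends this
  -- to all measurable sets.
  have h0 : ∀ N, average N f =ᵐ[gaussianLaw N] 0 := by
    intro N
    refine ae_eq_zero_of_integral_contDiff_smul_eq_zero (integrable_average hf).locallyIntegrable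
      fun g hg hgc => ?_
    obtain ⟨C, hC⟩ := hgc.exists_bound_of_continuous hg.continuous
    simp only [smul_eq_mul]
    rw [← integral_firstCoords_smul hf hg.continuous.measurable hC]
    exact h N g hg hgc
  have hcyl : ∀ A ∈ cylinderSets, ∫ x in A, f x ∂gaussianProduct = 0 := by
    rintro _ ⟨N, B, hB, rfl⟩
    have := integral_firstCoords_smul hf (g := B.indicator 1)
      (measurable_one.indicator hB) (C := 1) (fun y => by
        by_cases hy : y ∈ B <;> simp [hy])
    have hz : ∫ y, B.indicator 1 y * average N f y ∂gaussianLaw N = 0 :=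
      integral_eq_zero_of_ae (by filter_upwards [h0 N] with y hy; simp [hy])
    rw [hz] at this
    rw [← integral_indicator (measurable_firstCoords N hB), ← this]
    refine integral_congr_ae (Eventually.of_forall fun x => ?_)
    by_cases hx : firstCoords N x ∈ B <;> simp [hx]
  have hall : ∀ A, MeasurableSet A → ∫ x in A, f x ∂gaussianProduct = 0 := by
    have huniv : ∫ x, f x ∂gaussianProduct = 0 := by
      rw [← setIntegral_univ]
      exact hcyl _ ⟨0, Set.univ, MeasurableSet.univ, rfl⟩
    intro A hA
    induction A, hA using MeasurableSpace.induction_on_inter generateFrom_cylinderSets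
      isPiSystem_cylinderSets with
    | empty => simp
    | basic A hA => exact hcyl A hA
    | compl A hA ih => rw [setIntegral_compl hA hf, ih, huniv, sub_zero]
    | iUnion s hd hs ih =>
      rw [integral_iUnion hs hd hf.integrableOn]
      simp [ih]
  exact hf.ae_eq_zero_of_forall_setIntegral_eq_zero fun s hs _ => hall s hs

/-! ### Lipschitz numbers -/

section General

variable {α : Type*} [MeasurableSpace α] {μ : Measure α} {d : α → α → ℝ≥0∞}

theorem lipNumber_congr {f g : α → ℝ} (h : f =ᵐ[μ] g) : lipNumber μ d f = lipNumber μ d g := by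
  have e : ∀ A, essRange μ f A = essRange μ g A := by
    intro A
    ext a
    refine forall₂_congr fun U _ => ?_
    have : (A ∩ f ⁻¹' U : Set α) =ᵐ[μ] (A ∩ g ⁻¹' U : Set α) := by
      filter_upwards [h] with x hx
      exact propext (and_congr_right fun _ => by
        change f x ∈ U ↔ g x ∈ U
        rw [hx])
    rw [measure_congr this]
  simp only [lipNumber, essRangeDist, e]

theorem div_setDist_le_lipNumber {f : α → ℝ} {A B : Set α} (hA : MeasurableSet A)
    (hB : MeasurableSet B) (hA0 : 0 < μ A) (hB0 : 0 < μ B) (h : 0 < setDist μ d A B) :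
    essRangeDist μ f A B / setDist μ d A B ≤ lipNumber μ d f :=
  le_iSup₂_of_le A B (le_iSup₂_of_le hA hB (le_iSup₂_of_le hA0 hB0 (le_iSup_of_le h le_rfl)))

/-- As the support of a measure on `ℝ`, the essential range is closed and carries all the mass. -/
theorem essRange_eq_support {f : α → ℝ} (hf : Measurable f) {A : Set α} :
    essRange μ f A = ((μ.restrict A).map f).support := by
  ext a
  rw [Measure.mem_support_iff_forall]
  constructor
  · intro h U hU
    obtain ⟨V, hVU, hV, haV⟩ := mem_nhds_iff.1 hU
    refine (h V (hV.mem_nhds haV)).trans_le (le_trans ?_ (measure_mono hVU))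
    rw [Measure.map_apply hf hV.measurableSet, Measure.restrict_apply (hf hV.measurableSet),
      Set.inter_comm]
  · intro h U hU
    obtain ⟨V, hVU, hV, haV⟩ := mem_nhds_iff.1 hU
    have := h V (hV.mem_nhds haV)
    rw [Measure.map_apply hf hV.measurableSet,
      Measure.restrict_apply (hf hV.measurableSet)] at this
    exact this.trans_le (measure_mono fun x hx => ⟨hx.2, hVU hx.1⟩)

theorem inter_preimage_essRange_ae_eq {f : α → ℝ} (hf : Measurable f) {A : Set α} :
    (A ∩ f ⁻¹' essRange μ f A : Set α) =ᵐ[μ] A := by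
  have hc : IsClosed (essRange μ f A) := by
    rw [essRange_eq_support hf]; exact Measure.isClosed_support
  have h : (μ.restrict A).map f (essRange μ f A)ᶜ = 0 := by
    rw [essRange_eq_support hf]; exact Measure.measure_compl_support
  rw [Measure.map_apply hf hc.measurableSet.compl,
    Measure.restrict_apply (hf hc.measurableSet.compl)] at h
  have h2 : ∀ᵐ x ∂μ, x ∉ f ⁻¹' (essRange μ f A)ᶜ ∩ A := measure_eq_zero_iff_ae_notMem.1 h
  filter_upwards [h2] with x hx
  refine propext ⟨fun h => h.1, fun h => ⟨h, ?_⟩⟩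
  by_contra h3
  exact hx ⟨h3, h⟩

/-- Discard from `A` and `B` the null sets where `f` leaves its essential range. These
representatives compete in `setDist`, and on them the pointwise bound compares the two distances
directly. -/
theorem lipNumber_le_of_edist_le {f : α → ℝ} (hf : Measurable f) {K : ℝ≥0}
    (h : ∀ x y, edist (f x) (f y) ≤ K * d x y) : lipNumber μ d f ≤ K := by
  -- The slack `ε` keeps the divisor `K + ε` nonzero when `K = 0`.
  refine ENNReal.le_of_forall_pos_le_add fun ε hε _ => ?_
  have hK : ((K + ε : ℝ≥0) : ℝ≥0∞) ≠ 0 := by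
    rw [Ne, ENNReal.coe_eq_zero]; positivity
  rw [← ENNReal.coe_add]
  refine iSup₂_le fun A B => iSup₂_le fun hA hB => iSup₂_le fun hA0 hB0 => iSup_le fun hρ => ?_
  refine ENNReal.div_le_of_le_mul ?_
  have hm : ∀ D : Set α, MeasurableSet (f ⁻¹' essRange μ f D) := fun D => by
    rw [essRange_eq_support hf]; exact hf Measure.isClosed_support.measurableSet
  have key : essRangeDist μ f A B / (K + ε : ℝ≥0) ≤ setDist μ d A B := by
    refine le_trans ?_ (le_iSup₂_of_le (A ∩ f ⁻¹' essRange μ f A) (B ∩ f ⁻¹' essRange μ f B)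
      (le_iSup₂_of_le (hA.inter (hm A)) (hB.inter (hm B)) (le_iSup₂_of_le
        (inter_preimage_essRange_ae_eq hf) (inter_preimage_essRange_ae_eq hf) le_rfl)))
    refine le_iInf₂ fun x hx => le_iInf₂ fun y hy => ENNReal.div_le_of_le_mul' ?_
    refine ((iInf₂_le (f x) hx.2).trans (iInf₂_le (f y) hy.2)).trans ((h x y).trans ?_)
    gcongr
    exact le_self_add
  rw [ENNReal.div_le_iff hK ENNReal.coe_ne_top] at key
  rwa [mul_comm]

/-- By dominated convergence, almost everywhere convergence inside a ball of the Lipschitz algebra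
implies weak* convergence there, so `δ` preserves the limit. -/
theorem IsWeakStarContinuous.tendsto_integral {δ : Lip μ d →ₗ[ℝ] Lp ℝ ⊤ μ} [IsFiniteMeasure μ]
    (hδ : IsWeakStarContinuous δ) {f : ℕ → Lip μ d} {g : Lip μ d} {r : ℝ≥0}
    (hf : ∀ k, lipNorm (f k) ≤ r) (hg : lipNorm g ≤ r)
    (hlim : ∀ᵐ x ∂μ, Tendsto (fun k => (f k : Lp ℝ ⊤ μ) x) atTop (𝓝 ((g : Lp ℝ ⊤ μ) x)))
    (ψ : Lp ℝ 1 μ) :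
    Tendsto (fun k => ∫ x, δ (f k) x * ψ x ∂μ) atTop (𝓝 (∫ x, δ g x * ψ x ∂μ)) := by
  let t := lipBallWeakStar μ d r
  have h1 := isWeakStarContinuous_iff.1 hδ r ψ
  have h2 : Tendsto (fun k => (⟨f k, hf k⟩ : {f : Lip μ d // lipNorm f ≤ r})) atTop
      (𝓝 ⟨g, hg⟩) := by
    have ht : t = TopologicalSpace.induced (fun (f : {f : Lip μ d // lipNorm f ≤ r})
        (φ : Lp ℝ 1 μ) => ∫ x, ((f : Lip μ d) : Lp ℝ ⊤ μ) x * φ x ∂μ) inferInstance :=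
      induced_compose
    rw [ht, nhds_induced, tendsto_comap_iff, tendsto_pi_nhds]
    intro φ
    refine tendsto_integral_of_dominated_convergence (fun x => r * ‖φ x‖) (fun k => ?_)
      ((L1.integrable_coeFn φ).norm.const_mul _) (fun k => ?_) ?_
    · exact (integrable_pairing _ _).aestronglyMeasurable
    · have bd : ∀ᵐ x ∂μ, ‖(f k : Lp ℝ ⊤ μ) x‖ₑ ≤ ‖(f k : Lp ℝ ⊤ μ)‖ₑ := by
        rw [Lp.enorm_def, eLpNorm_exponent_top]; exact ae_le_eLpNormEssSup
      filter_upwards [bd] with x hx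
      change ‖(f k : Lp ℝ ⊤ μ) x * φ x‖ ≤ _
      rw [norm_mul]
      gcongr
      have := hx.trans ((le_max_right _ _).trans (hf k))
      rw [enorm_eq_nnnorm, ENNReal.coe_le_coe] at this
      exact this
    · filter_upwards [hlim] with x hx using hx.mul_const _
  exact (h1.tendsto _).comp h2

/-- Over a finite measure `f` is itself an admissible `L¹` test function. -/
theorem eq_zero_of_forall_integral_mul_eq_zero [IsFiniteMeasure μ] {f : Lp ℝ ⊤ μ}
    (h : ∀ ψ : Lp ℝ 1 μ, ∫ x, f x * ψ x ∂μ = 0) : f = 0 := by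
  have h1 : MemLp f 1 μ := (Lp.memLp f).mono_exponent le_top
  have h2 : MemLp f 2 μ := (Lp.memLp f).mono_exponent le_top
  have h3 : ∫ x, f x * f x ∂μ = 0 := by
    rw [← h (h1.toLp f)]
    refine integral_congr_ae ?_
    filter_upwards [h1.coeFn_toLp] with x hx
    rw [hx]
  rw [integral_eq_zero_iff_of_nonneg (fun x => mul_self_nonneg _) (h2.integrable_mul h2)] at h3
  refine Lp.ext ?_
  filter_upwards [h3, Lp.coeFn_zero ℝ ⊤ μ] with x hx h0
  rw [h0]
  simpa using hx

end General

/-! ### The `l²` metric -/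

theorem edist_le_l2Dist (x y : ℕ → ℝ) (n : ℕ) : edist (x n) (y n) ≤ l2Dist x y := by
  have h : ‖x n - y n‖ₑ ^ 2 ≤ ∑' n, ‖x n - y n‖ₑ ^ 2 := ENNReal.le_tsum n
  have h2 := ENNReal.rpow_le_rpow h (by norm_num : (0 : ℝ) ≤ 1 / 2)
  rw [← ENNReal.rpow_natCast, ← ENNReal.rpow_mul] at h2
  simpa [edist_eq_enorm_sub, l2Dist] using h2

theorem l2Dist_add_extendZero {N : ℕ} (x : ℕ → ℝ) (h : EuclideanSpace ℝ (Fin N)) :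
    l2Dist x (x + extendZero N h) = ‖h‖ₑ := by
  have e : ∑' n, ‖x n - (x + extendZero N h) n‖ₑ ^ 2 = ∑ i : Fin N, ‖h i‖ₑ ^ 2 := by
    rw [tsum_eq_sum (s := Finset.range N)]
    · rw [Finset.sum_range]
      exact Finset.sum_congr rfl fun i _ => by simp
    · intro n hn
      simp [extendZero_of_le h (not_lt.1 (by simpa using hn))]
  rw [l2Dist, e]
  have h3 : ∑ i : Fin N, ‖h i‖ₑ ^ 2 = ‖h‖ₑ ^ 2 := by
    simp only [enorm_eq_nnnorm]
    norm_cast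
    ext
    push_cast
    simpa using (EuclideanSpace.real_norm_sq_eq h).symm
  rw [h3, ← ENNReal.rpow_natCast, ← ENNReal.rpow_mul]
  simp

theorem edist_firstCoords_le_l2Dist (N : ℕ) (x y : ℕ → ℝ) :
    edist (firstCoords N x) (firstCoords N y) ≤ l2Dist x y := by
  have h : edist (firstCoords N x) (firstCoords N y) ^ 2 ≤ ∑' n, ‖x n - y n‖ₑ ^ 2 := by
    have h3 : edist (firstCoords N x) (firstCoords N y) ^ 2 = ∑ i : Fin N, ‖x i - y i‖ₑ ^ 2 := by
      rw [edist_eq_enorm_sub]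
      simp only [enorm_eq_nnnorm]
      norm_cast
      ext
      push_cast
      simpa using (EuclideanSpace.real_norm_sq_eq (firstCoords N x - firstCoords N y))
    rw [h3, ← Finset.sum_range (fun i => ‖x i - y i‖ₑ ^ 2)]
    exact ENNReal.sum_le_tsum _
  have h2 := ENNReal.rpow_le_rpow h (by norm_num : (0 : ℝ) ≤ 1 / 2)
  rw [← ENNReal.rpow_natCast, ← ENNReal.rpow_mul] at h2
  simpa [l2Dist] using h2

/-- The passage from sets to shifts. If the set had positive measure, a piece of it and the
translate of that piece by `h` would be at distance at most `‖h‖`, with essential ranges at least `r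
> L ‖h‖` apart. The Lipschitz number sees only pairs at positive distance, so the piece is cut to a
thin slab in a direction where `h` does not vanish. -/
theorem measure_translate_closed_eq_zero {N : ℕ} {f : (ℕ → ℝ) → ℝ} (hf : Measurable f) {L : ℝ≥0}
    (hL : lipNumber gaussianProduct l2Dist f ≤ L) (h : EuclideanSpace ℝ (Fin N)) {C D : Set ℝ}
    (hC : IsClosed C) (hD : IsClosed D) {r : ℝ≥0} (hr : L * ‖h‖ₑ < r)
    (hCD : ∀ a ∈ C, ∀ b ∈ D, (r : ℝ≥0∞) ≤ edist a b) :
    gaussianProduct {x | f x ∈ C ∧ f (x + extendZero N h) ∈ D} = 0 := by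
  by_cases h0 : h = 0
  · subst h0
    have e : extendZero N 0 = 0 := by ext i; by_cases hi : i < N <;> simp [extendZero]
    convert! measure_empty (μ := gaussianProduct)
    refine Set.eq_empty_of_forall_notMem fun x hx => ?_
    rw [Set.mem_ofPred_eq, e, add_zero] at hx
    have := hr.trans_le (hCD _ hx.1 _ hx.2)
    simp at this
  obtain ⟨n, hn⟩ : ∃ n, h n ≠ 0 := by
    by_contra! hcon
    exact h0 (by ext i; simpa using hcon i)
  by_contra hpos
  set A := {x | f x ∈ C ∧ f (x + extendZero N h) ∈ D} with hA
  have hmadd : Measurable fun x : ℕ → ℝ => x + extendZero N h := by fun_prop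
  have hmA : MeasurableSet A :=
    (hf hC.measurableSet).inter ((hf.comp hmadd) hD.measurableSet)
  -- Two points of one slab of width `|h n| / 2` differ by less than `|h n| / 2` in coordinate `n`.
  -- A point of the slab and a point of its translate therefore differ there by more than `η`.
  set η : ℝ := |h n| / 2 with hη
  have hη0 : 0 < η := by positivity
  obtain ⟨k, hk⟩ : ∃ k : ℤ, gaussianProduct (A ∩ {x | ⌊x n / η⌋ = k}) ≠ 0 := by
    by_contra! hcon
    refine hpos (measure_mono_null (fun x hx => ?_) (measure_iUnion_null hcon))
    exact Set.mem_iUnion.2 ⟨⌊x n / η⌋, hx, rfl⟩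
  set A₁ := A ∩ {x | ⌊x n / η⌋ = k} with hA₁
  have hmA₁ : MeasurableSet A₁ := hmA.inter
    (measurableSet_eq_fun (by fun_prop : Measurable fun x : ℕ → ℝ => x n / η).floor
      measurable_const)
  set B₁ : Set (ℕ → ℝ) := (fun x => x - extendZero N h) ⁻¹' A₁ with hB₁
  have hmB₁ : MeasurableSet B₁ := (by fun_prop : Measurable fun x : ℕ → ℝ => x - extendZero N h) hmA₁
  have hpre : (fun x => x + extendZero N h) ⁻¹' B₁ = A₁ := by
    ext x; simp [hB₁]
  have hac := gaussianProduct_map_add_absolutelyContinuous h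
  -- By quasi-invariance, a null translate would make `A₁` null.
  have hB₁0 : gaussianProduct B₁ ≠ 0 := by
    intro hz
    have := hac hz
    rw [Measure.map_apply hmadd hmB₁, hpre] at this
    exact hk this
  have hs0 : 0 < setDist gaussianProduct l2Dist A₁ B₁ := by
    refine lt_of_lt_of_le (ENNReal.ofReal_pos.2 hη0) (le_iSup₂_of_le A₁ B₁ (le_iSup₂_of_le hmA₁ hmB₁
      (le_iSup₂_of_le (ae_eq_refl _) (ae_eq_refl _) ?_)))
    refine le_iInf₂ fun x hx => le_iInf₂ fun y hy => ?_
    refine le_trans ?_ (edist_le_l2Dist x y n)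
    have hx2 : ⌊x n / η⌋ = k := hx.2
    have hy2 : ⌊(y n - extendZero N h n) / η⌋ = k := hy.2
    have := Int.abs_sub_lt_one_of_floor_eq_floor (hx2.trans hy2.symm)
    rw [← sub_div, abs_div, abs_of_pos hη0, div_lt_one hη0, extendZero_val] at this
    rw [edist_dist, Real.dist_eq]
    refine ENNReal.ofReal_le_ofReal ?_
    have e : h n = (x n - (y n - h n)) - (x n - y n) := by ring
    have := abs_sub (x n - (y n - h n)) (x n - y n)
    rw [← e] at this
    linarith
  -- Whatever representatives are chosen, almost every `x ∈ A₁` has `x` in the first and `x + h` in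
  -- the second, again by quasi-invariance.
  have hs1 : setDist gaussianProduct l2Dist A₁ B₁ ≤ ‖h‖ₑ := by
    refine iSup₂_le fun A' B' => iSup₂_le fun h1 h2 => iSup₂_le fun h3 h4 => ?_
    have h5 : ∀ᵐ x ∂gaussianProduct, x + extendZero N h ∈ B' ↔ x + extendZero N h ∈ B₁ := by
      have := hac.ae_le (h4.mem_iff)
      exact ae_of_ae_map hmadd.aemeasurable this
    obtain ⟨x, hxA₁, hxA', hxB'⟩ : ∃ x ∈ A₁, (x ∈ A' ↔ x ∈ A₁) ∧
        (x + extendZero N h ∈ B' ↔ x + extendZero N h ∈ B₁) := by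
      by_contra! hcon
      refine hk (measure_mono_null (fun x hx => ?_) (ae_iff.1 (h3.mem_iff.and h5)))
      intro hx2
      rcases hcon x hx hx2.1 with h7 | h7
      · exact h7.2 (hx2.2.1 h7.1)
      · exact h7.1 (hx2.2.2 h7.2)
    refine (iInf₂_le x (hxA'.2 hxA₁)).trans ((iInf₂_le (x + extendZero N h) (hxB'.2 ?_)).trans
      (l2Dist_add_extendZero x h).le)
    change x ∈ (fun x => x + extendZero N h) ⁻¹' B₁
    rwa [hpre]
  have hess : ∀ {E : Set (ℕ → ℝ)} {T : Set ℝ}, IsClosed T → (∀ x ∈ E, f x ∈ T) →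
      essRange gaussianProduct f E ⊆ T := by
    intro E T hT hE a ha
    by_contra haT
    have := ha _ (hT.isOpen_compl.mem_nhds haT)
    rw [show E ∩ f ⁻¹' Tᶜ = ∅ from Set.eq_empty_of_forall_notMem fun x hx => hx.2 (hE x hx.1),
      measure_empty] at this
    exact this.false
  have hrd : (r : ℝ≥0∞) ≤ essRangeDist gaussianProduct f A₁ B₁ := by
    refine le_iInf₂ fun a ha => le_iInf₂ fun b hb => hCD a ?_ b ?_
    · exact hess hC (fun x hx => hx.1.1) ha
    · refine hess hD (fun x hx => ?_) hb
      have := hx.1.2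
      rwa [sub_add_cancel] at this
  have hst : setDist gaussianProduct l2Dist A₁ B₁ ≠ ⊤ :=
    (hs1.trans_lt enorm_lt_top).ne
  have hfin : essRangeDist gaussianProduct f A₁ B₁ / setDist gaussianProduct l2Dist A₁ B₁ ≤ L :=
    (div_setDist_le_lipNumber hmA₁ hmB₁ (pos_iff_ne_zero.2 hk) (pos_iff_ne_zero.2 hB₁0) hs0).trans hL
  rw [ENNReal.div_le_iff hs0.ne' hst] at hfin
  exact absurd (hr.trans_le (hrd.trans hfin)) (not_lt.2 (by gcongr))

/-- A function of finite Lipschitz number is Lipschitz along finite-dimensional shifts. -/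
theorem ae_abs_translate_sub_le {N : ℕ} {f : (ℕ → ℝ) → ℝ} (hf : Measurable f) {L : ℝ≥0}
    (hL : lipNumber gaussianProduct l2Dist f ≤ L) (h : EuclideanSpace ℝ (Fin N)) :
    ∀ᵐ x ∂gaussianProduct, |f (x + extendZero N h) - f x| ≤ L * ‖h‖ := by
  -- A violation of the bound is detected by a pair of rational half-lines, so countably many null
  -- sets cover all violations.
  have key : ∀ a b : ℚ, (L : ℝ) * ‖h‖ < b - a → ∀ᵐ x ∂gaussianProduct,
      ¬ (f x ∈ Set.Iic (a : ℝ) ∧ f (x + extendZero N h) ∈ Set.Ici (b : ℝ)) ∧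
      ¬ (f x ∈ Set.Ici (b : ℝ) ∧ f (x + extendZero N h) ∈ Set.Iic (a : ℝ)) := by
    intro a b hab
    have hr : (L : ℝ≥0∞) * ‖h‖ₑ < ((b - a : ℝ).toNNReal : ℝ≥0∞) := by
      rw [enorm_eq_nnnorm, ← ENNReal.coe_mul, ENNReal.coe_lt_coe, Real.lt_toNNReal_iff_coe_lt]
      simpa using hab
    have hd : ∀ s ∈ Set.Iic (a : ℝ), ∀ t ∈ Set.Ici (b : ℝ),
        (((b - a : ℝ).toNNReal : ℝ≥0) : ℝ≥0∞) ≤ edist s t := by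
      intro s hs t ht
      rw [edist_comm, edist_dist, Real.dist_eq]
      refine ENNReal.ofReal_le_ofReal ((sub_le_sub ht hs).trans (le_abs_self _))
    have h1 := measure_translate_closed_eq_zero hf hL h isClosed_Iic isClosed_Ici hr hd
    have h2 := measure_translate_closed_eq_zero hf hL h isClosed_Ici isClosed_Iic hr
      (fun t ht s hs => (hd s hs t ht).trans_eq (edist_comm _ _))
    exact (measure_eq_zero_iff_ae_notMem.1 h1).and (measure_eq_zero_iff_ae_notMem.1 h2)
  have hall : ∀ᵐ x ∂gaussianProduct, ∀ a b : ℚ, (L : ℝ) * ‖h‖ < b - a →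
      ¬ (f x ∈ Set.Iic (a : ℝ) ∧ f (x + extendZero N h) ∈ Set.Ici (b : ℝ)) ∧
      ¬ (f x ∈ Set.Ici (b : ℝ) ∧ f (x + extendZero N h) ∈ Set.Iic (a : ℝ)) := by
    rw [ae_all_iff]; intro a
    rw [ae_all_iff]; intro b
    by_cases hab : (L : ℝ) * ‖h‖ < b - a
    · filter_upwards [key a b hab] with x hx _ using hx
    · exact Eventually.of_forall fun x hx => absurd hx hab
  filter_upwards [hall] with x hx
  have pick : ∀ s t : ℝ, (L : ℝ) * ‖h‖ < t - s → ∃ a b : ℚ, (L : ℝ) * ‖h‖ < b - a ∧ s ≤ a ∧ b ≤ t := by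
    intro s t hst
    set ε := (t - s - L * ‖h‖) / 2 with hε
    have hε0 : 0 < ε := by rw [hε]; linarith
    obtain ⟨a, ha1, ha2⟩ := exists_rat_btwn (show s < s + ε by linarith)
    obtain ⟨b, hb1, hb2⟩ := exists_rat_btwn (show t - ε < t by linarith)
    exact ⟨a, b, by linarith, ha1.le, hb2.le⟩
  rw [abs_le]
  constructor
  · by_contra! hcon
    obtain ⟨a, b, hab, h1, h2⟩ := pick (f (x + extendZero N h)) (f x) (by linarith)
    exact (hx a b hab).2 ⟨h2, h1⟩
  · by_contra! hcon
    obtain ⟨a, b, hab, h1, h2⟩ := pick (f x) (f (x + extendZero N h)) (by linarith)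
    exact (hx a b hab).1 ⟨h1, h2⟩

/-- Bounded functions that are Lipschitz for the `l²` metric at all points. -/
structure IsBddLip (u : (ℕ → ℝ) → ℝ) (M C : ℝ≥0) : Prop where
  measurable : Measurable u
  bound : ∀ x, |u x| ≤ M
  lip : ∀ x y, edist (u x) (u y) ≤ C * l2Dist x y

namespace IsBddLip

variable {u : (ℕ → ℝ) → ℝ} {M C : ℝ≥0}

theorem memLp (h : IsBddLip u M C) (p : ℝ≥0∞) : MemLp u p gaussianProduct :=
  MemLp.of_bound h.measurable.aestronglyMeasurable M (Eventually.of_forall h.bound)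

/-- The element of the Lipschitz algebra that a bounded Lipschitz function defines. -/
noncomputable def toLip (h : IsBddLip u M C) : Lip gaussianProduct l2Dist :=
  ⟨(h.memLp ⊤).toLp u, by
    change lipNumber _ _ _ < ⊤
    rw [lipNumber_congr (h.memLp ⊤).coeFn_toLp]
    exact (lipNumber_le_of_edist_le h.measurable h.lip).trans_lt ENNReal.coe_lt_top⟩

theorem coeFn_toLip (h : IsBddLip u M C) :
    (h.toLip : Lp ℝ ⊤ gaussianProduct) =ᵐ[gaussianProduct] u := (h.memLp ⊤).coeFn_toLp

theorem lipNorm_toLip_le (h : IsBddLip u M C) : lipNorm h.toLip ≤ (max C M : ℝ≥0) := by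
  rw [ENNReal.coe_max]
  refine max_le_max ?_ ?_
  · rw [lipNumber_congr h.coeFn_toLip]
    exact lipNumber_le_of_edist_le h.measurable h.lip
  · rw [Lp.enorm_def, eLpNorm_congr_ae h.coeFn_toLip, eLpNorm_exponent_top]
    refine eLpNormEssSup_le_of_ae_bound (C := M) (Eventually.of_forall h.bound) |>.trans ?_
    simp

end IsBddLip

/-! ### Smooth functions with bounded derivatives -/

namespace IsSmoothBounded

variable {n m : ℕ} {φ ψ : EuclideanSpace ℝ (Fin n) → ℝ}

theorem add (hφ : IsSmoothBounded φ) (hψ : IsSmoothBounded ψ) :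
    IsSmoothBounded (fun y => φ y + ψ y) := by
  refine ⟨hφ.1.add hψ.1, fun k => ?_⟩
  obtain ⟨C, hC⟩ := hφ.2 k
  obtain ⟨D, hD⟩ := hψ.2 k
  refine ⟨C + D, fun x => ?_⟩
  have h1 : ContDiffAt ℝ k φ x := (hφ.1.of_le (by exact_mod_cast le_top)).contDiffAt
  have h2 : ContDiffAt ℝ k ψ x := (hψ.1.of_le (by exact_mod_cast le_top)).contDiffAt
  change ‖iteratedFDeriv ℝ k (φ + ψ) x‖ ≤ _
  rw [iteratedFDeriv_add_apply h1 h2]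
  exact (norm_add_le _ _).trans (add_le_add (hC x) (hD x))

theorem const_mul (hφ : IsSmoothBounded φ) (c : ℝ) : IsSmoothBounded (fun y => c * φ y) := by
  refine ⟨contDiff_const.mul hφ.1, fun k => ?_⟩
  obtain ⟨C, hC⟩ := hφ.2 k
  refine ⟨|c| * C, fun x => ?_⟩
  have h1 : ContDiffAt ℝ k φ x := (hφ.1.of_le (by exact_mod_cast le_top)).contDiffAt
  change ‖iteratedFDeriv ℝ k (c • φ) x‖ ≤ _
  rw [iteratedFDeriv_const_smul_apply h1, norm_smul, Real.norm_eq_abs]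
  exact mul_le_mul_of_nonneg_left (hC x) (abs_nonneg c)

theorem mul (hφ : IsSmoothBounded φ) (hψ : IsSmoothBounded ψ) :
    IsSmoothBounded (fun y => φ y * ψ y) := by
  refine ⟨hφ.1.mul hψ.1, fun k => ?_⟩
  choose C hC using hφ.2
  choose D hD using hψ.2
  refine ⟨∑ i ∈ Finset.range (k + 1), (k.choose i : ℝ) * C i * D (k - i), fun x => ?_⟩
  refine (norm_iteratedFDeriv_mul_le hφ.1 hψ.1 x (by exact_mod_cast le_top)).trans
    (Finset.sum_le_sum fun i _ => ?_)
  have : 0 ≤ C i := (norm_nonneg _).trans (hC i x)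
  gcongr
  · exact hC i x
  · exact hD _ x

theorem comp_clm (hφ : IsSmoothBounded φ)
    (L : EuclideanSpace ℝ (Fin m) →L[ℝ] EuclideanSpace ℝ (Fin n)) :
    IsSmoothBounded (fun y => φ (L y)) := by
  refine ⟨hφ.1.comp L.contDiff, fun k => ?_⟩
  obtain ⟨C, hC⟩ := hφ.2 k
  refine ⟨C * ∏ _ : Fin k, ‖L‖, fun x => ?_⟩
  change ‖iteratedFDeriv ℝ k (φ ∘ L) x‖ ≤ _
  rw [L.iteratedFDeriv_comp_right hφ.1 x (by exact_mod_cast le_top)]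
  refine (ContinuousMultilinearMap.norm_compContinuousLinearMap_le _ _).trans ?_
  gcongr
  exact hC _

theorem of_hasCompactSupport (h : ContDiff ℝ ∞ φ) (hc : HasCompactSupport φ) :
    IsSmoothBounded φ := by
  refine ⟨h, fun k => ?_⟩
  exact (hc.iteratedFDeriv k).exists_bound_of_continuous
    (h.continuous_iteratedFDeriv (by exact_mod_cast le_top))

/-- Intended for sine and cosine, all of whose derivatives are bounded by `1`. -/
theorem comp_linear {f : ℝ → ℝ} (hf : ContDiff ℝ ∞ f) (hb : ∀ k x, |iteratedDeriv k f x| ≤ 1)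
    (L : EuclideanSpace ℝ (Fin n) →L[ℝ] ℝ) : IsSmoothBounded (fun y => f (L y)) := by
  refine ⟨hf.comp L.contDiff, fun k => ⟨1 * ∏ _ : Fin k, ‖L‖, fun x => ?_⟩⟩
  change ‖iteratedFDeriv ℝ k (f ∘ L) x‖ ≤ _
  rw [L.iteratedFDeriv_comp_right hf x (by exact_mod_cast le_top)]
  refine (ContinuousMultilinearMap.norm_compContinuousLinearMap_le _ _).trans ?_
  gcongr
  rw [norm_iteratedFDeriv_eq_norm_iteratedDeriv]
  exact hb _ _

theorem exists_bound (hφ : IsSmoothBounded φ) : ∃ C : ℝ≥0, ∀ x, |φ x| ≤ C := by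
  obtain ⟨C, hC⟩ := hφ.2 0
  refine ⟨C.toNNReal, fun x => ?_⟩
  have := hC x
  rw [norm_iteratedFDeriv_zero] at this
  exact this.trans (Real.le_coe_toNNReal C)

theorem exists_fderiv_bound (hφ : IsSmoothBounded φ) : ∃ C : ℝ≥0, ∀ x, ‖fderiv ℝ φ x‖ ≤ C := by
  obtain ⟨C, hC⟩ := hφ.2 1
  refine ⟨C.toNNReal, fun x => ?_⟩
  have := hC x
  rw [← norm_iteratedFDeriv_fderiv, norm_iteratedFDeriv_zero] at this
  exact this.trans (Real.le_coe_toNNReal C)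

theorem differentiable (hφ : IsSmoothBounded φ) : Differentiable ℝ φ :=
  hφ.1.differentiable (by simp)

end IsSmoothBounded

/-! ### Cylinder functions and their gradients -/

theorem cylinderGradient_apply {n : ℕ} (φ : EuclideanSpace ℝ (Fin n) → ℝ) (x : ℕ → ℝ) (i : Fin n) :
    cylinderGradient φ x i = fderiv ℝ φ (firstCoords n x) (EuclideanSpace.single i 1) := by
  rw [cylinderGradient, lp.coeFn_sum, Finset.sum_apply, Finset.sum_eq_single i]
  · exact lp.single_apply_self _ _ _
  · intro j _ hj
    exact lp.single_apply_ne _ _ _ fun h => hj (Fin.ext h.symm)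
  · simp

theorem cylinderGradient_apply_of_le {n : ℕ} (φ : EuclideanSpace ℝ (Fin n) → ℝ) (x : ℕ → ℝ) {i : ℕ}
    (hi : n ≤ i) : cylinderGradient φ x i = 0 := by
  rw [cylinderGradient, lp.coeFn_sum, Finset.sum_apply, Finset.sum_eq_zero]
  intro j _
  exact lp.single_apply_ne _ _ _ (j.2.trans_le hi).ne'

theorem continuous_firstCoords (n : ℕ) : Continuous (firstCoords n) := by
  unfold firstCoords; fun_prop

theorem norm_sum_single_eq {n : ℕ} (v : EuclideanSpace ℝ (Fin n)) :
    ‖(∑ i : Fin n, lp.single 2 (i : ℕ) (v i) : HilbertL2)‖ = ‖v‖ := by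
  have h := lp.norm_sum_single (p := 2) (E := fun _ : ℕ => ℝ) (by norm_num) (extendZero n v)
    (Finset.range n)
  rw [Finset.sum_range, Finset.sum_range] at h
  simp only [extendZero_val] at h
  rw [← sq_eq_sq₀ (norm_nonneg _) (norm_nonneg _), EuclideanSpace.real_norm_sq_eq]
  simpa using h

/-- The gradient `v` is the Riesz representative of the differential `T`, so `‖v‖² = T v ≤ ‖T‖ ‖v‖`.
-/
theorem norm_cylinderGradient_le {n : ℕ} (φ : EuclideanSpace ℝ (Fin n) → ℝ) (x : ℕ → ℝ) :
    ‖cylinderGradient φ x‖ ≤ ‖fderiv ℝ φ (firstCoords n x)‖ := by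
  set T := fderiv ℝ φ (firstCoords n x) with hT
  set v : EuclideanSpace ℝ (Fin n) := WithLp.toLp 2 fun i => T (EuclideanSpace.single i 1) with hv
  have e : ‖cylinderGradient φ x‖ = ‖v‖ := norm_sum_single_eq v
  rw [e]
  by_cases hv0 : ‖v‖ = 0
  · rw [hv0]; exact norm_nonneg _
  have h1 : T v = ‖v‖ ^ 2 := by
    have : v = ∑ i, v i • EuclideanSpace.single i (1 : ℝ) := by
      ext j
      simp [Pi.single_apply]
    conv_lhs => rw [this]
    rw [map_sum, EuclideanSpace.real_norm_sq_eq]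
    refine Finset.sum_congr rfl fun i _ => ?_
    rw [map_smul, smul_eq_mul, sq]
  have h2 := T.le_opNorm v
  rw [h1, Real.norm_eq_abs, abs_of_nonneg (sq_nonneg _), sq] at h2
  exact le_of_mul_le_mul_right h2 (lt_of_le_of_ne (norm_nonneg v) (Ne.symm hv0))

/-- `u` is a smooth bounded cylinder function with gradient `V`. -/
def IsCylinder (u : (ℕ → ℝ) → ℝ) (V : (ℕ → ℝ) → HilbertL2) : Prop :=
  ∃ (n : ℕ) (φ : EuclideanSpace ℝ (Fin n) → ℝ), IsSmoothBounded φ ∧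
    u = (fun x => φ (firstCoords n x)) ∧ V = cylinderGradient φ

namespace IsCylinder

variable {u v : (ℕ → ℝ) → ℝ} {U V : (ℕ → ℝ) → HilbertL2}

/-- Extra coordinates only add vanishing partial derivatives, so two cylinder functions can always
be written in a common number of coordinates. -/
theorem exists_of_le (h : IsCylinder u U) : ∃ n, ∀ m, n ≤ m →
    ∃ φ : EuclideanSpace ℝ (Fin m) → ℝ, IsSmoothBounded φ ∧
    u = (fun x => φ (firstCoords m x)) ∧ U = cylinderGradient φ := by
  obtain ⟨n, φ, hφ, rfl, rfl⟩ := h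
  refine ⟨n, fun m hm => ⟨fun y => φ (restrictCoords hm y), hφ.comp_clm _, rfl, ?_⟩⟩
  ext x i
  by_cases hi : i < m
  · rw [cylinderGradient_apply _ x (⟨i, hi⟩ : Fin m)]
    have hd : HasFDerivAt (fun y => φ (restrictCoords hm y))
        ((fderiv ℝ φ (firstCoords n x)).comp (restrictCoords hm)) (firstCoords m x) :=
      (hφ.differentiable (restrictCoords hm (firstCoords m x))).hasFDerivAt.comp (firstCoords m x)
        (restrictCoords hm).hasFDerivAt
    rw [hd.fderiv, ContinuousLinearMap.comp_apply]
    by_cases hi2 : i < n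
    · rw [cylinderGradient_apply _ x (⟨i, hi2⟩ : Fin n)]
      congr 1
      ext j
      simp [restrictCoords_apply, Fin.ext_iff]
    · rw [cylinderGradient_apply_of_le _ _ (not_lt.1 hi2)]
      symm
      convert! map_zero (fderiv ℝ φ (firstCoords n x))
      ext j
      have : (j : ℕ) ≠ i := fun h => hi2 (h ▸ j.2)
      simp [restrictCoords_apply, Fin.ext_iff, this]
  · rw [cylinderGradient_apply_of_le _ _ (not_lt.1 hi),
      cylinderGradient_apply_of_le _ _ (hm.trans (not_lt.1 hi))]

theorem exists_common (hu : IsCylinder u U) (hv : IsCylinder v V) :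
    ∃ (n : ℕ) (φ ψ : EuclideanSpace ℝ (Fin n) → ℝ), IsSmoothBounded φ ∧ IsSmoothBounded ψ ∧
    u = (fun x => φ (firstCoords n x)) ∧ U = cylinderGradient φ ∧
    v = (fun x => ψ (firstCoords n x)) ∧ V = cylinderGradient ψ := by
  obtain ⟨n, hn⟩ := hu.exists_of_le
  obtain ⟨m, hm⟩ := hv.exists_of_le
  obtain ⟨φ, h1, h2, h3⟩ := hn (max n m) (le_max_left _ _)
  obtain ⟨ψ, k1, k2, k3⟩ := hm (max n m) (le_max_right _ _)
  exact ⟨_, φ, ψ, h1, k1, h2, h3, k2, k3⟩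

theorem add (hu : IsCylinder u U) (hv : IsCylinder v V) :
    IsCylinder (fun x => u x + v x) (fun x => U x + V x) := by
  obtain ⟨n, φ, ψ, h1, h2, rfl, rfl, rfl, rfl⟩ := hu.exists_common hv
  refine ⟨n, _, h1.add h2, rfl, ?_⟩
  ext x i
  rw [lp.coeFn_add, Pi.add_apply]
  by_cases hi : i < n
  · simp only [cylinderGradient_apply _ x (⟨i, hi⟩ : Fin n)]
    rw [fderiv_fun_add (h1.differentiable _) (h2.differentiable _)]
    rfl
  · simp [cylinderGradient_apply_of_le _ _ (not_lt.1 hi)]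

theorem const_mul (hu : IsCylinder u U) (c : ℝ) :
    IsCylinder (fun x => c * u x) (fun x => c • U x) := by
  obtain ⟨n, φ, h1, rfl, rfl⟩ := hu
  refine ⟨n, _, h1.const_mul c, rfl, ?_⟩
  ext x i
  rw [lp.coeFn_smul, Pi.smul_apply]
  by_cases hi : i < n
  · simp only [cylinderGradient_apply _ x (⟨i, hi⟩ : Fin n)]
    rw [fderiv_const_mul (h1.differentiable _)]
    rfl
  · simp [cylinderGradient_apply_of_le _ _ (not_lt.1 hi)]

theorem mul (hu : IsCylinder u U) (hv : IsCylinder v V) :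
    IsCylinder (fun x => u x * v x) (fun x => u x • V x + v x • U x) := by
  obtain ⟨n, φ, ψ, h1, h2, rfl, rfl, rfl, rfl⟩ := hu.exists_common hv
  refine ⟨n, _, h1.mul h2, rfl, ?_⟩
  ext x i
  rw [lp.coeFn_add, lp.coeFn_smul, lp.coeFn_smul, Pi.add_apply, Pi.smul_apply, Pi.smul_apply]
  by_cases hi : i < n
  · simp only [cylinderGradient_apply _ x (⟨i, hi⟩ : Fin n)]
    rw [fderiv_fun_mul (h1.differentiable _) (h2.differentiable _)]
    rfl
  · simp [cylinderGradient_apply_of_le _ _ (not_lt.1 hi)]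

theorem continuous (hu : IsCylinder u U) : Continuous u := by
  obtain ⟨n, φ, h1, rfl, rfl⟩ := hu
  exact h1.1.continuous.comp (continuous_firstCoords n)

theorem continuous_gradient (hu : IsCylinder u U) : Continuous U := by
  obtain ⟨n, φ, h1, rfl, rfl⟩ := hu
  unfold cylinderGradient
  refine continuous_finsetSum _ fun i _ => ?_
  refine (lp.isometry_single (E := fun _ : ℕ => ℝ) (p := 2) (i : ℕ)).continuous.comp ?_
  have := (h1.1.continuous_fderiv (by simp)).comp (continuous_firstCoords n)
  exact this.clm_apply continuous_const

theorem exists_bound (hu : IsCylinder u U) : ∃ C : ℝ≥0, (∀ x, |u x| ≤ C) ∧ ∀ x, ‖U x‖ ≤ C := by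
  obtain ⟨n, φ, h1, rfl, rfl⟩ := hu
  obtain ⟨C, hC⟩ := h1.exists_bound
  obtain ⟨D, hD⟩ := h1.exists_fderiv_bound
  exact ⟨max C D, fun x => (hC _).trans (by exact_mod_cast le_max_left C D),
    fun x => (norm_cylinderGradient_le φ x).trans ((hD _).trans (by exact_mod_cast le_max_right C D))⟩

theorem memLp (hu : IsCylinder u U) (p : ℝ≥0∞) : MemLp u p gaussianProduct := by
  obtain ⟨C, hC, -⟩ := hu.exists_bound
  exact MemLp.of_bound hu.continuous.aestronglyMeasurable C (Eventually.of_forall hC)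

theorem memLp_gradient (hu : IsCylinder u U) (p : ℝ≥0∞) : MemLp U p gaussianProduct := by
  obtain ⟨C, -, hC⟩ := hu.exists_bound
  exact MemLp.of_bound hu.continuous_gradient.aestronglyMeasurable C (Eventually.of_forall hC)

theorem comp_linear {n : ℕ} {f : ℝ → ℝ} (hf : ContDiff ℝ ∞ f)
    (hb : ∀ k x, |iteratedDeriv k f x| ≤ 1) (c : EuclideanSpace ℝ (Fin n)) :
    IsCylinder (fun x => f (inner ℝ c (firstCoords n x)))
      (fun x => deriv f (inner ℝ c (firstCoords n x)) •
        ∑ i : Fin n, (lp.single 2 (i : ℕ) (c i) : HilbertL2)) := by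
  refine ⟨n, fun y => f (innerSL ℝ c y), IsSmoothBounded.comp_linear hf hb _, rfl, ?_⟩
  ext1 x
  rw [cylinderGradient, Finset.smul_sum]
  refine Finset.sum_congr rfl fun i _ => ?_
  have hd : HasFDerivAt (fun y => f (innerSL ℝ c y))
      (deriv f (innerSL ℝ c (firstCoords n x)) • innerSL ℝ c) (firstCoords n x) :=
    ((hf.differentiable (by simp)) _).hasDerivAt.comp_hasFDerivAt _ (innerSL ℝ c).hasFDerivAt
  rw [hd.fderiv, ← lp.single_smul]
  simp [EuclideanSpace.inner_single_right]

end IsCylinder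

/-! ### Integration by parts -/

theorem integrable_gaussianPDFReal_mul {f : ℝ → ℝ} (hf : Integrable f (gaussianReal 0 1)) :
    Integrable (fun x => gaussianPDFReal 0 1 x * f x) := by
  rw [gaussianReal_of_var_ne_zero _ one_ne_zero, integrable_withDensity_iff_integrable_smul'
    (measurable_gaussianPDF _ _) (ae_of_all _ fun _ => gaussianPDF_lt_top)] at hf
  simpa using hf

theorem hasDerivAt_gaussianPDFReal (x : ℝ) :
    HasDerivAt (gaussianPDFReal 0 1) (-x * gaussianPDFReal 0 1 x) x := by
  rw [gaussianPDFReal_def]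
  have h : HasDerivAt (fun x : ℝ => -(x - 0) ^ 2 / (2 * (1 : ℝ≥0))) (-x) x := by
    have := (((hasDerivAt_id x).sub_const 0).pow 2).neg.div_const (2 * ((1 : ℝ≥0) : ℝ))
    refine this.congr_deriv ?_
    simp
    ring
  refine (h.exp.const_mul _).congr_deriv ?_
  ring

/-- Stein's identity: integration by parts against the Gaussian density, whose derivative is `-x`
times itself. -/
theorem integral_deriv_gaussianReal {f f' : ℝ → ℝ} (hf : ∀ t, HasDerivAt f (f' t) t)
    (h1 : Integrable f (gaussianReal 0 1)) (h2 : Integrable f' (gaussianReal 0 1))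
    (h3 : Integrable (fun t => t * f t) (gaussianReal 0 1)) :
    ∫ t, f' t ∂gaussianReal 0 1 = ∫ t, t * f t ∂gaussianReal 0 1 := by
  rw [integral_gaussianReal_eq_integral_smul one_ne_zero,
    integral_gaussianReal_eq_integral_smul one_ne_zero]
  have := integral_mul_deriv_eq_deriv_mul_of_integrable (u := gaussianPDFReal 0 1) (v := f)
    (u' := fun x => -x * gaussianPDFReal 0 1 x) (v' := f')
    (fun x _ => hasDerivAt_gaussianPDFReal x) (fun x _ => hf x)
    (integrable_gaussianPDFReal_mul h2)
    ((integrable_gaussianPDFReal_mul h3).neg.congr (Eventually.of_forall fun x => by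
      simp only [Pi.neg_apply, Pi.mul_apply]; ring))
    (integrable_gaussianPDFReal_mul h1)
  simp only [smul_eq_mul]
  rw [this, ← integral_neg]
  refine integral_congr_ae (Eventually.of_forall fun x => ?_)
  ring

theorem memLp_coord (n : ℕ) : MemLp (fun x : ℕ → ℝ => x n) 2 gaussianProduct := by
  have h : MemLp id 2 (gaussianReal 0 1) := memLp_id_gaussianReal 2
  rw [← map_eval_gaussianProduct n] at h
  exact h.comp_measurePreserving ⟨measurable_pi_apply n, rfl⟩

/-- Stein's identity on each line parallel to the `n`-th axis, followed by Fubini. -/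
theorem IsCylinder.integral_gradient {u : (ℕ → ℝ) → ℝ} {U : (ℕ → ℝ) → HilbertL2}
    (hu : IsCylinder u U) (n : ℕ) :
    ∫ x, U x n ∂gaussianProduct = ∫ x, x n * u x ∂gaussianProduct := by
  obtain ⟨C, hC1, hC2⟩ := hu.exists_bound
  have hcn : Continuous fun x => U x n :=
    (lp.evalCLM ℝ (fun _ : ℕ => ℝ) 2 n).continuous.comp hu.continuous_gradient
  have hbn : ∀ x, |U x n| ≤ C := fun x =>
    (lp.norm_apply_le_norm (by norm_num) (U x) n).trans (hC2 x)
  have hi1 : Integrable (fun x => U x n) gaussianProduct :=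
    (memLp_one_iff_integrable.1 (MemLp.of_bound hcn.aestronglyMeasurable C
      (Eventually.of_forall hbn)))
  have hi2 : Integrable (fun x => x n * u x) gaussianProduct :=
    (memLp_coord n).integrable_mul (hu.memLp 2)
  have hm := measurePreserving_update n
  rw [← hm.map_eq] at hi1 hi2
  have e1 : ∫ x, U x n ∂gaussianProduct =
      ∫ z, ∫ t, U (Function.update z n t) n ∂gaussianReal 0 1 ∂gaussianProduct := by
    conv_lhs => rw [← hm.map_eq]
    rw [integral_map hm.measurable.aemeasurable hi1.1]
    exact integral_prod_symm _ (hi1.comp_measurable hm.measurable)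
  have e2 : ∫ x, x n * u x ∂gaussianProduct =
      ∫ z, ∫ t, t * u (Function.update z n t) ∂gaussianReal 0 1 ∂gaussianProduct := by
    conv_lhs => rw [← hm.map_eq]
    rw [integral_map hm.measurable.aemeasurable hi2.1]
    refine (integral_prod_symm _ (hi2.comp_measurable hm.measurable)).trans ?_
    simp
  rw [e1, e2]
  refine integral_congr_ae (Eventually.of_forall fun z => ?_)
  have hcu : Continuous fun t : ℝ => Function.update z n t := continuous_const.update n continuous_id
  have hi : Integrable (fun t => u (Function.update z n t)) (gaussianReal 0 1) :=
    memLp_one_iff_integrable.1 (MemLp.of_bound (hu.continuous.comp hcu).aestronglyMeasurable C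
      (Eventually.of_forall fun t => hC1 _))
  refine integral_deriv_gaussianReal (fun t => ?_) hi
    (memLp_one_iff_integrable.1 (MemLp.of_bound (hcn.comp hcu).aestronglyMeasurable C
      (Eventually.of_forall fun t => hbn _))) ?_
  -- At least `n + 1` coordinates are used, so that `U x n` is a partial derivative of the
  -- representing function.
  · obtain ⟨m, hm⟩ := hu.exists_of_le
    obtain ⟨φ, hφ, rfl, rfl⟩ := hm (max m (n + 1)) (le_max_left _ _)
    have hn : n < max m (n + 1) := by omega
    rw [cylinderGradient_apply φ _ (⟨n, hn⟩ : Fin _)]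
    refine HasFDerivAt.comp_hasDerivAt t (hφ.differentiable _).hasFDerivAt ?_
    have e : (fun t => firstCoords (max m (n + 1)) (Function.update z n t)) = fun t =>
        firstCoords (max m (n + 1)) (Function.update z n 0) +
          t • EuclideanSpace.single (⟨n, hn⟩ : Fin _) (1 : ℝ) := by
      ext t j
      by_cases hj : (j : ℕ) = n
      · simp [hj, Fin.ext_iff]
      · simp [hj, Fin.ext_iff]
    rw [e]
    simpa using ((hasDerivAt_id t).smul_const
      (EuclideanSpace.single (⟨n, hn⟩ : Fin _) (1 : ℝ))).const_add
      (firstCoords (max m (n + 1)) (Function.update z n 0))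
  · have h2 : MemLp (fun t => u (Function.update z n t)) 2 (gaussianReal 0 1) :=
      MemLp.of_bound (hu.continuous.comp hcu).aestronglyMeasurable C
        (Eventually.of_forall fun t => hC1 _)
    exact (memLp_id_gaussianReal' 2 (by simp)).integrable_mul h2

/-! ### The Gross-Sobolev derivative -/

theorem mem_cylinderGradientGraph {p : Lp ℝ 2 gaussianProduct × Lp HilbertL2 2 gaussianProduct} :
    p ∈ cylinderGradientGraph ↔
      ∃ u U, IsCylinder u U ∧ p.1 =ᵐ[gaussianProduct] u ∧ p.2 =ᵐ[gaussianProduct] U := by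
  constructor
  · rintro ⟨n, φ, h1, h2, h3⟩
    exact ⟨_, _, ⟨n, φ, h1, rfl, rfl⟩, h2, h3⟩
  · rintro ⟨_, _, ⟨n, φ, h1, rfl, rfl⟩, h2, h3⟩
    exact ⟨n, φ, h1, h2, h3⟩

theorem isCylinder_const (c : ℝ) : IsCylinder (fun _ => c) (fun _ => 0) := by
  -- A constant is a multiple of `cos 0`, a function of no coordinates.
  have h := (IsCylinder.comp_linear (n := 0) Real.contDiff_cos Real.abs_iteratedDeriv_cos_le_one
    0).const_mul c
  simpa using h

/-- The graph of the gradient on cylinder functions is a linear subspace. -/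
noncomputable def cylinderGradientSubmodule :
    Submodule ℝ (Lp ℝ 2 gaussianProduct × Lp HilbertL2 2 gaussianProduct) where
  carrier := cylinderGradientGraph
  zero_mem' := mem_cylinderGradientGraph.2
    ⟨_, _, isCylinder_const 0, Lp.coeFn_zero _ _ _, Lp.coeFn_zero _ _ _⟩
  add_mem' := by
    intro p q hp hq
    obtain ⟨u, U, h1, h2, h3⟩ := mem_cylinderGradientGraph.1 hp
    obtain ⟨v, V, k1, k2, k3⟩ := mem_cylinderGradientGraph.1 hq
    exact mem_cylinderGradientGraph.2 ⟨_, _, h1.add k1, (Lp.coeFn_add _ _).trans (h2.add k2),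
      (Lp.coeFn_add _ _).trans (h3.add k3)⟩
  smul_mem' := by
    intro c p hp
    obtain ⟨u, U, h1, h2, h3⟩ := mem_cylinderGradientGraph.1 hp
    exact mem_cylinderGradientGraph.2 ⟨_, _, h1.const_mul c,
      (Lp.coeFn_smul _ _).trans (h2.const_smul c), (Lp.coeFn_smul _ _).trans (h3.const_smul c)⟩

theorem IsCylinder.isGrossSobolevDerivative {u : (ℕ → ℝ) → ℝ} {U : (ℕ → ℝ) → HilbertL2}
    (h : IsCylinder u U) : IsGrossSobolevDerivative u U :=
  ⟨((h.memLp 2).toLp u, (h.memLp_gradient 2).toLp U), subset_closure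
    (mem_cylinderGradientGraph.2 ⟨u, U, h, (h.memLp 2).coeFn_toLp, (h.memLp_gradient 2).coeFn_toLp⟩),
    (h.memLp 2).coeFn_toLp, (h.memLp_gradient 2).coeFn_toLp⟩

namespace IsGrossSobolevDerivative

variable {f g : (ℕ → ℝ) → ℝ} {F G : (ℕ → ℝ) → HilbertL2}

theorem memLp (h : IsGrossSobolevDerivative f F) :
    MemLp f 2 gaussianProduct ∧ MemLp F 2 gaussianProduct := by
  obtain ⟨p, -, h1, h2⟩ := h
  exact ⟨(Lp.memLp p.1).ae_eq h1, (Lp.memLp p.2).ae_eq h2⟩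

theorem congr (h : IsGrossSobolevDerivative f F) (hf : f =ᵐ[gaussianProduct] g)
    (hF : F =ᵐ[gaussianProduct] G) : IsGrossSobolevDerivative g G := by
  obtain ⟨p, hp, h1, h2⟩ := h
  exact ⟨p, hp, h1.trans hf, h2.trans hF⟩

theorem add (hf : IsGrossSobolevDerivative f F) (hg : IsGrossSobolevDerivative g G) :
    IsGrossSobolevDerivative (fun x => f x + g x) (fun x => F x + G x) := by
  obtain ⟨p, hp, h1, h2⟩ := hf
  obtain ⟨q, hq, k1, k2⟩ := hg
  exact ⟨p + q, cylinderGradientSubmodule.topologicalClosure.add_mem hp hq,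
    (Lp.coeFn_add _ _).trans (h1.add k1), (Lp.coeFn_add _ _).trans (h2.add k2)⟩

theorem const_mul (hf : IsGrossSobolevDerivative f F) (c : ℝ) :
    IsGrossSobolevDerivative (fun x => c * f x) (fun x => c • F x) := by
  obtain ⟨p, hp, h1, h2⟩ := hf
  exact ⟨c • p, cylinderGradientSubmodule.topologicalClosure.smul_mem c hp,
    (Lp.coeFn_smul _ _).trans (h1.const_smul c), (Lp.coeFn_smul _ _).trans (h2.const_smul c)⟩

theorem of_tendsto {fk : ℕ → (ℕ → ℝ) → ℝ} {Fk : ℕ → (ℕ → ℝ) → HilbertL2}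
    (h : ∀ k, IsGrossSobolevDerivative (fk k) (Fk k)) (hf : MemLp f 2 gaussianProduct)
    (hF : MemLp F 2 gaussianProduct)
    (h1 : Tendsto (fun k => eLpNorm (fk k - f) 2 gaussianProduct) atTop (𝓝 0))
    (h2 : Tendsto (fun k => eLpNorm (Fk k - F) 2 gaussianProduct) atTop (𝓝 0)) :
    IsGrossSobolevDerivative f F := by
  choose p hp hp1 hp2 using h
  refine ⟨(hf.toLp f, hF.toLp F), ?_, hf.coeFn_toLp, hF.coeFn_toLp⟩
  refine isClosed_closure.mem_of_tendsto (b := atTop) (f := p) ?_ (Eventually.of_forall hp)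
  refine Tendsto.prodMk_nhds ((Lp.tendsto_Lp_iff_tendsto_eLpNorm _ f hf).2 ?_)
    ((Lp.tendsto_Lp_iff_tendsto_eLpNorm _ F hF).2 ?_)
  · exact h1.congr fun k => eLpNorm_congr_ae ((hp1 k).symm.sub (ae_eq_refl f))
  · exact h2.congr fun k => eLpNorm_congr_ae ((hp2 k).symm.sub (ae_eq_refl F))

theorem exists_seq (h : IsGrossSobolevDerivative f F) :
    ∃ (u : ℕ → (ℕ → ℝ) → ℝ) (U : ℕ → (ℕ → ℝ) → HilbertL2), (∀ k, IsCylinder (u k) (U k)) ∧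
      Tendsto (fun k => eLpNorm (u k - f) 2 gaussianProduct) atTop (𝓝 0) ∧
      Tendsto (fun k => eLpNorm (U k - F) 2 gaussianProduct) atTop (𝓝 0) := by
  obtain ⟨p, hp, h1, h2⟩ := h
  obtain ⟨q, hq, hqp⟩ := mem_closure_iff_seq_limit.1 hp
  choose u U hc hu hU using fun k => mem_cylinderGradientGraph.1 (hq k)
  refine ⟨u, U, hc, ?_, ?_⟩
  · have := (Lp.tendsto_Lp_iff_tendsto_eLpNorm' _ _).1 ((continuous_fst.tendsto p).comp hqp)
    exact this.congr fun k => eLpNorm_congr_ae ((hu k).sub h1)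
  · have := (Lp.tendsto_Lp_iff_tendsto_eLpNorm' _ _).1 ((continuous_snd.tendsto p).comp hqp)
    exact this.congr fun k => eLpNorm_congr_ae ((hU k).sub h2)

/-- The limiting step of the product rule: `f` and `F` are bounded, so both terms of the rule depend
continuously in `L²` on the pair `(g, G)`, which is approximated by cylinder functions. -/
theorem mul_of_forall_isCylinder (hf : IsGrossSobolevDerivative f F)
    (hg : IsGrossSobolevDerivative g G) {C : ℝ≥0}
    (hfb : ∀ᵐ x ∂gaussianProduct, ‖f x‖ ≤ C) (hFb : ∀ᵐ x ∂gaussianProduct, ‖F x‖ ≤ C)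
    (h : ∀ u U, IsCylinder u U →
      IsGrossSobolevDerivative (fun x => f x * u x) (fun x => f x • U x + u x • F x)) :
    IsGrossSobolevDerivative (fun x => f x * g x) (fun x => f x • G x + g x • F x) := by
  obtain ⟨u, U, hc, hu, hU⟩ := hg.exists_seq
  have mf := hf.memLp.1
  have mF := hf.memLp.2
  have mg := hg.memLp.1
  have mG := hg.memLp.2
  have hft : MemLp f ⊤ gaussianProduct := memLp_top_of_bound mf.1 C hfb
  have hFt : MemLp F ⊤ gaussianProduct := memLp_top_of_bound mF.1 C hFb
  refine of_tendsto (fun k => h (u k) (U k) (hc k)) (mg.mul hft)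
    ((mG.smul hft).add (hFt.smul mg)) ?_ ?_
  · have hz : Tendsto (fun k => ENNReal.ofReal C * eLpNorm (u k - g) 2 gaussianProduct) atTop
        (𝓝 0) := by
      simpa using ENNReal.Tendsto.const_mul hu (Or.inr (ENNReal.ofReal_ne_top (r := C)))
    refine tendsto_of_tendsto_of_tendsto_of_le_of_le tendsto_const_nhds hz (fun _ => zero_le)
      fun k => ?_
    refine eLpNorm_le_mul_eLpNorm_of_ae_le_mul ?_ 2
    filter_upwards [hfb] with x hx
    simp only [Pi.sub_apply]
    rw [← mul_sub, norm_mul]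
    gcongr
  · have hz : Tendsto (fun k => ENNReal.ofReal C * eLpNorm (U k - G) 2 gaussianProduct +
        ENNReal.ofReal C * eLpNorm (u k - g) 2 gaussianProduct) atTop (𝓝 0) := by
      simpa using (ENNReal.Tendsto.const_mul hU (Or.inr (ENNReal.ofReal_ne_top (r := C)))).add
        (ENNReal.Tendsto.const_mul hu (Or.inr (ENNReal.ofReal_ne_top (r := C))))
    refine tendsto_of_tendsto_of_tendsto_of_le_of_le tendsto_const_nhds hz (fun _ => zero_le)
      fun k => ?_
    have e : ((fun x => f x • U k x + u k x • F x) - fun x => f x • G x + g x • F x) =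
        (fun x => f x • (U k x - G x)) + fun x => (u k x - g x) • F x := by
      ext1 x
      simp only [Pi.sub_apply, Pi.add_apply, smul_sub, sub_smul]
      abel
    rw [e]
    refine (eLpNorm_add_le (mf.1.smul ((hc k).continuous_gradient.aestronglyMeasurable.sub mG.1))
      (((hc k).continuous.aestronglyMeasurable.sub mg.1).smul mF.1) (by norm_num)).trans
      (add_le_add ?_ ?_)
    · refine eLpNorm_le_mul_eLpNorm_of_ae_le_mul ?_ 2
      filter_upwards [hfb] with x hx
      rw [Pi.smul_apply', norm_smul]
      gcongr
    · refine eLpNorm_le_mul_eLpNorm_of_ae_le_mul ?_ 2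
      filter_upwards [hFb] with x hx
      rw [Pi.smul_apply', norm_smul, mul_comm]
      gcongr

/-- The limiting step is used twice: first with a fixed cylinder factor and `f` approximated, then
with `f` fixed and `g` approximated. -/
theorem mul (hf : IsGrossSobolevDerivative f F) (hg : IsGrossSobolevDerivative g G) {C : ℝ≥0}
    (hfb : ∀ᵐ x ∂gaussianProduct, ‖f x‖ ≤ C) (hFb : ∀ᵐ x ∂gaussianProduct, ‖F x‖ ≤ C) :
    IsGrossSobolevDerivative (fun x => f x * g x) (fun x => f x • G x + g x • F x) := by
  refine hf.mul_of_forall_isCylinder hg hfb hFb fun u U hc => ?_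
  obtain ⟨D, h1, h2⟩ := hc.exists_bound
  have := hc.isGrossSobolevDerivative.mul_of_forall_isCylinder hf
    (Eventually.of_forall h1) (Eventually.of_forall h2)
    fun v V hv => (hc.mul hv).isGrossSobolevDerivative
  refine this.congr (Eventually.of_forall fun x => mul_comm _ _)
    (Eventually.of_forall fun x => add_comm _ _)

end IsGrossSobolevDerivative

theorem memLp_smul_single {ψ : (ℕ → ℝ) → ℝ} {p : ℝ≥0∞} (h : MemLp ψ p gaussianProduct) (n : ℕ) :
    MemLp (fun x => (lp.single 2 n (ψ x) : HilbertL2)) p gaussianProduct :=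
  (lp.singleContinuousLinearMap ℝ (fun _ : ℕ => ℝ) 2 n).comp_memLp' h

/-- The integration by parts formula for the Gross-Sobolev derivative. -/
theorem IsGrossSobolevDerivative.integral_mul {f : (ℕ → ℝ) → ℝ} {F : (ℕ → ℝ) → HilbertL2}
    (h : IsGrossSobolevDerivative f F) {ψ : (ℕ → ℝ) → ℝ} {Ψ : (ℕ → ℝ) → HilbertL2}
    (hψ : IsCylinder ψ Ψ) (n : ℕ) :
    ∫ x, F x n * ψ x ∂gaussianProduct = ∫ x, f x * (x n * ψ x - Ψ x n) ∂gaussianProduct := by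
  obtain ⟨C, hC1, hC2⟩ := hψ.exists_bound
  have ma : MemLp (fun x => x n * ψ x - Ψ x n) 2 gaussianProduct :=
    ((hψ.memLp ⊤).mul (memLp_coord n)).sub
      ((lp.evalCLM ℝ (fun _ : ℕ => ℝ) 2 n).comp_memLp' (hψ.memLp_gradient 2))
  have mb := memLp_smul_single (hψ.memLp 2) n
  set a : Lp ℝ 2 gaussianProduct := ma.toLp _ with ha
  set b : Lp HilbertL2 2 gaussianProduct := mb.toLp _ with hb
  have ea : ∀ (q : Lp ℝ 2 gaussianProduct) (u : (ℕ → ℝ) → ℝ), q =ᵐ[gaussianProduct] u →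
      inner ℝ a q = ∫ x, u x * (x n * ψ x - Ψ x n) ∂gaussianProduct := by
    intro q u hq
    rw [L2.inner_def]
    refine integral_congr_ae ?_
    filter_upwards [hq, ma.coeFn_toLp] with x h1 h2
    rw [h1, ha, h2]
    simp [mul_comm]
  have eb : ∀ (q : Lp HilbertL2 2 gaussianProduct) (U : (ℕ → ℝ) → HilbertL2),
      q =ᵐ[gaussianProduct] U → inner ℝ b q = ∫ x, U x n * ψ x ∂gaussianProduct := by
    intro q U hq
    rw [L2.inner_def]
    refine integral_congr_ae ?_
    filter_upwards [hq, mb.coeFn_toLp] with x h1 h2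
    rw [h1, hb, h2, lp.inner_single_left]
    simp
  -- Both sides are `L²` inner products with the fixed vectors `a` and `b`, so the identity is a
  -- closed condition and need only be checked on cylinder functions.
  have hclosed : IsClosed {p : Lp ℝ 2 gaussianProduct × Lp HilbertL2 2 gaussianProduct |
      inner ℝ b p.2 = inner ℝ a p.1} :=
    isClosed_eq (continuous_const.inner continuous_snd) (continuous_const.inner continuous_fst)
  have hsub : cylinderGradientGraph ⊆ {p | inner ℝ b p.2 = inner ℝ a p.1} := by
    intro p hp
    obtain ⟨u, U, hc, h1, h2⟩ := mem_cylinderGradientGraph.1 hp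
    rw [Set.mem_ofPred_eq, ea _ _ h1, eb _ _ h2]
    -- The product `ψ u` is again cylindrical; its gradient formula is the desired identity,
    -- rearranged.
    have h3 := (hψ.mul hc).integral_gradient n
    have i1 : Integrable (fun x => U x n * ψ x) gaussianProduct :=
      ((lp.evalCLM ℝ (fun _ : ℕ => ℝ) 2 n).comp_memLp' (hc.memLp_gradient 2)).integrable_mul
        (hψ.memLp 2)
    have i2 : Integrable (fun x => u x * Ψ x n) gaussianProduct :=
      (hc.memLp 2).integrable_mul
        ((lp.evalCLM ℝ (fun _ : ℕ => ℝ) 2 n).comp_memLp' (hψ.memLp_gradient 2))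
    have i3 : Integrable (fun x => u x * (x n * ψ x)) gaussianProduct :=
      MemLp.integrable_mul (p := 2) (q := 2) (hc.memLp 2) ((hψ.memLp ⊤).mul (memLp_coord n))
    simp only [mul_sub]
    rw [integral_sub i3 i2, eq_sub_iff_add_eq, ← integral_add i1 i2]
    convert! h3 using 1
    · refine integral_congr_ae (Eventually.of_forall fun x => ?_)
      change U x n * ψ x + u x * Ψ x n = ψ x * U x n + u x * Ψ x n
      ring
    · refine integral_congr_ae (Eventually.of_forall fun x => ?_)
      ring
  obtain ⟨p, hp, h1, h2⟩ := h
  have := closure_minimal hsub hclosed hp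
  rwa [Set.mem_ofPred_eq, ea _ _ h1, eb _ _ h2] at this

theorem ae_eq_zero_of_forall_isCylinder {f : (ℕ → ℝ) → ℝ} (hf : Integrable f gaussianProduct)
    (h : ∀ ψ Ψ, IsCylinder ψ Ψ → ∫ x, f x * ψ x ∂gaussianProduct = 0) :
    f =ᵐ[gaussianProduct] 0 := by
  refine ae_eq_zero_of_forall_integral_cylinder hf fun N g hg hgc => ?_
  rw [← h _ _ ⟨N, g, IsSmoothBounded.of_hasCompactSupport hg hgc, rfl, rfl⟩]
  exact integral_congr_ae (Eventually.of_forall fun x => mul_comm _ _)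

theorem memLp_two_apply {F : (ℕ → ℝ) → HilbertL2} {p : ℝ≥0∞} (hF : MemLp F p gaussianProduct)
    (n : ℕ) : MemLp (fun x => F x n) p gaussianProduct :=
  (lp.evalCLM ℝ (fun _ : ℕ => ℝ) 2 n).comp_memLp' hF

theorem ae_eq_zero_of_forall_isCylinder_apply {F : (ℕ → ℝ) → HilbertL2}
    (hF : MemLp F 2 gaussianProduct)
    (h : ∀ n ψ Ψ, IsCylinder ψ Ψ → ∫ x, F x n * ψ x ∂gaussianProduct = 0) :
    F =ᵐ[gaussianProduct] 0 := by
  have : ∀ n, (fun x => F x n) =ᵐ[gaussianProduct] 0 := fun n =>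
    ae_eq_zero_of_forall_isCylinder ((memLp_two_apply hF n).integrable (by norm_num)) (h n)
  filter_upwards [ae_all_iff.2 this] with x hx
  ext n
  exact hx n

/-- The Gross-Sobolev derivative is unique up to null sets. -/
theorem IsGrossSobolevDerivative.unique {f : (ℕ → ℝ) → ℝ} {F G : (ℕ → ℝ) → HilbertL2}
    (hF : IsGrossSobolevDerivative f F) (hG : IsGrossSobolevDerivative f G) :
    F =ᵐ[gaussianProduct] G := by
  have h := ae_eq_zero_of_forall_isCylinder_apply (hF.memLp.2.sub hG.memLp.2) fun n ψ Ψ hψ => by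
    have i1 := (memLp_two_apply hF.memLp.2 n).integrable_mul (hψ.memLp 2)
    have i2 := (memLp_two_apply hG.memLp.2 n).integrable_mul (hψ.memLp 2)
    have := integral_sub i1 i2
    simp only [Pi.mul_apply] at this
    rw [hF.integral_mul hψ, hG.integral_mul hψ, sub_self] at this
    rw [← this]
    refine integral_congr_ae (Eventually.of_forall fun x => ?_)
    simp [sub_mul]
  filter_upwards [h] with x hx
  exact sub_eq_zero.1 hx

/-! ### Density of cylinder functions -/

theorem eq_top_of_isCylinder_mem {K : Submodule ℝ (Lp ℝ 2 gaussianProduct)}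
    (hK : IsClosed (K : Set (Lp ℝ 2 gaussianProduct)))
    (h : ∀ ψ Ψ (hψ : IsCylinder ψ Ψ), (hψ.memLp 2).toLp ψ ∈ K) : K = ⊤ := by
  rw [← hK.submodule_topologicalClosure_eq, Submodule.topologicalClosure_eq_top_iff,
    Submodule.eq_bot_iff]
  intro w hw
  refine Lp.ext ((ae_eq_zero_of_forall_isCylinder ((Lp.memLp w).integrable (by norm_num))
    fun ψ Ψ hψ => ?_).trans (Lp.coeFn_zero _ _ _).symm)
  have := hw _ (h ψ Ψ hψ)
  rw [L2.inner_def] at this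
  rw [← this]
  refine integral_congr_ae ?_
  filter_upwards [(hψ.memLp 2).coeFn_toLp] with x hx
  rw [hx]
  simp

/-- A vector orthogonal to all `ψ e_n` has every coordinate orthogonal to all cylinder functions,
hence vanishes. It is used to extend weak* continuity from these test sections to all of `L²`. -/
theorem eq_top_of_isCylinder_single_mem {K : Submodule ℝ (Lp HilbertL2 2 gaussianProduct)}
    (hK : IsClosed (K : Set (Lp HilbertL2 2 gaussianProduct)))
    (h : ∀ n ψ Ψ (hψ : IsCylinder ψ Ψ), (memLp_smul_single (hψ.memLp 2) n).toLp _ ∈ K) :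
    K = ⊤ := by
  rw [← hK.submodule_topologicalClosure_eq, Submodule.topologicalClosure_eq_top_iff,
    Submodule.eq_bot_iff]
  intro w hw
  refine Lp.ext ((ae_eq_zero_of_forall_isCylinder_apply (Lp.memLp w)
    fun n ψ Ψ hψ => ?_).trans (Lp.coeFn_zero _ _ _).symm)
  have := hw _ (h n ψ Ψ hψ)
  rw [L2.inner_def] at this
  rw [← this]
  refine integral_congr_ae ?_
  filter_upwards [(memLp_smul_single (hψ.memLp 2) n).coeFn_toLp] with x hx
  rw [hx, lp.inner_single_left]
  simp

theorem exists_isCylinder_eLpNorm_sub_lt {f : (ℕ → ℝ) → ℝ} (hf : MemLp f 2 gaussianProduct)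
    {ε : ℝ≥0∞} (hε : 0 < ε) : ∃ u U, IsCylinder u U ∧ eLpNorm (f - u) 2 gaussianProduct < ε := by
  set K := cylinderGradientSubmodule.map (LinearMap.fst ℝ _ _) with hK
  have htop : K.topologicalClosure = ⊤ := eq_top_of_isCylinder_mem K.isClosed_topologicalClosure
    fun ψ Ψ hψ => K.le_topologicalClosure ⟨((hψ.memLp 2).toLp ψ, (hψ.memLp_gradient 2).toLp Ψ),
      mem_cylinderGradientGraph.2 ⟨ψ, Ψ, hψ, (hψ.memLp 2).coeFn_toLp,
        (hψ.memLp_gradient 2).coeFn_toLp⟩, rfl⟩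
  have hmem : hf.toLp f ∈ closure (K : Set (Lp ℝ 2 gaussianProduct)) := by
    have : hf.toLp f ∈ K.topologicalClosure := htop ▸ Submodule.mem_top
    exact this
  obtain ⟨_, ⟨p, hp, rfl⟩, hd⟩ := EMetric.mem_closure_iff.1 hmem ε hε
  obtain ⟨u, U, hc, h1, h2⟩ := mem_cylinderGradientGraph.1 hp
  refine ⟨u, U, hc, ?_⟩
  rw [Lp.edist_def] at hd
  exact (eLpNorm_congr_ae (hf.coeFn_toLp.sub h1)).symm.trans_lt hd

/-! ### Weak compactness -/

/-- By Banach–Alaoglu the bounded sequence `h k` has a weak cluster point `h₀`. If `(e₀, h₀)` were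
outside the closed convex set, a separating functional would contradict the values at indices where
`e k` is near `e₀` and `h k` is weakly near `h₀`. -/
theorem exists_mem_of_bounded_seq {E H : Type*} [NormedAddCommGroup E] [NormedSpace ℝ E]
    [NormedAddCommGroup H] [InnerProductSpace ℝ H] [CompleteSpace H] {C : Set (E × H)}
    (hconv : Convex ℝ C) (hclosed : IsClosed C) {e : ℕ → E} {h : ℕ → H} {e₀ : E}
    (he : Tendsto e atTop (𝓝 e₀)) (hmem : ∀ k, (e k, h k) ∈ C) {R : ℝ} (hR : ∀ k, ‖h k‖ ≤ R) :
    ∃ h₀, (e₀, h₀) ∈ C := by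
  set x : ℕ → WeakDual ℝ H := fun k => StrongDual.toWeakDual (InnerProductSpace.toDual ℝ H (h k))
    with hx
  have hcomp := WeakDual.isCompact_closedBall (𝕜 := ℝ) (E := H) 0 R
  have hxmem : ∀ k, x k ∈ (WeakDual.toStrongDual ⁻¹' Metric.closedBall (0 : StrongDual ℝ H) R) := by
    intro k
    rw [Set.mem_preimage, mem_closedBall_zero_iff]
    exact ((InnerProductSpace.toDual ℝ H).norm_map (h k)).trans_le (hR k)
  obtain ⟨ξ, -, hξ⟩ := hcomp.exists_mapClusterPt (f := atTop) (u := x)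
    (tendsto_principal.2 (Eventually.of_forall hxmem))
  set h₀ : H := (InnerProductSpace.toDual ℝ H).symm (WeakDual.toStrongDual ξ) with hh₀
  refine ⟨h₀, ?_⟩
  by_contra hcon
  obtain ⟨ℓ, u, hu, hC⟩ := geometric_hahn_banach_point_closed hconv hclosed hcon
  set v : H := (InnerProductSpace.toDual ℝ H).symm (ℓ.comp (ContinuousLinearMap.inr ℝ E H)) with hv
  have hsplit : ∀ a b, ℓ (a, b) = ℓ (a, 0) + inner ℝ b v := by
    intro a b
    rw [real_inner_comm, hv, InnerProductSpace.toDual_symm_apply]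
    simp [← map_add]
  have hξv : ∀ b : ℝ, ξ v < b → ∃ᶠ k in atTop, x k v < b := fun b hb =>
    ((hξ.continuousAt_comp (WeakDual.eval_continuous v).continuousAt).frequently
      (Iio_mem_nhds hb))
  have hξ₀ : ξ v = inner ℝ h₀ v := by
    rw [hh₀, InnerProductSpace.toDual_symm_apply]; rfl
  rw [hsplit] at hu
  -- Half the separation gap: one half for the error in `e k`, one for the error in `h k`.
  set η := (u - (ℓ (e₀, 0) + inner ℝ h₀ v)) / 2 with hη
  have hη0 : 0 < η := by rw [hη]; linarith
  have h1 : ∀ᶠ k in atTop, ℓ (e k, 0) < ℓ (e₀, 0) + η := by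
    have : Tendsto (fun k => ℓ (e k, 0)) atTop (𝓝 (ℓ (e₀, 0))) :=
      ((ℓ.continuous.comp (continuous_id.prodMk continuous_const)).tendsto e₀).comp he
    exact this.eventually (Iio_mem_nhds (by linarith))
  obtain ⟨k, hk1, hk2⟩ := ((hξv (inner ℝ h₀ v + η) (by rw [hξ₀]; linarith)).and_eventually h1).exists
  have hk3 := hC _ (hmem k)
  rw [hsplit] at hk3
  have hk4 : inner ℝ (h k) v < inner ℝ h₀ v + η := hk1
  linarith

/-! ### Mollification -/

-- Each derivative falls on the smooth compactly supported factor, so only boundedness of `F` is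
-- needed. The induction ranges over all spaces `E`, `E'` because `fderiv ℝ ρ` takes values in a new
-- space.
open scoped Convolution in
theorem exists_bound_iteratedFDeriv_convolution {G : Type} [NormedAddCommGroup G]
    [InnerProductSpace ℝ G] [FiniteDimensional ℝ G] [MeasurableSpace G] [BorelSpace G]
    {F : G → ℝ} (hF : Measurable F) {M : ℝ} (hM : ∀ y, |F y| ≤ M) (k : ℕ) :
    ∀ (E E' : Type) [NormedAddCommGroup E] [NormedSpace ℝ E] [NormedAddCommGroup E']
      [NormedSpace ℝ E'] (B : E →L[ℝ] ℝ →L[ℝ] E') (ρ : G → E), ContDiff ℝ ∞ ρ →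
      HasCompactSupport ρ → ∃ C : ℝ, ∀ y, ‖iteratedFDeriv ℝ k (ρ ⋆[B, volume] F) y‖ ≤ C := by
  have hloc : LocallyIntegrable F (volume : Measure G) := by
    refine LocallyIntegrable.mono (locallyIntegrable_const M) hF.aestronglyMeasurable
      (Eventually.of_forall fun y => ?_)
    exact (hM y).trans (le_abs_self M)
  induction k with
  | zero =>
    intro E E' _ _ _ _ B ρ hρ hc
    refine ⟨∫ t, ‖B‖ * ‖ρ t‖ * M, fun y => ?_⟩
    rw [norm_iteratedFDeriv_zero, convolution_def]
    refine norm_integral_le_of_norm_le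
      (((hρ.continuous.integrable_of_hasCompactSupport hc).norm.const_mul _).mul_const _)
      (Eventually.of_forall fun t => (B.le_opNorm₂ _ _).trans ?_)
    gcongr
    exact hM _
  | succ k ih =>
    intro E E' _ _ _ _ B ρ hρ hc
    obtain ⟨C, hC⟩ := ih (G →L[ℝ] E) (G →L[ℝ] E') (B.precompL G) (fderiv ℝ ρ)
      (hρ.fderiv_right (by simp)) (hc.fderiv ℝ)
    refine ⟨C, fun y => ?_⟩
    have e : fderiv ℝ (ρ ⋆[B, volume] F) = (fderiv ℝ ρ) ⋆[B.precompL G, volume] F := by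
      ext1 z
      exact (hc.hasFDerivAt_convolution_left B (hρ.of_le (by simp)) hloc z).fderiv
    rw [← norm_iteratedFDeriv_fderiv, e]
    exact hC y

/-- The convolution of a function with a mollifier. -/
noncomputable def mollify {N : ℕ} (ρ F : EuclideanSpace ℝ (Fin N) → ℝ)
    (y : EuclideanSpace ℝ (Fin N)) : ℝ := ∫ t, ρ t * F (y - t)

section Mollify

variable {N : ℕ} {ρ F : EuclideanSpace ℝ (Fin N) → ℝ}

theorem isSmoothBounded_mollify (hρ : ContDiff ℝ ∞ ρ) (hc : HasCompactSupport ρ)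
    (hF : Measurable F) {M : ℝ} (hM : ∀ y, |F y| ≤ M) : IsSmoothBounded (mollify ρ F) := by
  have hloc : LocallyIntegrable F volume := by
    refine LocallyIntegrable.mono (locallyIntegrable_const M) hF.aestronglyMeasurable
      (Eventually.of_forall fun y => ?_)
    exact (hM y).trans (le_abs_self M)
  exact ⟨hc.contDiff_convolution_left (ContinuousLinearMap.lsmul ℝ ℝ) hρ hloc, fun k =>
    exists_bound_iteratedFDeriv_convolution hF hM k ℝ ℝ (ContinuousLinearMap.lsmul ℝ ℝ) ρ hρ hc⟩

theorem integrable_mollify (hρ : Integrable ρ) (hF : Measurable F) {M : ℝ} (hM : ∀ y, |F y| ≤ M)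
    (y : EuclideanSpace ℝ (Fin N)) : Integrable (fun t => ρ t * F (y - t)) :=
  hρ.mul_bdd (hF.comp (measurable_const.sub measurable_id)).aestronglyMeasurable
    (Eventually.of_forall fun t => hM (y - t))

theorem abs_mollify_le (hρ : Integrable ρ) (hρ0 : ∀ t, 0 ≤ ρ t) (hρ1 : ∫ t, ρ t = 1) {M : ℝ}
    (hM : ∀ y, |F y| ≤ M) (y : EuclideanSpace ℝ (Fin N)) : |mollify ρ F y| ≤ M := by
  have h : ‖mollify ρ F y‖ ≤ ∫ t, ρ t * M :=
    norm_integral_le_of_norm_le (hρ.mul_const _) (Eventually.of_forall fun t => by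
      rw [norm_mul, Real.norm_of_nonneg (hρ0 t)]
      exact mul_le_mul_of_nonneg_left (hM _) (hρ0 t))
  rwa [integral_mul_const, hρ1, one_mul] at h

/-- A difference of mollified values is an average of differences of `F` along one fixed shift, so
the almost everywhere bound for each shift becomes a bound at all points. -/
theorem lipschitzWith_mollify (hρ : Integrable ρ) (hρ0 : ∀ t, 0 ≤ ρ t) (hρ1 : ∫ t, ρ t = 1)
    (hF : Measurable F) {M : ℝ} (hM : ∀ y, |F y| ≤ M) {L : ℝ≥0}
    (hL : ∀ h, ∀ᵐ y, |F (y + h) - F y| ≤ L * ‖h‖) : LipschitzWith L (mollify ρ F) := by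
  refine LipschitzWith.of_dist_le_mul fun y z => ?_
  rw [dist_eq_norm, dist_eq_norm, mollify, mollify,
    ← integral_sub (integrable_mollify hρ hF hM y) (integrable_mollify hρ hF hM z)]
  have h : ∀ᵐ t, ‖ρ t * F (y - t) - ρ t * F (z - t)‖ ≤ ρ t * (L * ‖y - z‖) := by
    have := (Measure.measurePreserving_sub_left volume z).quasiMeasurePreserving.ae (hL (y - z))
    filter_upwards [this] with t ht
    rw [← mul_sub, norm_mul, Real.norm_of_nonneg (hρ0 t), Real.norm_eq_abs]
    refine mul_le_mul_of_nonneg_left ?_ (hρ0 t)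
    rwa [show z - t + (y - z) = y - t by abel] at ht
  refine (norm_integral_le_of_norm_le (hρ.mul_const _) h).trans_eq ?_
  rw [integral_mul_const, hρ1, one_mul]

/-- Fubini turns "for each shift, almost every point" into "for almost every point, almost every
shift". The measure `μ` need not be Lebesgue; it is applied to the Gaussian law. -/
theorem ae_abs_mollify_sub_le (hρ : Integrable ρ) (hρ0 : ∀ t, 0 ≤ ρ t) (hρ1 : ∫ t, ρ t = 1)
    (hF : Measurable F) {M : ℝ} (hM : ∀ y, |F y| ≤ M) {L : ℝ≥0} {r : ℝ}
    (hr : ∀ t, ρ t ≠ 0 → ‖t‖ ≤ r) {μ : Measure (EuclideanSpace ℝ (Fin N))} [SFinite μ]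
    (hL : ∀ h, ∀ᵐ y ∂μ, |F (y + h) - F y| ≤ L * ‖h‖) :
    ∀ᵐ y ∂μ, |mollify ρ F y - F y| ≤ L * r := by
  have hm : MeasurableSet {p : EuclideanSpace ℝ (Fin N) × EuclideanSpace ℝ (Fin N) |
      |F (p.2 + -p.1) - F p.2| ≤ L * ‖-p.1‖} := by
    refine measurableSet_le ?_ ?_
    · exact ((hF.comp (measurable_snd.add measurable_fst.neg)).sub
        (hF.comp measurable_snd)).norm
    · fun_prop
  have h1 : ∀ᵐ t ∂(volume : Measure (EuclideanSpace ℝ (Fin N))), ∀ᵐ y ∂μ,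
      |F (y + -t) - F y| ≤ L * ‖-t‖ := Eventually.of_forall fun t => hL (-t)
  rw [Measure.ae_ae_comm hm] at h1
  filter_upwards [h1] with y hy
  have e : mollify ρ F y - F y = ∫ t, (ρ t * F (y - t) - ρ t * F y) := by
    rw [integral_sub (integrable_mollify hρ hF hM y) (hρ.mul_const _), integral_mul_const, hρ1,
      one_mul, mollify]
  rw [e]
  have h : ∀ᵐ t, ‖ρ t * F (y - t) - ρ t * F y‖ ≤ ρ t * (L * r) := by
    filter_upwards [hy] with t ht
    rw [← mul_sub, norm_mul, Real.norm_of_nonneg (hρ0 t), Real.norm_eq_abs]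
    by_cases h0 : ρ t = 0
    · simp [h0]
    refine mul_le_mul_of_nonneg_left ?_ (hρ0 t)
    rw [sub_eq_add_neg]
    refine ht.trans ?_
    rw [norm_neg]
    gcongr
    exact hr t h0
  refine (norm_integral_le_of_norm_le (hρ.mul_const _) h).trans_eq ?_
  rw [integral_mul_const, hρ1, one_mul]

end Mollify

/-! ### Averages over all but finitely many coordinates -/

section Average

variable {f g : (ℕ → ℝ) → ℝ} {N : ℕ}

theorem measurable_average (hf : Measurable f) : Measurable (average N f) :=
  ((hf.comp (measurable_glue N)).stronglyMeasurable.integral_prod_right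
    (f := fun p : EuclideanSpace ℝ (Fin N) => fun z => f (glue N p z))
    (ν := gaussianProduct)).measurable

theorem abs_average_le {M : ℝ} (hM : ∀ x, |f x| ≤ M) (y : EuclideanSpace ℝ (Fin N)) :
    |average N f y| ≤ M := by
  have := norm_integral_le_of_norm_le_const (μ := gaussianProduct) (f := fun z => f (glue N y z))
    (Eventually.of_forall fun z => hM (glue N y z))
  simpa [average] using this

theorem measurable_glue_right (y : EuclideanSpace ℝ (Fin N)) : Measurable (glue N y) :=
  (measurable_glue N).comp (measurable_const.prodMk measurable_id)

theorem integrable_comp_glue (hf : Measurable f) {M : ℝ} (hM : ∀ x, |f x| ≤ M)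
    (y : EuclideanSpace ℝ (Fin N)) : Integrable (fun z => f (glue N y z)) gaussianProduct :=
  memLp_one_iff_integrable.1 (MemLp.of_bound
    (hf.comp (measurable_glue_right y)).aestronglyMeasurable M
    (Eventually.of_forall fun _ => hM _))

theorem ae_abs_average_translate_sub_le (hf : Measurable f) {M : ℝ} (hM : ∀ x, |f x| ≤ M)
    {L : ℝ≥0} (hL : lipNumber gaussianProduct l2Dist f ≤ L) (h : EuclideanSpace ℝ (Fin N)) :
    ∀ᵐ y ∂gaussianLaw N, |average N f (y + h) - average N f y| ≤ L * ‖h‖ := by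
  have h1 := ae_abs_translate_sub_le hf hL h
  have h2 := (measurePreserving_glue N).quasiMeasurePreserving.ae h1
  filter_upwards [Measure.ae_ae_of_ae_prod h2] with y hy
  rw [average, average, ← integral_sub (integrable_comp_glue hf hM _) (integrable_comp_glue hf hM _)]
  have := norm_integral_le_of_norm_le_const (μ := gaussianProduct)
    (f := fun z => f (glue N (y + h) z) - f (glue N y z)) (C := L * ‖h‖) (by
      filter_upwards [hy] with z hz
      rw [glue_add]
      exact hz)
  simpa using this

theorem average_sub (hf : Measurable f) {M : ℝ} (hM : ∀ x, |f x| ≤ M) (hg : Measurable g)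
    (hM' : ∀ x, |g x| ≤ M) (y : EuclideanSpace ℝ (Fin N)) :
    average N (fun x => f x - g x) y = average N f y - average N g y :=
  integral_sub (integrable_comp_glue hf hM y) (integrable_comp_glue hg hM' y)

/-- Averaging contracts `L²`: Jensen's inequality in the averaged coordinates, then Fubini for
gluing. -/
theorem eLpNorm_average_le (hf : Measurable f) :
    eLpNorm (fun x => average N f (firstCoords N x)) 2 gaussianProduct ≤
      eLpNorm f 2 gaussianProduct := by
  have h2 : ∀ u : (ℕ → ℝ) → ℝ, eLpNorm u 2 gaussianProduct =
      (∫⁻ x, ‖u x‖ₑ ^ (2 : ℝ) ∂gaussianProduct) ^ (1 / (2 : ℝ)) := fun u => by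
    rw [eLpNorm_eq_lintegral_rpow_enorm_toReal (by norm_num) (by norm_num)]
    norm_num
  rw [h2, h2]
  refine ENNReal.rpow_le_rpow ?_ (by norm_num)
  have hpt : ∀ y : EuclideanSpace ℝ (Fin N), ‖average N f y‖ₑ ^ (2 : ℝ) ≤
      ∫⁻ z, ‖f (glue N y z)‖ₑ ^ (2 : ℝ) ∂gaussianProduct := by
    intro y
    have h3 : ‖average N f y‖ₑ ≤ eLpNorm (fun z => f (glue N y z)) 2 gaussianProduct := by
      refine (enorm_integral_le_lintegral_enorm _).trans ?_
      rw [← eLpNorm_one_eq_lintegral_enorm]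
      exact eLpNorm_le_eLpNorm_of_exponent_le (by norm_num)
        (hf.comp (measurable_glue_right y)).aestronglyMeasurable
    rw [h2] at h3
    have := ENNReal.rpow_le_rpow h3 (by norm_num : (0 : ℝ) ≤ 2)
    rwa [← ENNReal.rpow_mul, show (1 / 2 : ℝ) * 2 = 1 by norm_num, ENNReal.rpow_one] at this
  have hm := measurePreserving_glue N
  calc ∫⁻ x, ‖average N f (firstCoords N x)‖ₑ ^ (2 : ℝ) ∂gaussianProduct
      = ∫⁻ y, ‖average N f y‖ₑ ^ (2 : ℝ) ∂gaussianLaw N := by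
        rw [gaussianLaw, lintegral_map ((measurable_average hf).enorm.pow_const _)
          (measurable_firstCoords N)]
    _ ≤ ∫⁻ y, ∫⁻ z, ‖f (glue N y z)‖ₑ ^ (2 : ℝ) ∂gaussianProduct ∂gaussianLaw N :=
        lintegral_mono hpt
    _ = ∫⁻ x, ‖f x‖ₑ ^ (2 : ℝ) ∂gaussianProduct := by
        rw [← hm.lintegral_comp (hf.enorm.pow_const _)]
        exact (lintegral_prod _ ((hf.enorm.pow_const _).comp hm.measurable).aemeasurable).symm

/-- Averaging contracts `L²` and fixes functions of the first `n` coordinates; cylinder functions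
are dense, so an approximating one supplies the number of coordinates. -/
theorem exists_eLpNorm_average_sub_lt (hf : Measurable f) {M : ℝ≥0} (hM : ∀ x, |f x| ≤ M)
    {ε : ℝ≥0∞} (hε : 0 < ε) :
    ∃ N, eLpNorm (fun x => average N f (firstCoords N x) - f x) 2 gaussianProduct < ε := by
  have hf2 : MemLp f 2 gaussianProduct :=
    MemLp.of_bound hf.aestronglyMeasurable M (Eventually.of_forall hM)
  obtain ⟨u, U, hu, hlt⟩ := exists_isCylinder_eLpNorm_sub_lt hf2 (ENNReal.half_pos hε.ne')
  obtain ⟨C, hC, -⟩ := hu.exists_bound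
  have hum := hu.continuous.measurable
  obtain ⟨n, φ, hφ, rfl, rfl⟩ := hu
  refine ⟨n, ?_⟩
  have e : (fun x => average n f (firstCoords n x) - f x) =
      (fun x => average n (fun x => f x - φ (firstCoords n x)) (firstCoords n x)) -
        (f - fun x => φ (firstCoords n x)) := by
    ext1 x
    simp only [Pi.sub_apply]
    rw [average_sub hf (M := max M C) (fun x => (hM x).trans (le_max_left _ _)) hum
      (fun x => (hC x).trans (le_max_right _ _))]
    have : average n (fun x => φ (firstCoords n x)) (firstCoords n x) = φ (firstCoords n x) := by
      simp [average]
    rw [this]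
    ring
  rw [e]
  have hd : Measurable fun x => f x - φ (firstCoords n x) := hf.sub hum
  refine (eLpNorm_sub_le ((measurable_average hd).comp
    (measurable_firstCoords n)).aestronglyMeasurable hd.aestronglyMeasurable (by norm_num)).trans_lt ?_
  rw [← ENNReal.add_halves ε]
  exact ENNReal.add_lt_add ((eLpNorm_average_le hd).trans_lt hlt) hlt

end Average

/-- Functions of finite Lipschitz number are limits of smooth Lipschitz cylinder functions. -/
theorem exists_smooth_approx {f : (ℕ → ℝ) → ℝ} (hf : Measurable f) {M L : ℝ≥0}
    (hM : ∀ x, |f x| ≤ M) (hL : lipNumber gaussianProduct l2Dist f ≤ L) {ε : ℝ≥0∞} (hε : 0 < ε) :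
    ∃ (N : ℕ) (φ : EuclideanSpace ℝ (Fin N) → ℝ), IsSmoothBounded φ ∧ (∀ y, |φ y| ≤ M) ∧
      LipschitzWith L φ ∧ eLpNorm (fun x => φ (firstCoords N x) - f x) 2 gaussianProduct < ε := by
  obtain ⟨N, hN⟩ := exists_eLpNorm_average_sub_lt hf hM (ENNReal.half_pos hε.ne')
  -- A mollifier of radius `r` moves a function with Lipschitz bound `L` by at most `L r`.
  obtain ⟨r, hr0, hr⟩ : ∃ r : ℝ, 0 < r ∧ ENNReal.ofReal (L * r) < ε / 2 := by
    have : Tendsto (fun r : ℝ => ENNReal.ofReal (L * r)) (𝓝[>] 0) (𝓝 0) := by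
      have h : Continuous fun r : ℝ => ENNReal.ofReal (L * r) :=
        ENNReal.continuous_ofReal.comp (by fun_prop)
      simpa using (h.tendsto 0).mono_left nhdsWithin_le_nhds
    obtain ⟨r, h1, h2⟩ := ((this.eventually (Iio_mem_nhds (ENNReal.half_pos hε.ne'))).and
      self_mem_nhdsWithin).exists
    exact ⟨r, h2, h1⟩
  let b : ContDiffBump (0 : EuclideanSpace ℝ (Fin N)) := ⟨r / 2, r, by positivity, by linarith⟩
  set ρ := b.normed volume with hρ
  have hF := measurable_average (N := N) hf
  have hFM := abs_average_le (N := N) hM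
  have hFL := ae_abs_average_translate_sub_le (N := N) hf hM hL
  have hρi : Integrable ρ := b.integrable_normed
  have hρ0 : ∀ t, 0 ≤ ρ t := b.nonneg_normed
  have hρ1 : ∫ t, ρ t = 1 := b.integral_normed
  have hsm := isSmoothBounded_mollify b.contDiff_normed b.hasCompactSupport_normed hF hFM (ρ := ρ)
  refine ⟨N, mollify ρ (average N f), hsm, abs_mollify_le hρi hρ0 hρ1 hFM,
    lipschitzWith_mollify hρi hρ0 hρ1 hF hFM fun h =>
      volume_absolutelyContinuous_gaussianLaw N (hFL h), ?_⟩
  have hsup : ∀ t, ρ t ≠ 0 → ‖t‖ ≤ r := by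
    intro t ht
    have : t ∈ Function.support ρ := ht
    rw [hρ, b.support_normed_eq] at this
    exact (mem_ball_zero_iff.1 this).le
  have hae := ae_abs_mollify_sub_le hρi hρ0 hρ1 hF hFM hsup hFL
  have hae' := ae_of_ae_map (measurable_firstCoords N).aemeasurable hae
  have e : (fun x => mollify ρ (average N f) (firstCoords N x) - f x) =
      (fun x => mollify ρ (average N f) (firstCoords N x) - average N f (firstCoords N x)) +
        fun x => average N f (firstCoords N x) - f x := by
    ext1 x; simp
  have m1 : Measurable fun x => average N f (firstCoords N x) := hF.comp (measurable_firstCoords N)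
  have m2 : Measurable fun x => mollify ρ (average N f) (firstCoords N x) :=
    hsm.1.continuous.measurable.comp (measurable_firstCoords N)
  rw [e]
  refine (eLpNorm_add_le (m2.sub m1).aestronglyMeasurable (m1.sub hf).aestronglyMeasurable
    (by norm_num)).trans_lt ?_
  rw [← ENNReal.add_halves ε]
  refine ENNReal.add_lt_add (lt_of_le_of_lt ?_ hr) hN
  refine (eLpNorm_le_of_ae_bound hae').trans ?_
  simp

/-! ### The derivative of Lipschitz functions -/

theorem lp_ae_norm_le {E α : Type*} [MeasurableSpace α] {μ : Measure α} [NormedAddCommGroup E]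
    (f : Lp E ⊤ μ) : ∀ᵐ x ∂μ, ‖f x‖ ≤ ‖f‖ := by
  have bd : ∀ᵐ x ∂μ, ‖f x‖ₑ ≤ ‖f‖ₑ := by
    rw [Lp.enorm_def, eLpNorm_exponent_top]; exact ae_le_eLpNormEssSup
  filter_upwards [bd] with x hx
  rw [enorm_eq_nnnorm, enorm_eq_nnnorm, ENNReal.coe_le_coe] at hx
  exact hx

theorem lp_enorm_le_of_ae_norm_le {E α : Type*} [MeasurableSpace α] {μ : Measure α}
    [NormedAddCommGroup E] {f : Lp E ⊤ μ} {C : ℝ≥0} (h : ∀ᵐ x ∂μ, ‖f x‖ ≤ C) : ‖f‖ₑ ≤ C := by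
  rw [Lp.enorm_def, eLpNorm_exponent_top]
  exact (eLpNormEssSup_le_of_ae_bound h).trans (by simp)

theorem exists_bounded_representative (f : Lp ℝ ⊤ gaussianProduct) :
    ∃ g : (ℕ → ℝ) → ℝ, Measurable g ∧ (∀ x, |g x| ≤ ‖f‖₊) ∧ f =ᵐ[gaussianProduct] g := by
  refine ⟨fun x => max (-‖f‖) (min ‖f‖ (f x)), ?_, fun x => ?_, ?_⟩
  · exact measurable_const.max (measurable_const.min (Lp.stronglyMeasurable f).measurable)
  · rw [abs_le, coe_nnnorm]
    exact ⟨le_max_left _ _, max_le (by linarith [norm_nonneg f]) (min_le_left _ _)⟩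
  · filter_upwards [lp_ae_norm_le f] with x hx
    rw [Real.norm_eq_abs, abs_le] at hx
    rw [min_eq_right hx.2, max_eq_right hx.1]

/-- The estimate by absolute coordinate differences is the one that `kills_of_coord` requires, since
its cones are sums of one-variable functions. -/
theorem sum_abs_bound {N : ℕ} {φ : EuclideanSpace ℝ (Fin N) → ℝ} {L : ℝ≥0} (h : LipschitzWith L φ)
    (x y : ℕ → ℝ) : |φ (firstCoords N x) - φ (firstCoords N y)| ≤
      L * ∑ i ∈ Finset.range N, |x i - y i| := by
  have h1 := h.dist_le_mul (firstCoords N x) (firstCoords N y)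
  rw [Real.dist_eq, dist_eq_norm] at h1
  refine h1.trans (mul_le_mul_of_nonneg_left ?_ L.2)
  set v := firstCoords N x - firstCoords N y with hv
  have : v = ∑ i, v i • EuclideanSpace.single i (1 : ℝ) := by
    ext j
    simp [Pi.single_apply]
  rw [this, Finset.sum_range]
  refine (norm_sum_le _ _).trans (Finset.sum_le_sum fun i _ => ?_)
  rw [norm_smul]
  simp [hv]

/-- Approximation of an element of the Lipschitz algebra by smooth cylinder functions. -/
theorem exists_isCylinder_seq (f : Lip gaussianProduct l2Dist) {L : ℝ≥0}
    (hL : lipNumber gaussianProduct l2Dist (f : Lp ℝ ⊤ gaussianProduct) ≤ L) :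
    ∃ (u : ℕ → (ℕ → ℝ) → ℝ) (U : ℕ → (ℕ → ℝ) → HilbertL2),
      (∀ k, IsCylinder (u k) (U k)) ∧ (∀ k, IsBddLip (u k) ‖(f : Lp ℝ ⊤ gaussianProduct)‖₊ L) ∧
      (∀ k x, ‖U k x‖ ≤ L) ∧
      (∀ k, ∃ N, ∀ x y, |u k x - u k y| ≤ L * ∑ i ∈ Finset.range N, |x i - y i|) ∧
      Tendsto (fun k => eLpNorm (u k - ((f : Lp ℝ ⊤ gaussianProduct) : (ℕ → ℝ) → ℝ)) 2 gaussianProduct) atTop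
        (𝓝 0) ∧
      ∀ᵐ x ∂gaussianProduct, Tendsto (fun k => u k x) atTop
        (𝓝 ((f : Lp ℝ ⊤ gaussianProduct) x)) := by
  obtain ⟨g, hg, hgb, hfg⟩ := exists_bounded_representative (f : Lp ℝ ⊤ gaussianProduct)
  rw [lipNumber_congr hfg] at hL
  have hε : ∀ k : ℕ, (0 : ℝ≥0∞) < (k + 1 : ℝ≥0∞)⁻¹ := fun k => by simp
  choose N φ hφ hφM hφL hφε using fun k => exists_smooth_approx hg hgb hL (hε k)
  have hc : ∀ k, IsCylinder (fun x => φ k (firstCoords (N k) x)) (cylinderGradient (φ k)) :=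
    fun k => ⟨N k, φ k, hφ k, rfl, rfl⟩
  have hbl : ∀ k, IsBddLip (fun x => φ k (firstCoords (N k) x))
      ‖(f : Lp ℝ ⊤ gaussianProduct)‖₊ L := fun k =>
    ⟨(hc k).continuous.measurable, fun x => hφM k _, fun x y => ((hφL k) _ _).trans
      (mul_le_mul_right (edist_firstCoords_le_l2Dist (N k) x y) _)⟩
  have hU : ∀ k x, ‖cylinderGradient (φ k) x‖ ≤ L := fun k x =>
    (norm_cylinderGradient_le _ x).trans (norm_fderiv_le_of_lipschitz ℝ (hφL k))
  have ht : Tendsto (fun k => eLpNorm ((fun x => φ k (firstCoords (N k) x)) -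
      ((f : Lp ℝ ⊤ gaussianProduct) : (ℕ → ℝ) → ℝ)) 2 gaussianProduct) atTop (𝓝 0) := by
    refine tendsto_of_tendsto_of_tendsto_of_le_of_le tendsto_const_nhds
      ((ENNReal.tendsto_inv_nat_nhds_zero).comp (tendsto_add_atTop_nat 1)) (fun _ => zero_le)
      fun k => ?_
    rw [eLpNorm_congr_ae ((ae_eq_refl _).sub hfg)]
    refine (hφε k).le.trans_eq ?_
    simp
  -- A subsequence converges almost everywhere, as the weak* limit argument requires.
  obtain ⟨ns, hns, hae⟩ := (tendstoInMeasure_of_tendsto_eLpNorm (by norm_num)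
    (fun k => (hc k).continuous.aestronglyMeasurable) (Lp.aestronglyMeasurable _)
    ht).exists_seq_tendsto_ae
  exact ⟨fun k x => φ (ns k) (firstCoords (N (ns k)) x), fun k => cylinderGradient (φ (ns k)),
    fun k => hc _, fun k => hbl _, fun k => hU _,
    fun k => ⟨N (ns k), fun x y => sum_abs_bound (hφL _) x y⟩, ht.comp hns.tendsto_atTop, hae⟩

theorem isClosed_ae_norm_le (L : ℝ) : IsClosed {q : Lp HilbertL2 2 gaussianProduct |
    ∀ᵐ x ∂gaussianProduct, ‖q x‖ ≤ L} := by
  refine IsSeqClosed.isClosed fun q p hq hqp => ?_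
  obtain ⟨ns, -, hae⟩ := (tendstoInMeasure_of_tendsto_Lp hqp).exists_seq_tendsto_ae
  filter_upwards [hae, ae_all_iff.2 hq] with x hx hb
  exact le_of_tendsto hx.norm (Eventually.of_forall fun k => hb _)

theorem convex_ae_norm_le (L : ℝ) : Convex ℝ {q : Lp HilbertL2 2 gaussianProduct |
    ∀ᵐ x ∂gaussianProduct, ‖q x‖ ≤ L} := by
  intro p hp q hq a b ha hb hab
  filter_upwards [hp, hq, Lp.coeFn_add (a • p) (b • q), Lp.coeFn_smul a p, Lp.coeFn_smul b q]
    with x h1 h2 h3 h4 h5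
  rw [h3, Pi.add_apply, h4, h5]
  simpa using (convex_closedBall (0 : HilbertL2) L) (mem_closedBall_zero_iff.2 h1)
    (mem_closedBall_zero_iff.2 h2) ha hb hab

/-- The gradients of the approximants are bounded by `L`, so they have a weak cluster point. The set
of pairs in the closed graph whose derivative is bounded by `L` is closed and convex, so the limit
pair stays in it. -/
theorem exists_grossDerivative (f : Lip gaussianProduct l2Dist) :
    ∃ G : Lp HilbertL2 ⊤ gaussianProduct,
      IsGrossSobolevDerivative (f : Lp ℝ ⊤ gaussianProduct) G ∧
      ‖G‖ₑ ≤ lipNumber gaussianProduct l2Dist (f : Lp ℝ ⊤ gaussianProduct) := by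
  have hf : lipNumber gaussianProduct l2Dist (f : Lp ℝ ⊤ gaussianProduct) < ⊤ := f.2
  obtain ⟨L, hL⟩ : ∃ L : ℝ≥0, (L : ℝ≥0∞) = _ := ⟨_, ENNReal.coe_toNNReal hf.ne⟩
  obtain ⟨u, U, hc, -, hU, -, ht, -⟩ := exists_isCylinder_seq f hL.ge
  have mf : MemLp (f : Lp ℝ ⊤ gaussianProduct) 2 gaussianProduct :=
    (Lp.memLp _).mono_exponent le_top
  set C : Set (Lp ℝ 2 gaussianProduct × Lp HilbertL2 2 gaussianProduct) :=
    closure cylinderGradientGraph ∩ Prod.snd ⁻¹' {q | ∀ᵐ x ∂gaussianProduct, ‖q x‖ ≤ L} with hC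
  have hconv : Convex ℝ C := by
    refine Convex.inter ?_ ?_
    · exact cylinderGradientSubmodule.topologicalClosure.convex
    · exact (convex_ae_norm_le L).linear_preimage (LinearMap.snd ℝ _ _)
  have hclosed : IsClosed C := isClosed_closure.inter ((isClosed_ae_norm_le L).preimage continuous_snd)
  obtain ⟨G, hG1, hG2⟩ := exists_mem_of_bounded_seq hconv hclosed
    (e := fun k => ((hc k).memLp 2).toLp (u k)) (h := fun k => ((hc k).memLp_gradient 2).toLp (U k))
    (e₀ := mf.toLp _) ((Lp.tendsto_Lp_iff_tendsto_eLpNorm'' _ _ _ _).2 ht)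
    (fun k => ⟨subset_closure (mem_cylinderGradientGraph.2 ⟨u k, U k, hc k,
      MemLp.coeFn_toLp ((hc k).memLp 2), MemLp.coeFn_toLp ((hc k).memLp_gradient 2)⟩), by
        filter_upwards [((hc k).memLp_gradient 2).coeFn_toLp] with x hx
        rw [hx]
        exact hU k x⟩) (R := measureUnivNNReal gaussianProduct ^ (2 : ℝ≥0∞).toReal⁻¹ * (L : ℝ))
    (fun k => Lp.norm_le_of_ae_bound L.2 (by
        filter_upwards [((hc k).memLp_gradient 2).coeFn_toLp] with x hx
        rw [hx]
        exact hU k x))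
  have hG2' : ∀ᵐ x ∂gaussianProduct, ‖G x‖ ≤ L := hG2
  have mG : MemLp G ⊤ gaussianProduct := memLp_top_of_bound (Lp.aestronglyMeasurable G) L hG2'
  refine ⟨mG.toLp G, ⟨(mf.toLp _, G), hG1, mf.coeFn_toLp, mG.coeFn_toLp.symm⟩, ?_⟩
  rw [← hL]
  refine lp_enorm_le_of_ae_norm_le ?_
  filter_upwards [mG.coeFn_toLp, hG2'] with x h1 h2
  rwa [h1]

/-- The Gross-Sobolev derivative as a map on the Lipschitz algebra. -/
noncomputable def grossDeriv : Lip gaussianProduct l2Dist →ₗ[ℝ] Lp HilbertL2 ⊤ gaussianProduct where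
  toFun f := (exists_grossDerivative f).choose
  map_add' f g := by
    refine Lp.ext (((exists_grossDerivative (f + g)).choose_spec.1.unique ?_).trans
      (Lp.coeFn_add _ _).symm)
    exact ((exists_grossDerivative f).choose_spec.1.add
      (exists_grossDerivative g).choose_spec.1).congr (Lp.coeFn_add _ _).symm (ae_eq_refl _)
  map_smul' c f := by
    refine Lp.ext (((exists_grossDerivative (c • f)).choose_spec.1.unique ?_).trans
      (Lp.coeFn_smul _ _).symm)
    refine ((exists_grossDerivative f).choose_spec.1.const_mul c).congr ?_ (ae_eq_refl _)
    exact (Lp.coeFn_smul c (f : Lp ℝ ⊤ gaussianProduct)).symm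

theorem isGrossSobolevDerivative_grossDeriv (f : Lip gaussianProduct l2Dist) :
    IsGrossSobolevDerivative (f : Lp ℝ ⊤ gaussianProduct) (grossDeriv f) :=
  (exists_grossDerivative f).choose_spec.1

theorem enorm_grossDeriv_le (f : Lip gaussianProduct l2Dist) :
    ‖grossDeriv f‖ₑ ≤ lipNumber gaussianProduct l2Dist (f : Lp ℝ ⊤ gaussianProduct) :=
  (exists_grossDerivative f).choose_spec.2

theorem grossDeriv_ae_eq {f : Lip gaussianProduct l2Dist} {u : (ℕ → ℝ) → ℝ}
    {U : (ℕ → ℝ) → HilbertL2} (hu : IsGrossSobolevDerivative u U)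
    (hf : (f : Lp ℝ ⊤ gaussianProduct) =ᵐ[gaussianProduct] u) :
    grossDeriv f =ᵐ[gaussianProduct] U :=
  (isGrossSobolevDerivative_grossDeriv f).unique (hu.congr hf.symm (ae_eq_refl _))

theorem grossDeriv_lipMul (f g : Lip gaussianProduct l2Dist) :
    grossDeriv (lipMul f g) = (f : Lp ℝ ⊤ gaussianProduct) • grossDeriv g +
      (g : Lp ℝ ⊤ gaussianProduct) • grossDeriv f := by
  have h := (isGrossSobolevDerivative_grossDeriv f).mul (isGrossSobolevDerivative_grossDeriv g)
    (C := max ‖(f : Lp ℝ ⊤ gaussianProduct)‖₊ ‖grossDeriv f‖₊)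
    (by filter_upwards [lp_ae_norm_le (f : Lp ℝ ⊤ gaussianProduct)] with x hx using
      hx.trans (le_max_left _ _))
    (by filter_upwards [lp_ae_norm_le (grossDeriv f)] with x hx using hx.trans (le_max_right _ _))
  refine Lp.ext ((grossDeriv_ae_eq h (Lp.coeFn_lpSMul _ _)).trans ?_)
  filter_upwards [Lp.coeFn_add ((f : Lp ℝ ⊤ gaussianProduct) • grossDeriv g)
    ((g : Lp ℝ ⊤ gaussianProduct) • grossDeriv f : Lp HilbertL2 ⊤ gaussianProduct),
    Lp.coeFn_lpSMul (r := ⊤) (f : Lp ℝ ⊤ gaussianProduct) (grossDeriv g),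
    Lp.coeFn_lpSMul (r := ⊤) (g : Lp ℝ ⊤ gaussianProduct) (grossDeriv f)] with x h1 h2 h3
  rw [h1, Pi.add_apply, h2, h3]
  rfl

/-! ### Vector fields defined by sections -/

/-- The fiberwise inner product of bounded sections. -/
noncomputable def sectionInner (G H : Lp HilbertL2 ⊤ gaussianProduct) : Lp ℝ ⊤ gaussianProduct :=
  (innerSL ℝ : HilbertL2 →L[ℝ] HilbertL2 →L[ℝ] ℝ).holder ⊤ G H

theorem coeFn_sectionInner (G H : Lp HilbertL2 ⊤ gaussianProduct) :
    sectionInner G H =ᵐ[gaussianProduct] fun x => inner ℝ (G x) (H x) :=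
  ContinuousLinearMap.coeFn_holder _ G H

theorem sectionInner_add_left (G G' H : Lp HilbertL2 ⊤ gaussianProduct) :
    sectionInner (G + G') H = sectionInner G H + sectionInner G' H :=
  ContinuousLinearMap.holder_add_left _ _ _ _

theorem sectionInner_add_right (G H H' : Lp HilbertL2 ⊤ gaussianProduct) :
    sectionInner G (H + H') = sectionInner G H + sectionInner G H' :=
  ContinuousLinearMap.holder_add_right _ _ _ _

theorem sectionInner_smul_left (c : ℝ) (G H : Lp HilbertL2 ⊤ gaussianProduct) :
    sectionInner (c • G) H = c • sectionInner G H :=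
  ContinuousLinearMap.holder_smul_left _ _ _ _

theorem sectionInner_smul_right (c : ℝ) (G H : Lp HilbertL2 ⊤ gaussianProduct) :
    sectionInner G (c • H) = c • sectionInner G H :=
  ContinuousLinearMap.holder_smul_right _ _ _ _

theorem sectionInner_lpSMul_left (a : Lp ℝ ⊤ gaussianProduct)
    (G H : Lp HilbertL2 ⊤ gaussianProduct) :
    sectionInner (a • G : Lp HilbertL2 ⊤ gaussianProduct) H = a • sectionInner G H := by
  refine Lp.ext ?_
  filter_upwards [coeFn_sectionInner (a • G : Lp HilbertL2 ⊤ gaussianProduct) H,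
    coeFn_sectionInner G H, Lp.coeFn_lpSMul (r := ⊤) a G,
    Lp.coeFn_lpSMul (r := ⊤) a (sectionInner G H)] with x h1 h2 h3 h4
  rw [h1, h3, h4, Pi.smul_apply', Pi.smul_apply', h2, real_inner_smul_left, smul_eq_mul]

theorem sectionInner_comm (G H : Lp HilbertL2 ⊤ gaussianProduct) :
    sectionInner G H = sectionInner H G := by
  refine Lp.ext ?_
  filter_upwards [coeFn_sectionInner G H, coeFn_sectionInner H G] with x h1 h2
  rw [h1, h2, real_inner_comm]

theorem sectionInner_lpSMul_right (a : Lp ℝ ⊤ gaussianProduct)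
    (G H : Lp HilbertL2 ⊤ gaussianProduct) :
    sectionInner G (a • H : Lp HilbertL2 ⊤ gaussianProduct) = a • sectionInner G H := by
  rw [sectionInner_comm, sectionInner_lpSMul_left, sectionInner_comm]

theorem enorm_sectionInner_le (G H : Lp HilbertL2 ⊤ gaussianProduct) :
    ‖sectionInner G H‖ₑ ≤ ‖G‖ₑ * ‖H‖ₑ := by
  rw [enorm_eq_nnnorm, enorm_eq_nnnorm, enorm_eq_nnnorm, ← ENNReal.coe_mul, ← enorm_eq_nnnorm]
  refine lp_enorm_le_of_ae_norm_le ?_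
  filter_upwards [coeFn_sectionInner G H, lp_ae_norm_le G, lp_ae_norm_le H] with x h1 h2 h3
  rw [h1]
  refine (norm_inner_le_norm _ _).trans ?_
  push_cast
  gcongr

/-- The derivative of a Lipschitz function as a square integrable section. -/
theorem memLp_two_section (G : Lp HilbertL2 ⊤ gaussianProduct) : MemLp G 2 gaussianProduct :=
  (Lp.memLp G).mono_exponent le_top

theorem norm_le_of_lipNorm_le {f : Lip gaussianProduct l2Dist} {r : ℝ≥0} (hf : lipNorm f ≤ r) :
    ∀ᵐ x ∂gaussianProduct, ‖grossDeriv f x‖ ≤ r := by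
  have h : ‖grossDeriv f‖ₑ ≤ r := (enorm_grossDeriv_le f).trans ((le_max_left _ _).trans hf)
  rw [enorm_eq_nnnorm, ENNReal.coe_le_coe] at h
  filter_upwards [lp_ae_norm_le (grossDeriv f)] with x hx using hx.trans h

/-- For `V = ψ e_n` with `ψ` cylindrical, integration by parts rewrites the pairing as the integral
of `f` against an `L¹` function, which is weak* continuous. On the ball all derivatives are bounded
by `r`, so the admissible `V` form a closed subspace, and density gives everything. -/
theorem continuous_inner_grossDeriv (r : ℝ≥0) (V : Lp HilbertL2 2 gaussianProduct) :
    @Continuous _ _ (lipBallWeakStar gaussianProduct l2Dist r) inferInstance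
      (fun f : {f : Lip gaussianProduct l2Dist // lipNorm f ≤ r} =>
        inner ℝ V ((memLp_two_section (grossDeriv f)).toLp _)) := by
  let _ := lipBallWeakStar gaussianProduct l2Dist r
  let K : Submodule ℝ (Lp HilbertL2 2 gaussianProduct) :=
    { carrier := {V | Continuous (fun f : {f : Lip gaussianProduct l2Dist // lipNorm f ≤ r} =>
        inner ℝ V ((memLp_two_section (grossDeriv f)).toLp _))}
      zero_mem' := by
        simp only [Set.mem_ofPred_eq, inner_zero_left]; exact continuous_const
      add_mem' := fun {V W} hV hW => by
        simp only [Set.mem_ofPred_eq, inner_add_left]; exact hV.add hW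
      smul_mem' := fun c V hV => by
        simp only [Set.mem_ofPred_eq, real_inner_smul_left]; exact hV.const_mul c }
  have hbd : ∀ f : {f : Lip gaussianProduct l2Dist // lipNorm f ≤ r},
      ‖(memLp_two_section (grossDeriv f)).toLp _‖ ≤ r := by
    intro f
    have := Lp.norm_le_of_ae_bound (p := 2) (f := (memLp_two_section (grossDeriv f)).toLp _) r.2 (by
      filter_upwards [(memLp_two_section (grossDeriv f)).coeFn_toLp, norm_le_of_lipNorm_le f.2]
        with x h1 h2
      rw [h1]; exact h2)
    simpa [measureUnivNNReal] using this
  have hclosed : IsClosed (K : Set (Lp HilbertL2 2 gaussianProduct)) := by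
    refine isClosed_of_closure_subset fun V hV => ?_
    refine continuous_of_uniform_approx_of_continuous fun s hs => ?_
    obtain ⟨ε, hε, hεs⟩ := Metric.mem_uniformity_dist.1 hs
    -- The denominator `r + 1` covers `r = 0`.
    obtain ⟨W, hW, hd⟩ := Metric.mem_closure_iff.1 hV (ε / (r + 1)) (by positivity)
    refine ⟨_, hW, fun f => hεs ?_⟩
    rw [Real.dist_eq, ← inner_sub_left]
    refine (abs_real_inner_le_norm _ _).trans_lt ?_
    rw [dist_eq_norm, lt_div_iff₀ (by positivity)] at hd
    refine lt_of_le_of_lt ?_ hd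
    gcongr
    exact (hbd f).trans (by linarith)
  have htop : K = ⊤ := by
    refine eq_top_of_isCylinder_single_mem hclosed fun n ψ Ψ hψ => ?_
    change Continuous _
    have mw : MemLp (fun x => x n * ψ x - Ψ x n) 2 gaussianProduct :=
      ((hψ.memLp ⊤).mul (memLp_coord n)).sub (memLp_two_apply (hψ.memLp_gradient 2) n)
    have mw1 := mw.mono_exponent (p := 1) (by norm_num)
    have hc : Continuous (fun f : {f : Lip gaussianProduct l2Dist // lipNorm f ≤ r} =>
        ∫ x, ((f : Lip gaussianProduct l2Dist) : Lp ℝ ⊤ gaussianProduct) x * mw1.toLp _ x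
          ∂gaussianProduct) := by
      let _ := weakStar gaussianProduct
      have h1 : Continuous (fun f : {f : Lip gaussianProduct l2Dist // lipNorm f ≤ r} =>
        ((f : Lip gaussianProduct l2Dist) : Lp ℝ ⊤ gaussianProduct)) := continuous_induced_dom
      have h2 : Continuous (fun (f : Lp ℝ ⊤ gaussianProduct) (g : Lp ℝ 1 gaussianProduct) =>
        ∫ x, f x * g x ∂gaussianProduct) := continuous_induced_dom
      exact ((continuous_apply _).comp h2).comp h1
    refine hc.congr fun f => ?_
    rw [L2.inner_def]
    have e1 : ∫ x, ((f : Lip gaussianProduct l2Dist) : Lp ℝ ⊤ gaussianProduct) x * mw1.toLp _ x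
        ∂gaussianProduct = ∫ x, ((f : Lip gaussianProduct l2Dist) : Lp ℝ ⊤ gaussianProduct) x *
          (x n * ψ x - Ψ x n) ∂gaussianProduct := by
      refine integral_congr_ae ?_
      filter_upwards [mw1.coeFn_toLp] with x hx
      rw [hx]
    rw [e1, ← (isGrossSobolevDerivative_grossDeriv f).integral_mul hψ n]
    refine integral_congr_ae ?_
    filter_upwards [(memLp_smul_single (hψ.memLp 2) n).coeFn_toLp,
      (memLp_two_section (grossDeriv f)).coeFn_toLp] with x h1 h2
    rw [h1, h2, lp.inner_single_left]
    simp
  have : V ∈ K := htop ▸ Submodule.mem_top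
  exact this

/-- For a square integrable weight `φ` this is the pairing with the `L²` section `φ G`. Indicators
are such weights, and the uniform bound `‖G‖ r` on the ball extends continuity to `L¹` limits. -/
theorem continuous_integral_sectionInner (r : ℝ≥0) (G : Lp HilbertL2 ⊤ gaussianProduct)
    (ψ : Lp ℝ 1 gaussianProduct) :
    @Continuous _ _ (lipBallWeakStar gaussianProduct l2Dist r) inferInstance
      (fun f : {f : Lip gaussianProduct l2Dist // lipNorm f ≤ r} =>
        ∫ x, sectionInner G (grossDeriv f) x * ψ x ∂gaussianProduct) := by
  let _ := lipBallWeakStar gaussianProduct l2Dist r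
  have hsq : ∀ φ : (ℕ → ℝ) → ℝ, MemLp φ 2 gaussianProduct →
      Continuous (fun f : {f : Lip gaussianProduct l2Dist // lipNorm f ≤ r} =>
        ∫ x, sectionInner G (grossDeriv f) x * φ x ∂gaussianProduct) := by
    intro φ hφ
    have mV : MemLp (fun x => φ x • G x) 2 gaussianProduct := (Lp.memLp G).smul hφ
    refine (continuous_inner_grossDeriv r (mV.toLp _)).congr fun f => ?_
    rw [L2.inner_def]
    refine integral_congr_ae ?_
    filter_upwards [mV.coeFn_toLp, (memLp_two_section (grossDeriv f)).coeFn_toLp,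
      coeFn_sectionInner G (grossDeriv f)] with x h1 h2 h3
    rw [h1, h2, h3, real_inner_smul_left, mul_comm]
  induction ψ using Lp.induction (p := 1) ENNReal.one_ne_top with
  | indicatorConst c hs hμ =>
    rename_i s
    refine (hsq (s.indicator fun _ => c) (memLp_indicator_const 2 hs c (Or.inr hμ.ne))).congr
      fun f => integral_congr_ae ?_
    filter_upwards [indicatorConstLp_coeFn (p := 1) (hs := hs) (hμs := hμ.ne) (c := c)] with x hx
    have : (Lp.simpleFunc.indicatorConst 1 hs hμ.ne c : Lp ℝ 1 gaussianProduct) x =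
        s.indicator (fun _ => c) x := by
      rw [Lp.simpleFunc.coe_indicatorConst]; exact hx
    rw [this]
  | add hf hg hd h1 h2 =>
    rename_i φ χ
    refine (h1.add h2).congr fun f => ?_
    rw [Pi.add_apply, ← integral_add (integrable_pairing _ _) (integrable_pairing _ _)]
    refine integral_congr_ae ?_
    filter_upwards [Lp.coeFn_add (hf.toLp φ) (hg.toLp χ)] with x hx
    rw [hx, Pi.add_apply]
    ring
  | isClosed =>
    refine isClosed_of_closure_subset fun φ hφ => ?_
    refine continuous_of_uniform_approx_of_continuous fun s hs => ?_
    obtain ⟨ε, hε, hεs⟩ := Metric.mem_uniformity_dist.1 hs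
    obtain ⟨χ, hχ, hd⟩ := Metric.mem_closure_iff.1 hφ (ε / (‖G‖ * r + 1)) (by positivity)
    refine ⟨_, hχ, fun f => hεs ?_⟩
    rw [Real.dist_eq, ← integral_sub (integrable_pairing _ _) (integrable_pairing _ _)]
    rw [dist_eq_norm, lt_div_iff₀ (by positivity)] at hd
    refine lt_of_le_of_lt ?_ hd
    have hb : ∀ᵐ x ∂gaussianProduct, ‖sectionInner G (grossDeriv f) x * φ x -
        sectionInner G (grossDeriv f) x * χ x‖ ≤ ‖(φ - χ : Lp ℝ 1 gaussianProduct) x‖ *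
          (‖G‖ * r + 1) := by
      filter_upwards [coeFn_sectionInner G (grossDeriv f), lp_ae_norm_le G,
        norm_le_of_lipNorm_le f.2, Lp.coeFn_sub φ χ] with x h1 h2 h3 h4
      rw [← mul_sub, norm_mul, h4, Pi.sub_apply, mul_comm]
      gcongr
      rw [h1]
      refine (norm_inner_le_norm _ _).trans ?_
      have : ‖G x‖ * ‖grossDeriv f x‖ ≤ ‖G‖ * r := by gcongr
      linarith
    refine (norm_integral_le_of_norm_le ((L1.integrable_coeFn (φ - χ)).norm.mul_const _) hb).trans_eq
      ?_
    rw [integral_mul_const, ← L1.norm_eq_integral_norm]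

/-- The derivation `f ↦ ⟨G, Df⟩`. -/
noncomputable def sectionField (G : Lp HilbertL2 ⊤ gaussianProduct) :
    VectorField gaussianProduct l2Dist :=
  ⟨{ toFun := fun f => sectionInner G (grossDeriv f)
     map_add' := fun f g => by rw [map_add, sectionInner_add_right]
     map_smul' := fun c f => by rw [map_smul, sectionInner_smul_right, RingHom.id_apply] }, by
    refine ⟨fun f g => ?_, ?_, isWeakStarContinuous_iff.2 fun r ψ =>
      continuous_integral_sectionInner r G ψ⟩
    · change sectionInner G (grossDeriv (lipMul f g)) = _ • sectionInner G (grossDeriv g) +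
        _ • sectionInner G (grossDeriv f)
      rw [grossDeriv_lipMul, sectionInner_add_right, sectionInner_lpSMul_right,
        sectionInner_lpSMul_right]
    · refine lt_of_le_of_lt (iSup₂_le fun f hf => ?_) (enorm_lt_top (x := G))
      refine (enorm_sectionInner_le _ _).trans ?_
      calc ‖G‖ₑ * ‖grossDeriv f‖ₑ ≤ ‖G‖ₑ * 1 := by
            gcongr
            exact (enorm_grossDeriv_le f).trans ((le_max_left _ _).trans hf)
        _ = ‖G‖ₑ := mul_one _⟩

theorem sectionField_apply (G : Lp HilbertL2 ⊤ gaussianProduct) (f : Lip gaussianProduct l2Dist) :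
    (sectionField G).1 f = sectionInner G (grossDeriv f) := rfl

theorem opNorm_sectionField_le (G : Lp HilbertL2 ⊤ gaussianProduct) :
    opNorm (sectionField G).1 ≤ ‖G‖ₑ := by
  refine iSup₂_le fun f hf => (enorm_sectionInner_le _ _).trans ?_
  calc ‖G‖ₑ * ‖grossDeriv f‖ₑ ≤ ‖G‖ₑ * 1 := by
        gcongr
        exact (enorm_grossDeriv_le f).trans ((le_max_left _ _).trans hf)
    _ = ‖G‖ₑ := mul_one _

/-! ### Square-summable sequences in `L^∞` as bounded sections -/

theorem hasSum_sq_apply (v : HilbertL2) : HasSum (fun n => v n ^ 2) (‖v‖ ^ 2) := by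
  simpa using lp.hasSum_norm (p := 2) (by norm_num) v

theorem enorm_hilbertL2 (v : HilbertL2) : ‖v‖ₑ = (∑' n, ‖v n‖ₑ ^ 2) ^ (1 / 2 : ℝ) := by
  have hs : HasSum (fun n => ‖v n‖ ^ 2) (‖v‖ ^ 2) := by simpa using hasSum_sq_apply v
  have h : ‖v‖ₑ ^ 2 = ∑' n, ‖v n‖ₑ ^ 2 := by
    simp only [← ofReal_norm, ← ENNReal.ofReal_pow (norm_nonneg _)]
    rw [← hs.tsum_eq, ENNReal.ofReal_tsum_of_nonneg (fun n => by positivity) hs.summable]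
  rw [← h, ← ENNReal.rpow_natCast, ← ENNReal.rpow_mul]
  norm_num

theorem norm_le_of_sum_range_le {v : HilbertL2} {C : ℝ} (hC : 0 ≤ C)
    (h : ∀ N, ∑ n ∈ Finset.range N, v n ^ 2 ≤ C ^ 2) : ‖v‖ ≤ C := by
  refine (sq_le_sq₀ (norm_nonneg _) hC).1 ?_
  exact le_of_tendsto' (hasSum_sq_apply v).tendsto_sum_nat h

section Sections

variable {α : Type*} [MeasurableSpace α] {μ : Measure α}

theorem exists_ae_sum_range_le (g : WeakL2 μ) :
    ∃ C : ℝ, 0 ≤ C ∧ ∀ᵐ x ∂μ, ∀ N, ∑ n ∈ Finset.range N, (g : ℕ → Lp ℝ ⊤ μ) n x ^ 2 ≤ C ^ 2 := by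
  obtain ⟨g, C, hC⟩ := g
  refine ⟨√(max C 0), Real.sqrt_nonneg _, ?_⟩
  filter_upwards [ae_all_iff.2 hC] with x hx N
  rw [Real.sq_sqrt (le_max_right _ _)]
  exact (hx N).trans (le_max_left _ _)

theorem exists_hilbertL2_of_sum_range_le {a : ℕ → ℝ} {C : ℝ}
    (h : ∀ N, ∑ n ∈ Finset.range N, a n ^ 2 ≤ C) : ∃ v : HilbertL2, ∀ n, v n = a n := by
  refine ⟨⟨a, ?_⟩, fun n => rfl⟩
  refine (memℓp_gen_iff (by norm_num)).2 ?_
  have := summable_of_sum_range_le (fun n => sq_nonneg (a n)) h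
  simpa using this

/-- Almost everywhere the coordinates form a vector of `l²`; measurability follows because it is the
limit of its finite partial sums. -/
theorem exists_section (g : WeakL2 μ) :
    ∃ G : Lp HilbertL2 ⊤ μ, ∀ᵐ x ∂μ, ∀ n, G x n = (g : ℕ → Lp ℝ ⊤ μ) n x := by
  classical
  obtain ⟨C, hC0, hC⟩ := exists_ae_sum_range_le g
  -- The value `0` is taken only on the null set where the squares are not summable.
  set F : α → HilbertL2 := fun x =>
    if h : ∃ v : HilbertL2, ∀ n, v n = (g : ℕ → Lp ℝ ⊤ μ) n x then h.choose else 0 with hF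
  have hFx : ∀ᵐ x ∂μ, ∀ n, F x n = (g : ℕ → Lp ℝ ⊤ μ) n x := by
    filter_upwards [hC] with x hx
    have h := exists_hilbertL2_of_sum_range_le hx
    rw [hF]
    simp only [dif_pos h]
    exact h.choose_spec
  have hm : AEStronglyMeasurable F μ := by
    refine aestronglyMeasurable_of_tendsto_ae atTop
      (f := fun N x => ∑ n ∈ Finset.range N, lp.single 2 n ((g : ℕ → Lp ℝ ⊤ μ) n x)) (fun N => ?_) ?_
    · refine Finset.aestronglyMeasurable_fun_sum _ fun n _ => ?_
      exact (lp.singleContinuousLinearMap ℝ (fun _ : ℕ => ℝ) 2 n).continuous.comp_aestronglyMeasurable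
        (Lp.aestronglyMeasurable _)
    · filter_upwards [hFx] with x hx
      have := (lp.hasSum_single (p := 2) (by norm_num) (F x)).tendsto_sum_nat
      simpa only [hx] using this
  have hb : ∀ᵐ x ∂μ, ‖F x‖ ≤ C := by
    filter_upwards [hFx, hC] with x h1 h2
    refine norm_le_of_sum_range_le hC0 fun N => ?_
    simpa only [h1] using h2 N
  have mF := memLp_top_of_bound hm C hb
  refine ⟨mF.toLp F, ?_⟩
  filter_upwards [mF.coeFn_toLp, hFx] with x h1 h2
  rwa [h1]

theorem section_ext {G H : Lp HilbertL2 ⊤ μ} (h : ∀ n, ∀ᵐ x ∂μ, G x n = H x n) : G = H := by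
  refine Lp.ext ?_
  filter_upwards [ae_all_iff.2 h] with x hx
  exact lp.ext (funext hx)

/-- The section `x ↦ (g_n(x))` given by a sequence in `l²(L^∞)`. -/
noncomputable def sectionMap (μ : Measure α) : WeakL2 μ →ₗ[ℝ] Lp HilbertL2 ⊤ μ where
  toFun g := (exists_section g).choose
  map_add' g h := by
    refine section_ext fun n => ?_
    filter_upwards [(exists_section (g + h)).choose_spec, (exists_section g).choose_spec,
      (exists_section h).choose_spec, Lp.coeFn_add (exists_section g).choose (exists_section h).choose,
      Lp.coeFn_add ((g : ℕ → Lp ℝ ⊤ μ) n) ((h : ℕ → Lp ℝ ⊤ μ) n)] with x h1 h2 h3 h4 h5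
    rw [h1, h4, Pi.add_apply, lp.coeFn_add, Pi.add_apply, h2, h3]
    exact h5
  map_smul' c g := by
    refine section_ext fun n => ?_
    filter_upwards [(exists_section (c • g)).choose_spec, (exists_section g).choose_spec,
      Lp.coeFn_smul c (exists_section g).choose,
      Lp.coeFn_smul c ((g : ℕ → Lp ℝ ⊤ μ) n)] with x h1 h2 h4 h5
    rw [h1, RingHom.id_apply, h4, Pi.smul_apply, lp.coeFn_smul, Pi.smul_apply, h2]
    exact h5

theorem sectionMap_apply (g : WeakL2 μ) :
    ∀ᵐ x ∂μ, ∀ n, sectionMap μ g x n = (g : ℕ → Lp ℝ ⊤ μ) n x :=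
  (exists_section g).choose_spec

theorem enorm_sectionMap (g : WeakL2 μ) : ‖sectionMap μ g‖ₑ = weakL2Norm g := by
  rw [Lp.enorm_def, eLpNorm_exponent_top, eLpNormEssSup, weakL2Norm]
  refine essSup_congr_ae ?_
  filter_upwards [sectionMap_apply g] with x hx
  rw [enorm_hilbertL2]
  simp only [hx]

theorem sectionMap_weakL2SMul (a : Lp ℝ ⊤ μ) (g : WeakL2 μ) :
    sectionMap μ (weakL2SMul a g) = a • sectionMap μ g := by
  refine section_ext fun n => ?_
  filter_upwards [sectionMap_apply g, sectionMap_apply (weakL2SMul a g),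
    Lp.coeFn_lpSMul (r := ⊤) a (sectionMap μ g),
    Lp.coeFn_lpSMul (r := ⊤) a ((g : ℕ → Lp ℝ ⊤ μ) n)] with x h1 h2 h3 h4
  rw [h2, h3, Pi.smul_apply', lp.coeFn_smul, Pi.smul_apply, h1]
  exact h4

theorem memLp_top_apply (G : Lp HilbertL2 ⊤ μ) (n : ℕ) : MemLp (fun x => G x n) ⊤ μ :=
  (Lp.memLp G).of_le ((lp.evalCLM ℝ (fun _ : ℕ => ℝ) 2 n).continuous.comp_aestronglyMeasurable
    (Lp.aestronglyMeasurable G)) (Eventually.of_forall fun x => lp.norm_apply_le_norm (by norm_num) _ n)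

theorem sum_range_sq_le (v : HilbertL2) (N : ℕ) : ∑ n ∈ Finset.range N, v n ^ 2 ≤ ‖v‖ ^ 2 := by
  exact sum_le_hasSum _ (fun n _ => sq_nonneg _) (hasSum_sq_apply v)

theorem sectionMap_bijective : Function.Bijective (sectionMap μ) := by
  constructor
  · rw [injective_iff_map_eq_zero]
    intro g hg
    refine Subtype.ext (funext fun n => Lp.ext ?_)
    filter_upwards [sectionMap_apply g, Lp.coeFn_zero HilbertL2 ⊤ μ, Lp.coeFn_zero ℝ ⊤ μ]
      with x h1 h2 h3
    rw [← h1 n, hg, h2]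
    exact h3.symm
  · intro G
    have hg : (fun n => (memLp_top_apply G n).toLp _) ∈ WeakL2 μ := by
      refine ⟨‖G‖ ^ 2, fun N => ?_⟩
      filter_upwards [ae_all_iff.2 fun n => (memLp_top_apply G n).coeFn_toLp, lp_ae_norm_le G]
        with x h1 h2
      simp only [h1]
      exact (sum_range_sq_le _ _).trans (by gcongr)
    refine ⟨⟨_, hg⟩, section_ext fun n => ?_⟩
    · filter_upwards [sectionMap_apply (μ := μ) ⟨_, hg⟩, (memLp_top_apply G n).coeFn_toLp] with x h1 h2
      rw [h1]
      exact h2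

/-- `l²(L^∞)` is the module of bounded measurable sections of the trivial Hilbert bundle. -/
noncomputable def sectionEquiv (μ : Measure α) : WeakL2 μ ≃ₗ[ℝ] Lp HilbertL2 ⊤ μ :=
  LinearEquiv.ofBijective (sectionMap μ) sectionMap_bijective

end Sections

/-! ### Functions annihilated by a vector field -/

namespace IsBddLip

variable {u v : (ℕ → ℝ) → ℝ} {M N C D : ℝ≥0}

theorem of_abs_sub_le (hu : IsBddLip u M C) (hv : IsBddLip v N D) {w : (ℕ → ℝ) → ℝ}
    {B K K' : ℝ≥0} (hw : Measurable w) (hb : ∀ x, |w x| ≤ B)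
    (h : ∀ x y, |w x - w y| ≤ K * |u x - u y| + K' * |v x - v y|) :
    IsBddLip w B (K * C + K' * D) := by
  refine ⟨hw, hb, fun x y => ?_⟩
  have h1 : edist (w x) (w y) ≤ K * edist (u x) (u y) + K' * edist (v x) (v y) := by
    simp only [edist_dist, Real.dist_eq]
    rw [← ENNReal.ofReal_coe_nnreal (p := K), ← ENNReal.ofReal_coe_nnreal (p := K'),
      ← ENNReal.ofReal_mul K.coe_nonneg, ← ENNReal.ofReal_mul K'.coe_nonneg,
      ← ENNReal.ofReal_add (by positivity) (by positivity)]
    exact ENNReal.ofReal_le_ofReal (h x y)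
  refine h1.trans ?_
  rw [ENNReal.coe_add, ENNReal.coe_mul, ENNReal.coe_mul, add_mul, mul_assoc, mul_assoc]
  gcongr
  · exact hu.lip x y
  · exact hv.lip x y

theorem of_abs_sub_le_left (hu : IsBddLip u M C) {w : (ℕ → ℝ) → ℝ} {B K : ℝ≥0}
    (hw : Measurable w) (hb : ∀ x, |w x| ≤ B) (h : ∀ x y, |w x - w y| ≤ K * |u x - u y|) :
    IsBddLip w B (K * C) := by
  have := hu.of_abs_sub_le hu (K := K) (K' := 0) hw hb (fun x y => by simpa using h x y)
  simpa using this

theorem const (c : ℝ) : IsBddLip (fun _ => c) ‖c‖₊ 0 :=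
  ⟨measurable_const, fun _ => le_rfl, fun x y => by simp⟩

theorem add (hu : IsBddLip u M C) (hv : IsBddLip v N D) :
    IsBddLip (fun x => u x + v x) (M + N) (1 * C + 1 * D) := by
  refine hu.of_abs_sub_le hv (hu.measurable.add hv.measurable) (fun x => ?_) fun x y => ?_
  · exact (abs_add_le _ _).trans (by push_cast; exact add_le_add (hu.bound x) (hv.bound x))
  · rw [NNReal.coe_one, one_mul, one_mul, add_sub_add_comm]
    exact abs_add_le _ _

theorem mul (hu : IsBddLip u M C) (hv : IsBddLip v N D) :
    IsBddLip (fun x => u x * v x) (M * N) (N * C + M * D) := by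
  refine hu.of_abs_sub_le hv (hu.measurable.mul hv.measurable) (fun x => ?_) fun x y => ?_
  · rw [abs_mul, NNReal.coe_mul]
    exact mul_le_mul (hu.bound x) (hv.bound x) (abs_nonneg _) M.2
  · have e : u x * v x - u y * v y = v x * (u x - u y) + u y * (v x - v y) := by ring
    rw [e]
    refine (abs_add_le _ _).trans ?_
    rw [abs_mul, abs_mul]
    gcongr
    · exact hv.bound x
    · exact hu.bound y

/-- Each coordinate difference is at most the `l²` distance. The constant is crude, but it depends
only on `C'` and `n`, so it is uniform along sequences with the same bounds. -/
theorem of_abs_sub_le_coord {C' : ℝ≥0} {n : ℕ} (hw : Measurable u) (hb : ∀ x, |u x| ≤ M)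
    (h : ∀ x y, |u x - u y| ≤ C' * ∑ i ∈ Finset.range n, |x i - y i|) : IsBddLip u M (C' * n) := by
  refine ⟨hw, hb, fun x y => ?_⟩
  have h1 : edist (u x) (u y) ≤ C' * ∑ i ∈ Finset.range n, edist (x i) (y i) := by
    simp only [edist_dist, Real.dist_eq]
    rw [← ENNReal.ofReal_coe_nnreal (p := C'), ← ENNReal.ofReal_sum_of_nonneg (fun _ _ => abs_nonneg _),
      ← ENNReal.ofReal_mul C'.coe_nonneg]
    exact ENNReal.ofReal_le_ofReal (h x y)
  refine h1.trans ?_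
  rw [ENNReal.coe_mul, mul_assoc]
  gcongr
  refine (Finset.sum_le_sum fun i _ => edist_le_l2Dist x y i).trans ?_
  simp

theorem eq_toLip (hu : IsBddLip u M C) {f : Lip gaussianProduct l2Dist}
    (hf : (f : Lp ℝ ⊤ gaussianProduct) =ᵐ[gaussianProduct] u) : f = hu.toLip :=
  Subtype.ext (Lp.ext (hf.trans hu.coeFn_toLip.symm))

end IsBddLip

/-- The vector field `δ` annihilates the bounded Lipschitz function `u`. -/
def Kills (δ : VectorField gaussianProduct l2Dist) (u : (ℕ → ℝ) → ℝ) : Prop :=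
  ∃ (M C : ℝ≥0) (h : IsBddLip u M C), δ.1 h.toLip = 0

theorem coeFn_lipMul {f g : Lip gaussianProduct l2Dist} {u v : (ℕ → ℝ) → ℝ}
    (hf : (f : Lp ℝ ⊤ gaussianProduct) =ᵐ[gaussianProduct] u)
    (hg : (g : Lp ℝ ⊤ gaussianProduct) =ᵐ[gaussianProduct] v) :
    (lipMul f g : Lp ℝ ⊤ gaussianProduct) =ᵐ[gaussianProduct] fun x => u x * v x := by
  filter_upwards [hf, hg, Lp.coeFn_lpSMul (r := ⊤) (f : Lp ℝ ⊤ gaussianProduct)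
    (g : Lp ℝ ⊤ gaussianProduct)] with x h1 h2 h3
  rw [← h1, ← h2]
  exact h3

theorem vectorField_lipMul_ae (δ : VectorField gaussianProduct l2Dist)
    {f g : Lip gaussianProduct l2Dist} {u v : (ℕ → ℝ) → ℝ}
    (hf : (f : Lp ℝ ⊤ gaussianProduct) =ᵐ[gaussianProduct] u)
    (hg : (g : Lp ℝ ⊤ gaussianProduct) =ᵐ[gaussianProduct] v) :
    ∀ᵐ x ∂gaussianProduct, δ.1 (lipMul f g) x = u x * δ.1 g x + v x * δ.1 f x := by
  rw [δ.2.1]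
  filter_upwards [hf, hg, Lp.coeFn_add ((f : Lp ℝ ⊤ gaussianProduct) • δ.1 g : Lp ℝ ⊤ gaussianProduct)
    ((g : Lp ℝ ⊤ gaussianProduct) • δ.1 f),
    Lp.coeFn_lpSMul (r := ⊤) (f : Lp ℝ ⊤ gaussianProduct) (δ.1 g),
    Lp.coeFn_lpSMul (r := ⊤) (g : Lp ℝ ⊤ gaussianProduct) (δ.1 f)] with x h1 h2 h3 h4 h5
  rw [h3, Pi.add_apply, h4, h5, Pi.smul_apply', Pi.smul_apply', h1, h2, smul_eq_mul, smul_eq_mul]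

theorem lp_eq_zero_iff {α : Type*} [MeasurableSpace α] {μ : Measure α} {f : Lp ℝ ⊤ μ} :
    f = 0 ↔ ∀ᵐ x ∂μ, f x = 0 := Lp.eq_zero_iff_ae_eq_zero

namespace Kills

variable {δ : VectorField gaussianProduct l2Dist} {u v : (ℕ → ℝ) → ℝ} {M N C D : ℝ≥0}

/-- The constants chosen in `Kills` are immaterial, because the element of the Lipschitz algebra
depends only on the class of `u`. -/
theorem apply_eq_zero (h : Kills δ u) {f : Lip gaussianProduct l2Dist}
    (hf : (f : Lp ℝ ⊤ gaussianProduct) =ᵐ[gaussianProduct] u) : δ.1 f = 0 := by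
  obtain ⟨M, C, hu, h0⟩ := h
  rwa [hu.eq_toLip hf]

theorem of_apply (hu : IsBddLip u M C) {f : Lip gaussianProduct l2Dist}
    (hf : (f : Lp ℝ ⊤ gaussianProduct) =ᵐ[gaussianProduct] u) (h : δ.1 f = 0) : Kills δ u :=
  ⟨M, C, hu, by rwa [← hu.eq_toLip hf]⟩

theorem add (hu : Kills δ u) (hv : Kills δ v) : Kills δ (fun x => u x + v x) := by
  obtain ⟨M, C, hu, h0⟩ := hu
  obtain ⟨N, D, hv, k0⟩ := hv
  refine of_apply (hu.add hv) (f := hu.toLip + hv.toLip) ?_ (by rw [map_add, h0, k0, add_zero])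
  filter_upwards [Lp.coeFn_add (hu.toLip : Lp ℝ ⊤ gaussianProduct) hv.toLip, hu.coeFn_toLip,
    hv.coeFn_toLip] with x h1 h2 h3
  rw [← h2, ← h3]
  exact h1

theorem mul (hu : Kills δ u) (hv : Kills δ v) : Kills δ (fun x => u x * v x) := by
  obtain ⟨M, C, hu, h0⟩ := hu
  obtain ⟨N, D, hv, k0⟩ := hv
  refine of_apply (hu.mul hv) (coeFn_lipMul hu.coeFn_toLip hv.coeFn_toLip) ?_
  rw [δ.2.1, h0, k0, Lp.smul_zero, Lp.smul_zero, add_zero]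

/-- From `1 = 1 * 1` the Leibniz rule gives `δ(1) = 2 δ(1)`. -/
theorem one (δ : VectorField gaussianProduct l2Dist) : Kills δ (fun _ => 1) := by
  refine ⟨_, _, IsBddLip.const 1, ?_⟩
  set f := (IsBddLip.const 1).toLip with hf
  have h1 := vectorField_lipMul_ae δ (IsBddLip.const 1).coeFn_toLip (IsBddLip.const 1).coeFn_toLip
  have h2 : lipMul f f = f := (IsBddLip.const 1).eq_toLip <| by
    rw [hf]
    simpa using coeFn_lipMul (IsBddLip.const 1).coeFn_toLip (IsBddLip.const 1).coeFn_toLip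
  rw [← hf, h2] at h1
  rw [lp_eq_zero_iff]
  filter_upwards [h1] with x hx
  linarith

theorem const_mul (hu : Kills δ u) (c : ℝ) : Kills δ (fun x => c * u x) := by
  obtain ⟨M, C, hu, h0⟩ := hu
  refine of_apply ((IsBddLip.const c).mul hu) (f := c • hu.toLip) ?_
    (by rw [map_smul, h0, smul_zero])
  filter_upwards [Lp.coeFn_smul c (hu.toLip : Lp ℝ ⊤ gaussianProduct), hu.coeFn_toLip] with x h1 h2
  rw [← h2]
  exact h1

theorem const (δ : VectorField gaussianProduct l2Dist) (c : ℝ) : Kills δ (fun _ => c) := by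
  simpa using (one δ).const_mul c

theorem sub (hu : Kills δ u) (hv : Kills δ v) : Kills δ (fun x => u x - v x) := by
  simpa [sub_eq_add_neg] using hu.add (hv.const_mul (-1))

theorem sum {ι : Type*} (s : Finset ι) {w : ι → (ℕ → ℝ) → ℝ} (h : ∀ i ∈ s, Kills δ (w i)) :
    Kills δ (fun x => ∑ i ∈ s, w i x) := by
  classical
  induction s using Finset.induction_on with
  | empty => simpa using const δ 0
  | insert i s hi ih =>
    simp only [Finset.sum_insert hi]
    exact (h i (Finset.mem_insert_self _ _)).add
      (ih fun j hj => h j (Finset.mem_insert_of_mem hj))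

/-- Weak* continuity enters here. The constants `M` and `C` must not depend on `k`, so that the
whole sequence lies in one ball. -/
theorem of_tendsto_lip {w : ℕ → (ℕ → ℝ) → ℝ} (hb : ∀ k, IsBddLip (w k) M C) (hw : ∀ k, Kills δ (w k))
    {f : Lip gaussianProduct l2Dist} (hf : lipNorm f ≤ (max C M : ℝ≥0))
    (hlim : ∀ᵐ x ∂gaussianProduct, Tendsto (fun k => w k x) atTop
      (𝓝 ((f : Lp ℝ ⊤ gaussianProduct) x))) : δ.1 f = 0 := by
  refine eq_zero_of_forall_integral_mul_eq_zero fun ψ => ?_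
  have h := δ.2.2.2.tendsto_integral (f := fun k => (hb k).toLip)
    (fun k => (hb k).lipNorm_toLip_le) hf (by
      filter_upwards [hlim, ae_all_iff.2 fun k => (hb k).coeFn_toLip] with x h1 h2
      simpa only [h2] using h1) ψ
  refine tendsto_nhds_unique h ?_
  refine tendsto_const_nhds.congr fun k => ?_
  rw [(hw k).apply_eq_zero (hb k).coeFn_toLip]
  symm
  refine integral_eq_zero_of_ae ?_
  filter_upwards [Lp.coeFn_zero ℝ ⊤ gaussianProduct] with x hx
  rw [hx]
  simp

theorem of_tendsto {w : ℕ → (ℕ → ℝ) → ℝ} (hb : ∀ k, IsBddLip (w k) M C) (hw : ∀ k, Kills δ (w k))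
    (hlim : ∀ x, Tendsto (fun k => w k x) atTop (𝓝 (u x))) : Kills δ u := by
  have hu : IsBddLip u M C :=
    ⟨measurable_of_tendsto_metrizable (fun k => (hb k).measurable) (tendsto_pi_nhds.2 hlim),
      fun x => le_of_tendsto' (hlim x).abs fun k => (hb k).bound x,
      fun x y => le_of_tendsto' ((hlim x).edist (hlim y)) fun k => (hb k).lip x y⟩
  refine ⟨M, C, hu, of_tendsto_lip hb hw hu.lipNorm_toLip_le ?_⟩
  filter_upwards [hu.coeFn_toLip] with x hx
  rw [hx]
  exact hlim x

/-- Since `δ(u²) = 2 u δ(u)`, one may divide by the nowhere vanishing `u`. -/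
theorem of_sq (hu : IsBddLip u M C) (h0 : ∀ x, u x ≠ 0) (h : Kills δ (fun x => u x * u x)) :
    Kills δ u := by
  refine ⟨M, C, hu, lp_eq_zero_iff.2 ?_⟩
  have h1 := h.apply_eq_zero (coeFn_lipMul hu.coeFn_toLip hu.coeFn_toLip)
  rw [lp_eq_zero_iff] at h1
  filter_upwards [h1, vectorField_lipMul_ae δ hu.coeFn_toLip hu.coeFn_toLip] with x h2 h3
  rw [h2] at h3
  have : u x * δ.1 hu.toLip x = 0 := by linarith
  exact (mul_eq_zero.1 this).resolve_left (h0 x)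

/-- The functions `√(u² + 1/(k+1)²)` never vanish, have annihilated squares, and inherit the
Lipschitz constant of `u`; they converge to `|u|`. -/
theorem abs (hu : Kills δ u) : Kills δ (fun x => |u x|) := by
  obtain ⟨M, C, hb, -⟩ := id hu
  set w : ℕ → (ℕ → ℝ) → ℝ := fun k x => √(u x * u x + (1 / (k + 1 : ℝ)) ^ 2) with hw
  have hpos : ∀ (k : ℕ) x, 0 < u x * u x + (1 / (k + 1 : ℝ)) ^ 2 := fun k x =>
    add_pos_of_nonneg_of_pos (mul_self_nonneg _) (pow_pos Nat.one_div_pos_of_nat 2)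
  have hsq : ∀ k x, w k x * w k x = u x * u x + (1 / (k + 1 : ℝ)) ^ 2 := fun k x =>
    Real.mul_self_sqrt (hpos k x).le
  have hwpos : ∀ k x, 0 < w k x := fun k x => Real.sqrt_pos.2 (hpos k x)
  have habs : ∀ k x, |u x| ≤ w k x := fun k x => by
    rw [hw]
    refine Real.le_sqrt_of_sq_le ?_
    rw [sq_abs, sq]
    exact le_add_of_nonneg_right (by positivity)
  have hbw : ∀ k, IsBddLip (w k) (M + 1) (1 * C) := fun k => by
    refine hb.of_abs_sub_le_left
      (((hb.measurable.mul hb.measurable).add_const _).sqrt) (fun x => ?_) fun x y => ?_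
    · rw [abs_of_pos (hwpos k x), hw]
      refine Real.sqrt_le_iff.2 ⟨by positivity, ?_⟩
      have h1 : (1 / (k + 1 : ℝ)) ≤ 1 := by
        rw [div_le_one (by positivity)]
        linarith [(Nat.cast_nonneg k : (0 : ℝ) ≤ k)]
      have h2 := abs_le.1 (hb.bound x)
      have h3 : (0 : ℝ) ≤ M := M.2
      have h4 : (0 : ℝ) ≤ 1 / (k + 1 : ℝ) := by positivity
      push_cast
      nlinarith
    · rw [NNReal.coe_one, one_mul]
      have h1 : 0 < w k x + w k y := add_pos (hwpos k x) (hwpos k y)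
      refine le_of_mul_le_mul_right ?_ h1
      rw [← abs_of_pos h1, ← abs_mul]
      have : (w k x - w k y) * (w k x + w k y) = (u x - u y) * (u x + u y) := by
        linear_combination hsq k x - hsq k y
      rw [this, abs_mul, abs_of_pos h1]
      gcongr
      exact (abs_add_le _ _).trans (add_le_add (habs k x) (habs k y))
  refine of_tendsto hbw (fun k => of_sq (hbw k) (fun x => (hwpos k x).ne') ?_) fun x => ?_
  · simp only [hsq]
    exact (hu.mul hu).add (const δ _)
  · have h1 : Tendsto (fun k : ℕ => (1 / (k + 1 : ℝ))) atTop (𝓝 0) :=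
      tendsto_one_div_add_atTop_nhds_zero_nat
    have h2 := ((h1.pow 2).const_add (u x * u x)).sqrt
    simpa [hw, Real.sqrt_mul_self_eq_abs] using h2

theorem max (hu : Kills δ u) (hv : Kills δ v) : Kills δ (fun x => max (u x) (v x)) := by
  have := ((hu.add hv).add (hu.sub hv).abs).const_mul (2⁻¹)
  refine cast (congrArg _ (funext fun x => ?_)) this
  rcases le_total (u x) (v x) with h | h
  · rw [max_eq_right h, abs_of_nonpos (by linarith)]; ring
  · rw [max_eq_left h, abs_of_nonneg (by linarith)]; ring

theorem min (hu : Kills δ u) (hv : Kills δ v) : Kills δ (fun x => min (u x) (v x)) := by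
  have := ((hu.add hv).sub (hu.sub hv).abs).const_mul (2⁻¹)
  refine cast (congrArg _ (funext fun x => ?_)) this
  rcases le_total (u x) (v x) with h | h
  · rw [min_eq_left h, abs_of_nonpos (by linarith)]; ring
  · rw [min_eq_right h, abs_of_nonneg (by linarith)]; ring

/-- Half-angle argument: a field that annihilates `sin 2t = 2 s c` and `cos 2t = c² - s²`
annihilates `s = sin t` and `c = cos t`. -/
theorem half_angle {s c : (ℕ → ℝ) → ℝ} (hs : IsBddLip s M C) (hc : IsBddLip c N D)
    (h1 : ∀ x, s x * s x + c x * c x = 1) (hsc : Kills δ (fun x => s x * c x))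
    (hcs : Kills δ (fun x => c x * c x - s x * s x)) : Kills δ s ∧ Kills δ c := by
  have e1 := lp_eq_zero_iff.1 (hsc.apply_eq_zero (coeFn_lipMul hs.coeFn_toLip hc.coeFn_toLip))
  have e2 : δ.1 (lipMul hc.toLip hc.toLip - lipMul hs.toLip hs.toLip) = 0 := by
    refine hcs.apply_eq_zero ?_
    filter_upwards [coeFn_lipMul hs.coeFn_toLip hs.coeFn_toLip,
      coeFn_lipMul hc.coeFn_toLip hc.coeFn_toLip,
      Lp.coeFn_sub (lipMul hc.toLip hc.toLip : Lp ℝ ⊤ gaussianProduct)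
        (lipMul hs.toLip hs.toLip)] with x h2 h3 h4
    rw [← h2, ← h3]
    exact h4
  rw [map_sub, sub_eq_zero] at e2
  have key : ∀ᵐ x ∂gaussianProduct, δ.1 hs.toLip x = 0 ∧ δ.1 hc.toLip x = 0 := by
    have h4 := vectorField_lipMul_ae δ hc.coeFn_toLip hc.coeFn_toLip
    rw [e2] at h4
    filter_upwards [e1, vectorField_lipMul_ae δ hs.coeFn_toLip hc.coeFn_toLip,
      vectorField_lipMul_ae δ hs.coeFn_toLip hs.coeFn_toLip, h4] with x k1 k2 k3 k4
    rw [k1] at k2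
    rw [k3] at k4
    constructor
    -- The relations `s δc + c δs = 0` and `c δc = s δs` are linear in `δs`, `δc`, with determinant
    -- `±(s² + c²) = ±1`.
    · linear_combination (-(c x)) * k2 + (1 / 2 * s x) * k4 - δ.1 hs.toLip x * (h1 x)
    · linear_combination (-(s x)) * k2 + (-(1 / 2) * c x) * k4 - δ.1 hc.toLip x * (h1 x)
  exact ⟨⟨_, _, hs, lp_eq_zero_iff.2 (key.mono fun x hx => hx.1)⟩,
    ⟨_, _, hc, lp_eq_zero_iff.2 (key.mono fun x hx => hx.2)⟩⟩

end Kills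

/-! ### From sines and cosines of coordinates to Lipschitz cylinder functions -/

theorem measurable_coord (i : ℕ) : Measurable fun x : ℕ → ℝ => x i := measurable_pi_apply i

theorem isBddLip_of_coord {F : ℝ → ℝ} {B K : ℝ≥0} (i : ℕ) (hm : Measurable F) (hb : ∀ t, |F t| ≤ B)
    (h : ∀ s t, |F s - F t| ≤ K * |s - t|) : IsBddLip (fun x => F (x i)) B K := by
  refine ⟨hm.comp (measurable_coord i), fun x => hb _, fun x y => ?_⟩
  refine le_trans ?_ (mul_le_mul_right (edist_le_l2Dist x y i) _)
  simp only [edist_dist, Real.dist_eq]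
  rw [← ENNReal.ofReal_coe_nnreal (p := K), ← ENNReal.ofReal_mul K.coe_nonneg]
  exact ENNReal.ofReal_le_ofReal (h _ _)

theorem abs_sin_sub_sin_le (s t : ℝ) : |Real.sin s - Real.sin t| ≤ |s - t| := by
  rw [Real.sin_sub_sin, abs_mul, abs_mul, abs_two]
  have h1 := Real.abs_sin_le_abs (x := (s - t) / 2)
  have h2 := Real.abs_cos_le_one ((s + t) / 2)
  rw [abs_div, abs_two] at h1
  nlinarith [abs_nonneg (Real.sin ((s - t) / 2)), abs_nonneg (s - t)]

theorem abs_cos_sub_cos_le (s t : ℝ) : |Real.cos s - Real.cos t| ≤ |s - t| := by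
  have := abs_sin_sub_sin_le (s + Real.pi / 2) (t + Real.pi / 2)
  simpa [Real.sin_add_pi_div_two] using this

theorem isBddLip_sin_coord (a : ℝ) (i : ℕ) : IsBddLip (fun x => Real.sin (a * x i)) 1 ‖a‖₊ := by
  refine isBddLip_of_coord (F := fun t => Real.sin (a * t)) i (by fun_prop)
    (fun t => Real.abs_sin_le_one _) fun s t => ?_
  refine (abs_sin_sub_sin_le _ _).trans_eq ?_
  rw [← mul_sub, abs_mul]; simp

theorem isBddLip_cos_coord (a : ℝ) (i : ℕ) : IsBddLip (fun x => Real.cos (a * x i)) 1 ‖a‖₊ := by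
  refine isBddLip_of_coord (F := fun t => Real.cos (a * t)) i (by fun_prop)
    (fun t => Real.abs_cos_le_one _) fun s t => ?_
  refine (abs_cos_sub_cos_le _ _).trans_eq ?_
  rw [← mul_sub, abs_mul]; simp

variable {δ : VectorField gaussianProduct l2Dist}

/-- Repeated halving of the angle yields arbitrarily low frequencies, from which the coordinate
itself can be recovered in the limit. -/
theorem kills_sin_cos_pow {i : ℕ} (hs : Kills δ fun x => Real.sin (x i))
    (hc : Kills δ fun x => Real.cos (x i)) (k : ℕ) :
    Kills δ (fun x => Real.sin ((1 / 2) ^ k * x i)) ∧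
      Kills δ (fun x => Real.cos ((1 / 2) ^ k * x i)) := by
  induction k with
  | zero => simpa using ⟨hs, hc⟩
  | succ k ih =>
    have e : ∀ x : ℕ → ℝ, (1 / 2 : ℝ) ^ k * x i = 2 * ((1 / 2) ^ (k + 1) * x i) := fun x => by
      rw [pow_succ]; ring
    refine Kills.half_angle (isBddLip_sin_coord _ i) (isBddLip_cos_coord _ i)
      (fun x => by rw [← sq, ← sq, Real.sin_sq_add_cos_sq]) ?_ ?_
    · refine cast (congrArg _ (funext fun x => ?_)) (ih.1.const_mul 2⁻¹)
      rw [e, Real.sin_two_mul]; ring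
    · refine cast (congrArg _ (funext fun x => ?_)) ih.2
      rw [e, Real.cos_two_mul']; ring

theorem tendsto_scaled_sin (t : ℝ) :
    Tendsto (fun k : ℕ => (2 : ℝ) ^ k * Real.sin ((1 / 2) ^ k * t)) atTop (𝓝 t) := by
  have h1 : HasDerivAt (fun s => Real.sin (s * t)) t 0 := by
    have := ((hasDerivAt_id (0 : ℝ)).mul_const t).sin
    simpa using this
  have h2 := h1.tendsto_slope_zero_right
  have h3 : Tendsto (fun k : ℕ => (1 / 2 : ℝ) ^ k) atTop (𝓝[>] 0) :=
    tendsto_nhdsWithin_iff.2 ⟨tendsto_pow_atTop_nhds_zero_of_lt_one (by norm_num) (by norm_num),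
      Eventually.of_forall fun k => Set.mem_Ioi.2 (by positivity)⟩
  refine (h2.comp h3).congr fun k => ?_
  simp

/-- The functions `2^k sin (2^{-k} (x_i - q))` tend to `x_i - q` and all have Lipschitz constant
`1`; truncating their absolute values at `b` makes them uniformly bounded. The addition formula
absorbs the shift by `q`. -/
theorem kills_min_abs_sub {i : ℕ} (hs : Kills δ fun x => Real.sin (x i))
    (hc : Kills δ fun x => Real.cos (x i)) (q : ℝ) (b : ℝ≥0) :
    Kills δ fun x => min (b : ℝ) |x i - q| := by
  have hmin : ∀ {r s b : ℝ}, |min b r - min b s| ≤ |r - s| := fun {r s b} => by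
    simpa using abs_min_sub_min_le_max b r b s
  refine Kills.of_tendsto (M := b) (C := 1)
    (w := fun k x => min (b : ℝ) |(2 : ℝ) ^ k * Real.sin ((1 / 2) ^ k * (x i - q))|)
    (fun k => ?_) (fun k => ?_) fun x => ?_
  · refine isBddLip_of_coord
      (F := fun t => min (b : ℝ) |(2 : ℝ) ^ k * Real.sin ((1 / 2) ^ k * (t - q))|) i
      (by fun_prop) (fun t => ?_) fun s t => ?_
    · rw [abs_of_nonneg (le_min b.coe_nonneg (abs_nonneg _))]
      exact min_le_left _ _
    · refine hmin.trans ((abs_abs_sub_abs_le_abs_sub _ _).trans ?_)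
      rw [← mul_sub, abs_mul, abs_of_pos (by positivity : (0 : ℝ) < 2 ^ k)]
      refine (mul_le_mul_of_nonneg_left (abs_sin_sub_sin_le _ _) (by positivity)).trans_eq ?_
      rw [← mul_sub, abs_mul, abs_of_pos (by positivity : (0 : ℝ) < (1 / 2) ^ k), ← mul_assoc,
        ← mul_pow]
      simp
  · refine (Kills.const δ b).min (Kills.abs ?_)
    obtain ⟨h1, h2⟩ := kills_sin_cos_pow hs hc k
    refine cast (congrArg _ (funext fun x => ?_))
      (((h1.const_mul (Real.cos ((1 / 2) ^ k * q))).sub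
        (h2.const_mul (Real.sin ((1 / 2) ^ k * q)))).const_mul (2 ^ k))
    rw [mul_sub ((1 / 2 : ℝ) ^ k), Real.sin_sub]
    ring
  · exact tendsto_const_nhds.min (tendsto_scaled_sin _).abs

/-- A vector field that annihilates the sines and cosines of the first `N` coordinates annihilates
every bounded Lipschitz function of these coordinates. -/
theorem kills_of_coord {N : ℕ} (hs : ∀ i < N, Kills δ fun x => Real.sin (x i))
    (hc : ∀ i < N, Kills δ fun x => Real.cos (x i)) {u : (ℕ → ℝ) → ℝ} {M L : ℝ≥0}
    (hb : ∀ x, |u x| ≤ M) (hu : ∀ x y, |u x - u y| ≤ L * ∑ i ∈ Finset.range N, |x i - y i|) :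
    Kills δ u := by
  wlog hL : 0 < L generalizing L
  · refine this (L := L + 1) (fun x y => (hu x y).trans ?_) (by positivity)
    gcongr
    exact le_self_add
  have hL' : (0 : ℝ) < L := hL
  -- With `L b = 2 M`, a cone truncated at `b` has already dropped to at most `-M` once one
  -- coordinate difference exceeds `b`, so truncation does not push it above `u`.
  set b : ℝ≥0 := 2 * M / L with hbdef
  have hLb : (L : ℝ) * b = 2 * M := by
    rw [hbdef]; push_cast; field_simp
  set q := TopologicalSpace.denseSeq (ℕ → ℝ) with hq
  -- McShane's formula: `u` is the supremum of downward cones with apexes at a dense sequence of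
  -- points `q j`. Each cone here is truncated and built from annihilated functions.
  set v : ℕ → (ℕ → ℝ) → ℝ := fun j x =>
    max (-(M : ℝ)) (u (q j) - L * ∑ i ∈ Finset.range N, min (b : ℝ) |x i - q j i|) with hv
  have hvk : ∀ j, Kills δ (v j) := fun j =>
    (Kills.const δ _).max ((Kills.const δ _).sub (Kills.const_mul (Kills.sum _ fun i hi =>
      kills_min_abs_sub (hs i (Finset.mem_range.1 hi)) (hc i (Finset.mem_range.1 hi)) _ _) _))
  have hvm : ∀ j, Measurable (v j) := fun j => by
    refine measurable_const.max (measurable_const.sub ((Finset.measurable_fun_sum _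
      fun i _ => measurable_const.min ?_).const_mul _))
    exact ((measurable_coord i).sub_const _).abs
  have hvL : ∀ j x y, |v j x - v j y| ≤ L * ∑ i ∈ Finset.range N, |x i - y i| := fun j x y => by
    refine (abs_max_sub_max_le_max _ _ _ _).trans (max_le (by rw [sub_self, abs_zero]; positivity) ?_)
    rw [sub_sub_sub_cancel_left, ← mul_sub, abs_mul, abs_of_pos hL', ← Finset.sum_sub_distrib]
    gcongr
    refine (Finset.abs_sum_le_sum_abs _ _).trans ?_
    rw [← Finset.sum_congr rfl fun i _ => abs_sub_comm (y i) (x i)]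
    refine Finset.sum_le_sum fun i _ => ?_
    refine (abs_min_sub_min_le_max _ _ _ _).trans
      (max_le (by rw [sub_self, abs_zero]; positivity) ((abs_abs_sub_abs_le_abs_sub _ _).trans_eq ?_))
    congr 1; ring
  have hvu : ∀ j x, v j x ≤ u x := fun j x => by
    refine max_le (neg_le_of_abs_le (hb x)) ?_
    by_cases h : ∀ i ∈ Finset.range N, |x i - q j i| ≤ b
    · rw [Finset.sum_congr rfl fun i hi => min_eq_right (h i hi)]
      have := (abs_le.1 (hu x (q j))).1
      linarith
    · push Not at h
      obtain ⟨i, hi, hlt⟩ := h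
      have h1 : (b : ℝ) ≤ ∑ i ∈ Finset.range N, min (b : ℝ) |x i - q j i| := by
        have := Finset.single_le_sum (f := fun i => min (b : ℝ) |x i - q j i|)
          (fun i _ => le_min b.2 (abs_nonneg _)) hi
        simpa [min_eq_left hlt.le] using this
      have h2 := mul_le_mul_of_nonneg_left h1 hL'.le
      have h3 := (abs_le.1 (hb x)).1
      have h4 := (abs_le.1 (hb (q j))).2
      linarith
  -- Running maxima of the cones stay annihilated, keep the bounds `M` and `L`, and increase to `u`.
  set V : ℕ → (ℕ → ℝ) → ℝ := fun k => Nat.rec (v 0) (fun k W x => max (W x) (v (k + 1) x)) k with hV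
  have hV0 : V 0 = v 0 := rfl
  have hVs : ∀ k, V (k + 1) = fun x => max (V k x) (v (k + 1) x) := fun k => rfl
  have hVk : ∀ k, Kills δ (V k) := fun k => by
    induction k with
    | zero => exact hvk 0
    | succ k ih => exact ih.max (hvk _)
  have hVm : ∀ k, Measurable (V k) := fun k => by
    induction k with
    | zero => exact hvm 0
    | succ k ih => exact ih.max (hvm _)
  have hVL : ∀ k x y, |V k x - V k y| ≤ L * ∑ i ∈ Finset.range N, |x i - y i| := fun k x y => by
    induction k with
    | zero => exact hvL 0 x y
    | succ k ih =>
      rw [hVs]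
      exact (abs_max_sub_max_le_max _ _ _ _).trans (max_le ih (hvL _ x y))
  have hVu : ∀ k x, V k x ≤ u x := fun k x => by
    induction k with
    | zero => exact hvu 0 x
    | succ k ih => exact max_le ih (hvu _ x)
  have hVv : ∀ j k x, j ≤ k → v j x ≤ V k x := fun j k x hjk => by
    induction k with
    | zero => rw [Nat.le_zero.1 hjk, hV0]
    | succ k ih =>
      rw [hVs]
      rcases Nat.le_succ_iff.1 hjk with h | h
      · exact (ih h).trans (le_max_left _ _)
      · rw [h]; exact le_max_right _ _
  have hVb : ∀ k x, |V k x| ≤ M := fun k x => by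
    refine abs_le.2 ⟨?_, (hVu k x).trans (le_of_abs_le (hb x))⟩
    exact (le_max_left _ _).trans (hVv 0 k x (Nat.zero_le _))
  refine Kills.of_tendsto (fun k => IsBddLip.of_abs_sub_le_coord (hVm k) (hVb k) (hVL k)) hVk
    fun x => ?_
  refine Metric.tendsto_atTop.2 fun ε hε => ?_
  -- An apex this close to `x` costs `ε / 2` for the change of `u` and `ε / 2` for the height of the
  -- cone.
  have hopen : IsOpen {y : ℕ → ℝ | L * ∑ i ∈ Finset.range N, |x i - y i| < ε / 2} :=
    isOpen_lt (by fun_prop) continuous_const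
  obtain ⟨j, hj⟩ := (TopologicalSpace.denseRange_denseSeq (ℕ → ℝ)).exists_mem_open hopen
    ⟨x, by simpa using hε⟩
  refine ⟨j, fun k hk => ?_⟩
  have h1 := hVv j k x hk
  have h2 := hVu k x
  have h3 := (abs_le.1 (hu x (q j))).2
  have h4 : L * ∑ i ∈ Finset.range N, |x i - q j i| < ε / 2 := hj
  have h5 : u (q j) - L * ∑ i ∈ Finset.range N, |x i - q j i| ≤ v j x := by
    refine le_trans ?_ (le_max_right _ _)
    gcongr
    exact min_le_right _ _
  rw [Real.dist_eq, abs_lt]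
  constructor <;> linarith

/-! ### Vector fields are sections -/

/-- The vector of `l²(ℕ)` with finitely many prescribed coordinates. -/
noncomputable def finVec {n : ℕ} (c : EuclideanSpace ℝ (Fin n)) : HilbertL2 :=
  ∑ i : Fin n, lp.single 2 (i : ℕ) (c i)

theorem inner_finVec {n : ℕ} (v : HilbertL2) (c : EuclideanSpace ℝ (Fin n)) :
    inner ℝ v (finVec c) = ∑ i : Fin n, c i * v i := by
  rw [finVec, inner_sum]
  refine Finset.sum_congr rfl fun i _ => ?_
  rw [lp.inner_single_right]
  simp [mul_comm]

theorem grossDeriv_sin_linear {n : ℕ} (c : EuclideanSpace ℝ (Fin n))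
    {f : Lip gaussianProduct l2Dist}
    (hf : (f : Lp ℝ ⊤ gaussianProduct) =ᵐ[gaussianProduct]
      fun x => Real.sin (inner ℝ c (firstCoords n x))) :
    grossDeriv f =ᵐ[gaussianProduct]
      fun x => Real.cos (inner ℝ c (firstCoords n x)) • finVec c := by
  have h := (IsCylinder.comp_linear Real.contDiff_sin
    (fun k x => Real.abs_iteratedDeriv_sin_le_one k x) c).isGrossSobolevDerivative
  rw [Real.deriv_sin] at h
  exact grossDeriv_ae_eq h hf

theorem grossDeriv_cos_linear {n : ℕ} (c : EuclideanSpace ℝ (Fin n))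
    {f : Lip gaussianProduct l2Dist}
    (hf : (f : Lp ℝ ⊤ gaussianProduct) =ᵐ[gaussianProduct]
      fun x => Real.cos (inner ℝ c (firstCoords n x))) :
    grossDeriv f =ᵐ[gaussianProduct]
      fun x => -Real.sin (inner ℝ c (firstCoords n x)) • finVec c := by
  have h := (IsCylinder.comp_linear Real.contDiff_cos
    (fun k x => Real.abs_iteratedDeriv_cos_le_one k x) c).isGrossSobolevDerivative
  rw [Real.deriv_cos'] at h
  exact grossDeriv_ae_eq h hf

theorem isBddLip_sin_linear {n : ℕ} (c : EuclideanSpace ℝ (Fin n)) (q : ℝ) :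
    IsBddLip (fun x => Real.sin (inner ℝ c (firstCoords n x) - q)) 1 ‖c‖₊ := by
  refine ⟨?_, fun x => Real.abs_sin_le_one _, fun x y => ?_⟩
  · have := measurable_firstCoords n
    fun_prop
  · refine le_trans ?_ (mul_le_mul_right (edist_firstCoords_le_l2Dist n x y) _)
    rw [edist_dist, edist_dist, Real.dist_eq, dist_eq_norm, ← ENNReal.ofReal_coe_nnreal (p := ‖c‖₊),
      ← ENNReal.ofReal_mul (NNReal.coe_nonneg _)]
    refine ENNReal.ofReal_le_ofReal ((abs_sin_sub_sin_le _ _).trans ?_)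
    rw [sub_sub_sub_cancel_right, ← inner_sub_right]
    exact abs_real_inner_le_norm _ _

theorem inner_single_firstCoords (n : ℕ) (x : ℕ → ℝ) :
    inner ℝ (EuclideanSpace.single (Fin.last n) (1 : ℝ)) (firstCoords (n + 1) x) = x n := by
  rw [EuclideanSpace.inner_single_left]
  simp [firstCoords]

theorem isBddLip_sin (n : ℕ) : IsBddLip (fun x => Real.sin (x n)) 1 1 := by
  simpa using isBddLip_sin_coord 1 n

theorem isBddLip_cos (n : ℕ) : IsBddLip (fun x => Real.cos (x n)) 1 1 := by
  simpa using isBddLip_cos_coord 1 n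

theorem sectionField_ae_eq (G : Lp HilbertL2 ⊤ gaussianProduct) {f : Lip gaussianProduct l2Dist}
    {U : (ℕ → ℝ) → HilbertL2} (h : grossDeriv f =ᵐ[gaussianProduct] U) :
    (sectionField G).1 f =ᵐ[gaussianProduct] fun x => inner ℝ (G x) (U x) := by
  rw [sectionField_apply]
  filter_upwards [coeFn_sectionInner G (grossDeriv f), h] with x h1 h2
  rw [h1, h2]

theorem sectionField_sin (G : Lp HilbertL2 ⊤ gaussianProduct) (n : ℕ) :
    (sectionField G).1 (isBddLip_sin n).toLip =ᵐ[gaussianProduct]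
      fun x => Real.cos (x n) * G x n := by
  have h := sectionField_ae_eq G (grossDeriv_sin_linear (EuclideanSpace.single (Fin.last n) (1 : ℝ))
    (f := (isBddLip_sin n).toLip) (by simpa only [inner_single_firstCoords] using
      (isBddLip_sin n).coeFn_toLip))
  filter_upwards [h] with x hx
  rw [hx, inner_smul_right, inner_finVec, inner_single_firstCoords, Fin.sum_univ_castSucc]
  simp

theorem sectionField_cos (G : Lp HilbertL2 ⊤ gaussianProduct) (n : ℕ) :
    (sectionField G).1 (isBddLip_cos n).toLip =ᵐ[gaussianProduct]
      fun x => -Real.sin (x n) * G x n := by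
  have h := sectionField_ae_eq G (grossDeriv_cos_linear (EuclideanSpace.single (Fin.last n) (1 : ℝ))
    (f := (isBddLip_cos n).toLip) (by simpa only [inner_single_firstCoords] using
      (isBddLip_cos n).coeFn_toLip))
  filter_upwards [h] with x hx
  rw [hx, inner_smul_right, inner_finVec, inner_single_firstCoords, Fin.sum_univ_castSucc]
  simp

/-- The `n`-th component of a vector field. -/
noncomputable def component (δ : VectorField gaussianProduct l2Dist) (n : ℕ) :
    Lp ℝ ⊤ gaussianProduct :=
  ((isBddLip_cos n).toLip : Lp ℝ ⊤ gaussianProduct) • δ.1 (isBddLip_sin n).toLip -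
    ((isBddLip_sin n).toLip : Lp ℝ ⊤ gaussianProduct) • δ.1 (isBddLip_cos n).toLip

theorem coeFn_component (δ : VectorField gaussianProduct l2Dist) (n : ℕ) :
    component δ n =ᵐ[gaussianProduct] fun x => Real.cos (x n) * δ.1 (isBddLip_sin n).toLip x -
      Real.sin (x n) * δ.1 (isBddLip_cos n).toLip x := by
  filter_upwards [Lp.coeFn_sub
    (((isBddLip_cos n).toLip : Lp ℝ ⊤ gaussianProduct) • δ.1 (isBddLip_sin n).toLip :
      Lp ℝ ⊤ gaussianProduct)
    (((isBddLip_sin n).toLip : Lp ℝ ⊤ gaussianProduct) • δ.1 (isBddLip_cos n).toLip),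
    Lp.coeFn_lpSMul (r := ⊤) ((isBddLip_cos n).toLip : Lp ℝ ⊤ gaussianProduct)
      (δ.1 (isBddLip_sin n).toLip),
    Lp.coeFn_lpSMul (r := ⊤) ((isBddLip_sin n).toLip : Lp ℝ ⊤ gaussianProduct)
      (δ.1 (isBddLip_cos n).toLip), (isBddLip_sin n).coeFn_toLip, (isBddLip_cos n).coeFn_toLip]
    with x h1 h2 h3 h4 h5
  rw [component, h1, Pi.sub_apply, h2, h3, Pi.smul_apply', Pi.smul_apply', h4, h5, smul_eq_mul,
    smul_eq_mul]

/-- By the chain rule the combination is `(cos² + sin²) G_n`. So `component` plays the part of the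
value on the unbounded coordinate function. -/
theorem component_sectionField (G : Lp HilbertL2 ⊤ gaussianProduct) (n : ℕ) :
    component (sectionField G) n =ᵐ[gaussianProduct] fun x => G x n := by
  filter_upwards [coeFn_component (sectionField G) n, sectionField_sin G n, sectionField_cos G n]
    with x h1 h2 h3
  rw [h1, h2, h3]
  linear_combination (G x n) * Real.sin_sq_add_cos_sq (x n)

/-- Half of `δ(sin² + cos²) = δ(1) = 0`. -/
theorem sin_mul_add_cos_mul (δ : VectorField gaussianProduct l2Dist) (n : ℕ) :
    ∀ᵐ x ∂gaussianProduct, Real.sin (x n) * δ.1 (isBddLip_sin n).toLip x +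
      Real.cos (x n) * δ.1 (isBddLip_cos n).toLip x = 0 := by
  have hs := coeFn_lipMul (isBddLip_sin n).coeFn_toLip (isBddLip_sin n).coeFn_toLip
  have hc := coeFn_lipMul (isBddLip_cos n).coeFn_toLip (isBddLip_cos n).coeFn_toLip
  set s := (isBddLip_sin n).toLip
  set c := (isBddLip_cos n).toLip
  have h : δ.1 (lipMul s s + lipMul c c) = 0 := by
    refine (Kills.one δ).apply_eq_zero ?_
    filter_upwards [hs, hc, Lp.coeFn_add (lipMul s s : Lp ℝ ⊤ gaussianProduct) (lipMul c c)]
      with x h1 h2 h3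
    refine h3.trans ?_
    rw [Pi.add_apply, h1, h2, ← sq, ← sq, Real.sin_sq_add_cos_sq]
  rw [map_add, lp_eq_zero_iff] at h
  filter_upwards [h, Lp.coeFn_add (δ.1 (lipMul s s)) (δ.1 (lipMul c c)),
    vectorField_lipMul_ae δ (isBddLip_sin n).coeFn_toLip (isBddLip_sin n).coeFn_toLip,
    vectorField_lipMul_ae δ (isBddLip_cos n).coeFn_toLip (isBddLip_cos n).coeFn_toLip]
    with x h1 h2 h3 h4
  rw [h2, Pi.add_apply, h3, h4] at h1
  linarith

theorem sub_sectionField_apply_eq_zero {δ : VectorField gaussianProduct l2Dist}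
    {G : Lp HilbertL2 ⊤ gaussianProduct} {f : Lip gaussianProduct l2Dist}
    (h : ∀ᵐ x ∂gaussianProduct, δ.1 f x = (sectionField G).1 f x) :
    (δ - sectionField G).1 f = 0 :=
  sub_eq_zero.2 (Lp.ext h)

/-- The component and the relation `sin_mul_add_cos_mul` together determine `δ(sin x_n)` and `δ(cos
x_n)`: they equal `cos x_n` and `-sin x_n` times the component, as for the section field. -/
theorem kills_sin_cos_sub {δ : VectorField gaussianProduct l2Dist}
    {G : Lp HilbertL2 ⊤ gaussianProduct} {n : ℕ}
    (h : component δ n =ᵐ[gaussianProduct] fun x => G x n) :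
    Kills (δ - sectionField G) (fun x => Real.sin (x n)) ∧
      Kills (δ - sectionField G) (fun x => Real.cos (x n)) := by
  have key := sin_mul_add_cos_mul δ n
  refine ⟨⟨_, _, isBddLip_sin n, sub_sectionField_apply_eq_zero ?_⟩,
    ⟨_, _, isBddLip_cos n, sub_sectionField_apply_eq_zero ?_⟩⟩
  · filter_upwards [h, key, coeFn_component δ n, sectionField_sin G n] with x h1 h2 h3 h4
    rw [h4, ← h1, h3]
    linear_combination (Real.sin (x n)) * h2 -
      (δ.1 (isBddLip_sin n).toLip x) * Real.sin_sq_add_cos_sq (x n)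
  · filter_upwards [h, key, coeFn_component δ n, sectionField_cos G n] with x h1 h2 h3 h4
    rw [h4, ← h1, h3]
    linear_combination (Real.cos (x n)) * h2 -
      (δ.1 (isBddLip_cos n).toLip x) * Real.sin_sq_add_cos_sq (x n)

/-- Square-summability of all components is not yet known; finitely many bounded components always
form a section, which suffices to compute `δ` on functions of `N` coordinates. -/
theorem exists_partial_section (δ : VectorField gaussianProduct l2Dist) (N : ℕ) :
    ∃ G : Lp HilbertL2 ⊤ gaussianProduct, ∀ᵐ x ∂gaussianProduct, ∀ n < N,
      G x n = component δ n x := by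
  set g : ℕ → Lp ℝ ⊤ gaussianProduct := fun n => if n < N then component δ n else 0 with hg
  have hmem : g ∈ WeakL2 gaussianProduct := by
    refine ⟨∑ n ∈ Finset.range N, ‖component δ n‖ ^ 2, fun K => ?_⟩
    filter_upwards [ae_all_iff.2 fun n => lp_ae_norm_le (g n), Lp.coeFn_zero ℝ ⊤ gaussianProduct]
      with x h1 h2
    have h3 : ∀ n, n ∉ Finset.range N → g n x ^ 2 = 0 := fun n hn => by
      rw [hg]
      simp only [if_neg (fun h => hn (Finset.mem_range.2 h)), h2]
      simp
    rw [← Finset.sum_filter_add_sum_filter_not _ (fun n => n ∈ Finset.range N),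
      Finset.sum_eq_zero (s := Finset.filter (fun n => n ∉ Finset.range N) _)
        (fun n hn => h3 n (Finset.mem_filter.1 hn).2), add_zero]
    refine (Finset.sum_le_sum_of_subset_of_nonneg (t := Finset.range N)
      (fun n hn => (Finset.mem_filter.1 hn).2) fun _ _ _ => sq_nonneg _).trans ?_
    refine Finset.sum_le_sum fun n hn => ?_
    have h4 := h1 n
    rw [← sq_abs]
    refine pow_le_pow_left₀ (abs_nonneg _) (h4.trans_eq ?_) 2
    rw [hg]
    simp only [if_pos (Finset.mem_range.1 hn)]
  refine ⟨sectionMap _ ⟨g, hmem⟩, ?_⟩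
  filter_upwards [sectionMap_apply ⟨g, hmem⟩] with x hx n hn
  rw [hx n, hg]
  simp only [if_pos hn]

theorem abs_inner_firstCoords_sub_le {N : ℕ} (c : EuclideanSpace ℝ (Fin N)) (x y : ℕ → ℝ) :
    |inner ℝ c (firstCoords N x) - inner ℝ c (firstCoords N y)| ≤
      ‖c‖ * ∑ i ∈ Finset.range N, |x i - y i| := by
  rw [← inner_sub_right, PiLp.inner_apply, Finset.sum_range, Finset.mul_sum]
  refine (Finset.abs_sum_le_sum_abs _ _).trans (Finset.sum_le_sum fun i _ => ?_)
  rw [RCLike.inner_apply, conj_trivial, abs_mul, mul_comm]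
  exact mul_le_mul_of_nonneg_right (PiLp.norm_apply_le c i) (abs_nonneg _)

/-- On `sin (⟨c, x⟩ - q)`, which lies in the unit ball of the Lipschitz algebra, `δ` takes the value
`cos (⟨c, x⟩ - q) ∑ c_i g_i`, where `g_i` are its components. Rational `q` close to `⟨c, x⟩` bring
the cosine to `1` at the cost of countably many null sets. -/
theorem ae_abs_sum_le_of_norm_le_one (δ : VectorField gaussianProduct l2Dist) {K : ℝ≥0}
    (hK : opNorm δ.1 ≤ K) {N : ℕ} (c : EuclideanSpace ℝ (Fin N)) (hc : ‖c‖ ≤ 1) :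
    ∀ᵐ x ∂gaussianProduct, |∑ i : Fin N, c i * component δ i x| ≤ K := by
  obtain ⟨G, hG⟩ := exists_partial_section δ N
  have hk : ∀ n < N, Kills (δ - sectionField G) (fun x => Real.sin (x n)) ∧
      Kills (δ - sectionField G) (fun x => Real.cos (x n)) := fun n hn => by
    refine kills_sin_cos_sub ?_
    filter_upwards [hG] with x hx using (hx n hn).symm
  have hq : ∀ q : ℚ, ∀ᵐ x ∂gaussianProduct,
      |Real.cos (inner ℝ c (firstCoords N x) - q) * ∑ i : Fin N, c i * component δ i x| ≤ K := by
    intro q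
    set f := (isBddLip_sin_linear c q).toLip with hf
    have h0 : Kills (δ - sectionField G) (fun x => Real.sin (inner ℝ c (firstCoords N x) - q)) :=
      kills_of_coord (fun n hn => (hk n hn).1) (fun n hn => (hk n hn).2) (M := 1) (L := ‖c‖₊)
        (fun x => Real.abs_sin_le_one _) fun x y => (abs_sin_sub_sin_le _ _).trans (by
          rw [sub_sub_sub_cancel_right]
          exact abs_inner_firstCoords_sub_le c x y)
    have h1 : δ.1 f = (sectionField G).1 f :=
      sub_eq_zero.1 (h0.apply_eq_zero (isBddLip_sin_linear c q).coeFn_toLip)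
    have h2 : ‖δ.1 f‖ₑ ≤ K := by
      refine le_trans ?_ hK
      refine le_iSup₂_of_le f ((isBddLip_sin_linear c q).lipNorm_toLip_le.trans ?_) le_rfl
      have : ‖c‖₊ ≤ 1 := hc
      simpa using this
    have h3 : grossDeriv f =ᵐ[gaussianProduct]
        fun x => Real.cos (inner ℝ c (firstCoords N x) - q) • finVec c := by
      have hs := (IsCylinder.comp_linear Real.contDiff_sin
        (fun k x => Real.abs_iteratedDeriv_sin_le_one k x) c)
      have hc' := (IsCylinder.comp_linear Real.contDiff_cos
        (fun k x => Real.abs_iteratedDeriv_cos_le_one k x) c)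
      have h := ((hs.const_mul (Real.cos q)).add
        (hc'.const_mul (-Real.sin q))).isGrossSobolevDerivative
      have e : ∀ x : ℕ → ℝ, Real.cos q * Real.sin (inner ℝ c (firstCoords N x)) +
          -Real.sin q * Real.cos (inner ℝ c (firstCoords N x)) =
          Real.sin (inner ℝ c (firstCoords N x) - q) := fun x => by
        rw [Real.sin_sub]; ring
      refine (grossDeriv_ae_eq h ?_).trans (Eventually.of_forall fun x => ?_)
      · simp only [e]
        exact (isBddLip_sin_linear c q).coeFn_toLip
      · simp only [Real.deriv_sin, Real.deriv_cos', smul_smul, ← add_smul, finVec, Real.cos_sub]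
        congr 1
        ring
    have h2' : ‖δ.1 f‖ ≤ K := by
      rw [enorm_eq_nnnorm, ENNReal.coe_le_coe] at h2
      exact h2
    filter_upwards [hG, sectionField_ae_eq G h3, lp_ae_norm_le (δ.1 f)] with x k1 k2 k3
    rw [h1, k2, inner_smul_right, inner_finVec, Finset.sum_congr rfl fun i _ =>
      congrArg (c i * ·) (k1 i i.2)] at k3
    exact k3.trans (h1 ▸ h2')
  filter_upwards [ae_all_iff.2 hq] with x hx
  -- For fixed `x` the bound is a closed condition on `q`, so it extends from rational `q` to `q =
  -- ⟨c, x⟩`.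
  have hcl : IsClosed {q : ℝ | |Real.cos (inner ℝ c (firstCoords N x) - q) *
      ∑ i : Fin N, c i * component δ i x| ≤ K} := isClosed_le (by fun_prop) continuous_const
  have := isClosed_property (Rat.denseRange_cast (𝕜 := ℝ)) hcl hx (inner ℝ c (firstCoords N x))
  simpa using this

/-- Outside one null set the linear bound holds for a dense sequence of `c`, hence for all `c`,
including the vector `w` of components at `x`; this gives `‖w‖² ≤ K ‖w‖`. -/
theorem ae_sum_sq_component_le (δ : VectorField gaussianProduct l2Dist) {K : ℝ≥0}
    (hK : opNorm δ.1 ≤ K) (N : ℕ) :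
    ∀ᵐ x ∂gaussianProduct, ∑ n ∈ Finset.range N, component δ n x ^ 2 ≤ (K : ℝ) ^ 2 := by
  have h : ∀ c : EuclideanSpace ℝ (Fin N), ∀ᵐ x ∂gaussianProduct,
      |∑ i : Fin N, c i * component δ i x| ≤ K * ‖c‖ := by
    intro c
    rcases eq_or_ne c 0 with rfl | hc
    · exact Eventually.of_forall fun x => by simp
    have hc' : 0 < ‖c‖ := norm_pos_iff.2 hc
    filter_upwards [ae_abs_sum_le_of_norm_le_one δ hK (‖c‖⁻¹ • c) (by
      rw [norm_smul, norm_inv, norm_norm, inv_mul_cancel₀ hc'.ne'])] with x hx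
    have e : ∑ i : Fin N, (‖c‖⁻¹ • c) i * component δ i x =
        ‖c‖⁻¹ * ∑ i : Fin N, c i * component δ i x := by
      rw [Finset.mul_sum]
      refine Finset.sum_congr rfl fun i _ => ?_
      rw [PiLp.smul_apply, smul_eq_mul, mul_assoc]
    rw [e, abs_mul, abs_of_pos (inv_pos.2 hc'), inv_mul_le_iff₀ hc'] at hx
    linarith
  filter_upwards [ae_all_iff.2 fun j => h (TopologicalSpace.denseSeq _ j)] with x hx
  set w : EuclideanSpace ℝ (Fin N) := WithLp.toLp 2 fun i => component δ i x with hw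
  have hcl : IsClosed {c : EuclideanSpace ℝ (Fin N) |
      |∑ i : Fin N, c i * component δ i x| ≤ K * ‖c‖} := isClosed_le (by fun_prop) (by fun_prop)
  have h1 := isClosed_property (TopologicalSpace.denseRange_denseSeq (EuclideanSpace ℝ (Fin N))) hcl hx w
  have h2 : ∑ i : Fin N, w i * component δ i x = ‖w‖ ^ 2 := by
    rw [EuclideanSpace.real_norm_sq_eq]
    exact Finset.sum_congr rfl fun i _ => by rw [sq]
  have h3 : ∑ n ∈ Finset.range N, component δ n x ^ 2 = ‖w‖ ^ 2 := by
    rw [EuclideanSpace.real_norm_sq_eq, Finset.sum_range]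
  have h1' : |‖w‖ ^ 2| ≤ K * ‖w‖ := by rw [← h2]; exact h1
  rw [abs_of_nonneg (by positivity)] at h1'
  rw [h3]
  have : ‖w‖ ≤ K := by
    by_contra! hlt
    nlinarith [K.coe_nonneg, norm_nonneg w]
  gcongr

/-- The components form a section bounded by `‖δ‖`. The difference of `δ` and its field annihilates
all coordinate sines and cosines, hence the cylinder approximants of any `f`, and by weak*
continuity `f` itself. -/
theorem exists_sectionField_eq (δ : VectorField gaussianProduct l2Dist) :
    ∃ G : Lp HilbertL2 ⊤ gaussianProduct, sectionField G = δ ∧ ‖G‖ₑ ≤ opNorm δ.1 := by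
  obtain ⟨K, hK⟩ : ∃ K : ℝ≥0, (K : ℝ≥0∞) = opNorm δ.1 := ⟨_, ENNReal.coe_toNNReal δ.2.2.1.ne⟩
  have hmem : component δ ∈ WeakL2 gaussianProduct := ⟨(K : ℝ) ^ 2, ae_sum_sq_component_le δ hK.ge⟩
  set G := sectionMap _ ⟨component δ, hmem⟩ with hG
  have hGx : ∀ᵐ x ∂gaussianProduct, ∀ n, G x n = component δ n x := sectionMap_apply ⟨_, hmem⟩
  refine ⟨G, ?_, ?_⟩
  · have hk : ∀ n, Kills (δ - sectionField G) (fun x => Real.sin (x n)) ∧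
        Kills (δ - sectionField G) (fun x => Real.cos (x n)) := fun n => by
      refine kills_sin_cos_sub ?_
      filter_upwards [hGx] with x hx using (hx n).symm
    refine (sub_eq_zero.1 (Subtype.ext (LinearMap.ext fun f => ?_))).symm
    have hf : lipNumber gaussianProduct l2Dist (f : Lp ℝ ⊤ gaussianProduct) < ⊤ := f.2
    obtain ⟨L, hL⟩ : ∃ L : ℝ≥0, (L : ℝ≥0∞) = _ := ⟨_, ENNReal.coe_toNNReal hf.ne⟩
    obtain ⟨u, U, -, hb, -, hN, -, hlim⟩ := exists_isCylinder_seq f hL.ge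
    refine Kills.of_tendsto_lip hb (fun k => ?_) ?_ hlim
    · obtain ⟨N, hN⟩ := hN k
      exact kills_of_coord (fun i _ => (hk i).1) (fun i _ => (hk i).2) (hb k).bound hN
    · rw [ENNReal.coe_max, hL]
      exact le_rfl
  · rw [← hK]
    refine lp_enorm_le_of_ae_norm_le ?_
    filter_upwards [hGx, ae_all_iff.2 (ae_sum_sq_component_le δ hK.ge)] with x h1 h2
    refine norm_le_of_sum_range_le K.coe_nonneg fun N => ?_
    simpa only [h1] using h2 N

theorem sectionField_injective : Function.Injective sectionField := by
  intro G H h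
  refine section_ext fun n => ?_
  have h1 := component_sectionField G n
  rw [h] at h1
  exact h1.symm.trans (component_sectionField H n)

/-- The lower bound comes from the representing section of norm at most the operator norm, which
injectivity identifies with `G`. -/
theorem opNorm_sectionField (G : Lp HilbertL2 ⊤ gaussianProduct) :
    opNorm (sectionField G).1 = ‖G‖ₑ := by
  refine (opNorm_sectionField_le G).antisymm ?_
  obtain ⟨H, h1, h2⟩ := exists_sectionField_eq (sectionField G)
  rwa [sectionField_injective h1] at h2

/-- The bounded measurable sections are the vector fields. -/
noncomputable def sectionFieldEquiv :
    Lp HilbertL2 ⊤ gaussianProduct ≃ₗ[ℝ] VectorField gaussianProduct l2Dist :=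
  LinearEquiv.ofBijective
    ({ toFun := sectionField
       map_add' := fun G H => Subtype.ext (LinearMap.ext fun _ => sectionInner_add_left G H _)
       map_smul' := fun c G =>
         Subtype.ext (LinearMap.ext fun f => sectionInner_smul_left c G (grossDeriv f)) } :
      Lp HilbertL2 ⊤ gaussianProduct →ₗ[ℝ] VectorField gaussianProduct l2Dist)
    ⟨sectionField_injective, fun δ => (exists_sectionField_eq δ).imp fun _ h => h.1⟩

theorem sectionField_lpSMul (a : Lp ℝ ⊤ gaussianProduct) (G : Lp HilbertL2 ⊤ gaussianProduct) :
    sectionField (a • G : Lp HilbertL2 ⊤ gaussianProduct) = fieldSMul a (sectionField G) :=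
  Subtype.ext (LinearMap.ext fun _ => sectionInner_lpSMul_left a G _)

/-! ### The dual of the module of sections -/

section Dual

variable {Λ : Lp HilbertL2 ⊤ gaussianProduct →ₗ[ℝ] Lp ℝ ⊤ gaussianProduct} {F : ℝ≥0}

/-- Multiply `G` by the indicator of `{‖G‖ ≤ q}`; module linearity carries the indicator through
`Λ`, so the global bound becomes local. -/
theorem ae_abs_le_mul_of_ae_norm_le
    (hΛ : ∀ (a : Lp ℝ ⊤ gaussianProduct) (G : Lp HilbertL2 ⊤ gaussianProduct),
      Λ (a • G : Lp HilbertL2 ⊤ gaussianProduct) = a • Λ G)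
    (hF : ∀ G, ‖Λ G‖ₑ ≤ F * ‖G‖ₑ) (G : Lp HilbertL2 ⊤ gaussianProduct) (q : ℝ≥0) :
    ∀ᵐ x ∂gaussianProduct, ‖G x‖ ≤ q → |Λ G x| ≤ F * q := by
  have hA : MeasurableSet {x | ‖G x‖ ≤ q} :=
    measurableSet_le (Lp.stronglyMeasurable G).norm.measurable measurable_const
  set a : Lp ℝ ⊤ gaussianProduct := indicatorConstLp ⊤ hA (measure_ne_top _ _) (1 : ℝ)
  have ha : a =ᵐ[gaussianProduct] _ := indicatorConstLp_coeFn
  have h1 : ‖(a • G : Lp HilbertL2 ⊤ gaussianProduct)‖ₑ ≤ q := by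
    refine lp_enorm_le_of_ae_norm_le ?_
    filter_upwards [ha, Lp.coeFn_lpSMul (r := ⊤) a G] with x h1 h2
    rw [h2, Pi.smul_apply', h1]
    by_cases hx : x ∈ {x | ‖G x‖ ≤ q}
    · rw [Set.indicator_of_mem hx, one_smul]; exact hx
    · rw [Set.indicator_of_notMem hx, zero_smul, norm_zero]; exact q.coe_nonneg
  have h2 : ‖(a • Λ G : Lp ℝ ⊤ gaussianProduct)‖ₑ ≤ (F * q : ℝ≥0) := by
    rw [← hΛ, ENNReal.coe_mul]
    exact (hF _).trans (mul_le_mul_right h1 _)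
  have h2' : ‖(a • Λ G : Lp ℝ ⊤ gaussianProduct)‖ ≤ F * q := by
    rw [enorm_eq_nnnorm, ENNReal.coe_le_coe] at h2
    exact h2
  filter_upwards [ha, Lp.coeFn_lpSMul (r := ⊤) a (Λ G),
    lp_ae_norm_le (a • Λ G : Lp ℝ ⊤ gaussianProduct)] with x h3 h4 h5 hx
  rw [h4, Pi.smul_apply', h3, Set.indicator_of_mem (by exact hx), one_smul] at h5
  exact h5.trans h2'

/-- Letting rational levels `q` decrease to `‖G x‖` shows that `Λ` acts fiber by fiber. -/
theorem ae_abs_le_mul_norm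
    (hΛ : ∀ (a : Lp ℝ ⊤ gaussianProduct) (G : Lp HilbertL2 ⊤ gaussianProduct),
      Λ (a • G : Lp HilbertL2 ⊤ gaussianProduct) = a • Λ G)
    (hF : ∀ G, ‖Λ G‖ₑ ≤ F * ‖G‖ₑ) (G : Lp HilbertL2 ⊤ gaussianProduct) :
    ∀ᵐ x ∂gaussianProduct, |Λ G x| ≤ F * ‖G x‖ := by
  filter_upwards [ae_all_iff.2 fun q : ℚ => ae_abs_le_mul_of_ae_norm_le hΛ hF G (q : ℝ).toNNReal]
    with x hx
  refine le_of_forall_pos_le_add fun ε hε => ?_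
  obtain ⟨q, hq1, hq2⟩ := exists_rat_btwn
    (show ‖G x‖ < ‖G x‖ + ε / (F + 1) from lt_add_of_pos_right _ (by positivity))
  have hq0 : (0 : ℝ) ≤ q := (norm_nonneg _).trans hq1.le
  have h1 := hx q (by rw [Real.coe_toNNReal _ hq0]; exact hq1.le)
  rw [Real.coe_toNNReal _ hq0] at h1
  have h2 : (F : ℝ) * (ε / (F + 1)) ≤ ε := by
    rw [← mul_div_assoc, div_le_iff₀ (by positivity)]
    nlinarith
  have h3 := mul_le_mul_of_nonneg_left hq2.le F.coe_nonneg
  linarith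

/-- The constant section `e_n`. -/
noncomputable def basisSection (n : ℕ) : Lp HilbertL2 ⊤ gaussianProduct :=
  (memLp_const (lp.single 2 n (1 : ℝ) : HilbertL2)).toLp _

theorem coeFn_sum_smul_basisSection (a : ℕ → Lp ℝ ⊤ gaussianProduct) (N : ℕ) :
    ∀ᵐ x ∂gaussianProduct, (∑ n ∈ Finset.range N, (a n • basisSection n :
      Lp HilbertL2 ⊤ gaussianProduct)) x = ∑ n ∈ Finset.range N, lp.single 2 n (a n x) := by
  filter_upwards [Lp.coeFn_finsetSum (Finset.range N) fun n => (a n • basisSection n :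
      Lp HilbertL2 ⊤ gaussianProduct),
    ae_all_iff.2 fun n => Lp.coeFn_lpSMul (r := ⊤) (a n) (basisSection n),
    ae_all_iff.2 fun n => MemLp.coeFn_toLp (μ := gaussianProduct) (p := ⊤)
      (memLp_const (lp.single 2 n (1 : ℝ) : HilbertL2))] with x h1 h2 h3
  rw [h1, Finset.sum_apply]
  refine Finset.sum_congr rfl fun n _ => ?_
  rw [h2, Pi.smul_apply', basisSection, h3, ← lp.single_smul, smul_eq_mul, mul_one]

theorem coeFn_apply_sum
    (hΛ : ∀ (a : Lp ℝ ⊤ gaussianProduct) (G : Lp HilbertL2 ⊤ gaussianProduct),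
      Λ (a • G : Lp HilbertL2 ⊤ gaussianProduct) = a • Λ G)
    (a : ℕ → Lp ℝ ⊤ gaussianProduct) (N : ℕ) :
    ∀ᵐ x ∂gaussianProduct, Λ (∑ n ∈ Finset.range N, (a n • basisSection n :
      Lp HilbertL2 ⊤ gaussianProduct)) x =
        ∑ n ∈ Finset.range N, a n x * Λ (basisSection n) x := by
  rw [map_sum, Finset.sum_congr rfl fun n _ => hΛ (a n) (basisSection n)]
  filter_upwards [Lp.coeFn_finsetSum (Finset.range N) fun n => (a n • Λ (basisSection n) :
      Lp ℝ ⊤ gaussianProduct),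
    ae_all_iff.2 fun n => Lp.coeFn_lpSMul (r := ⊤) (a n) (Λ (basisSection n))] with x h1 h2
  rw [h1, Finset.sum_apply]
  exact Finset.sum_congr rfl fun n _ => h2 n

theorem norm_sq_sum_single (a : ℕ → ℝ) (N : ℕ) :
    ‖(∑ n ∈ Finset.range N, lp.single 2 n (a n) : HilbertL2)‖ ^ 2 =
      ∑ n ∈ Finset.range N, a n ^ 2 := by
  have h := lp.norm_sum_single (p := 2) (E := fun _ : ℕ => ℝ) (by norm_num) a (Finset.range N)
  simpa using h

/-- Every bounded module homomorphism from the sections of the Hilbert bundle to `L^∞` is the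
fiberwise inner product with a section. -/
theorem exists_sectionInner_eq
    (hΛ : ∀ (a : Lp ℝ ⊤ gaussianProduct) (G : Lp HilbertL2 ⊤ gaussianProduct),
      Λ (a • G : Lp HilbertL2 ⊤ gaussianProduct) = a • Λ G)
    (hF : ∀ G, ‖Λ G‖ₑ ≤ F * ‖G‖ₑ) :
    ∃ T : Lp HilbertL2 ⊤ gaussianProduct, ‖T‖ₑ ≤ F ∧ ∀ G, Λ G = sectionInner T G := by
  set t : ℕ → Lp ℝ ⊤ gaussianProduct := fun n => Λ (basisSection n) with ht
  -- The fiberwise bound at the section `∑ t_n e_n` reads `r² ≤ F r` with `r² = ∑ t_n²`.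
  have hsum : ∀ N, ∀ᵐ x ∂gaussianProduct, ∑ n ∈ Finset.range N, t n x ^ 2 ≤ (F : ℝ) ^ 2 := by
    intro N
    filter_upwards [coeFn_sum_smul_basisSection t N, coeFn_apply_sum hΛ t N,
      ae_abs_le_mul_norm hΛ hF (∑ n ∈ Finset.range N, (t n • basisSection n :
        Lp HilbertL2 ⊤ gaussianProduct))] with x h1 h2 h3
    rw [h1, h2] at h3
    have h4 := norm_sq_sum_single (fun n => t n x) N
    set r := ‖(∑ n ∈ Finset.range N, lp.single 2 n (t n x) : HilbertL2)‖
    have h5 : ∑ n ∈ Finset.range N, t n x * Λ (basisSection n) x = r ^ 2 := by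
      rw [h4]
      exact Finset.sum_congr rfl fun n _ => (sq _).symm
    rw [h5, abs_of_nonneg (by positivity)] at h3
    rw [← h4]
    have h6 : 0 ≤ r := norm_nonneg _
    have : r ≤ F := by
      by_contra! hlt
      nlinarith [F.coe_nonneg]
    gcongr
  have hmem : t ∈ WeakL2 gaussianProduct := ⟨_, hsum⟩
  have hT : ∀ᵐ x ∂gaussianProduct, ∀ n, sectionMap _ ⟨t, hmem⟩ x n = t n x :=
    sectionMap_apply ⟨t, hmem⟩
  refine ⟨sectionMap _ ⟨t, hmem⟩, lp_enorm_le_of_ae_norm_le ?_, fun G => Lp.ext ?_⟩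
  · filter_upwards [hT, ae_all_iff.2 hsum] with x h1 h2
    refine norm_le_of_sum_range_le F.coe_nonneg fun N => ?_
    simpa only [h1] using h2 N
  · set a : ℕ → Lp ℝ ⊤ gaussianProduct := fun n => (memLp_top_apply G n).toLp _ with ha
    -- The truncations converge to `G` in each fiber but not necessarily in the `L^∞` norm;
    -- convergence of `Λ (P N)` to `Λ G` therefore rests on the fiberwise bound.
    set P : ℕ → Lp HilbertL2 ⊤ gaussianProduct := fun N => ∑ n ∈ Finset.range N,
      (a n • basisSection n : Lp HilbertL2 ⊤ gaussianProduct) with hP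
    filter_upwards [hT, coeFn_sectionInner (sectionMap _ ⟨t, hmem⟩) G,
      ae_all_iff.2 fun n => (memLp_top_apply G n).coeFn_toLp,
      ae_all_iff.2 (coeFn_sum_smul_basisSection a), ae_all_iff.2 (coeFn_apply_sum hΛ a),
      ae_all_iff.2 fun N => ae_abs_le_mul_norm hΛ hF (G - P N),
      ae_all_iff.2 fun N => Lp.coeFn_sub G (P N),
      ae_all_iff.2 fun N => Lp.coeFn_sub (Λ G) (Λ (P N))] with x h1 h2 h3 h4 h5 h6 h7 h8
    rw [h2]
    have l1 : Tendsto (fun N => Λ (P N) x) atTop (𝓝 (inner ℝ (sectionMap _ ⟨t, hmem⟩ x) (G x))) := by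
      have := (lp.hasSum_inner (𝕜 := ℝ) (sectionMap _ ⟨t, hmem⟩ x) (G x)).tendsto_sum_nat
      refine this.congr fun N => ?_
      rw [hP, h5]
      refine Finset.sum_congr rfl fun n _ => ?_
      rw [h1, RCLike.inner_apply, conj_trivial]
      congr 1
      exact (h3 n).symm
    have l2 : Tendsto (fun N => Λ (P N) x) atTop (𝓝 (Λ G x)) := by
      have k1 : Tendsto (fun N => F * ‖G x - P N x‖) atTop (𝓝 0) := by
        have := (lp.hasSum_single (p := 2) (by norm_num) (G x)).tendsto_sum_nat
        have k2 := ((this.const_sub (G x)).norm).const_mul (F : ℝ)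
        rw [sub_self, norm_zero, mul_zero] at k2
        refine k2.congr fun N => ?_
        rw [hP, h4]
        simp only [ha, h3]
      refine tendsto_iff_norm_sub_tendsto_zero.2
        (squeeze_zero (fun _ => norm_nonneg _) (fun N => ?_) k1)
      have k3 := h6 N
      rw [map_sub, h8, h7, Pi.sub_apply, Pi.sub_apply] at k3
      rw [norm_sub_rev]
      exact k3
    exact tendsto_nhds_unique l2 l1

end Dual

/-! ### One-forms are sections -/

theorem sectionFieldEquiv_symm_fieldSMul (a : Lp ℝ ⊤ gaussianProduct)
    (δ : VectorField gaussianProduct l2Dist) :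
    sectionFieldEquiv.symm (fieldSMul a δ) =
      (a • sectionFieldEquiv.symm δ : Lp HilbertL2 ⊤ gaussianProduct) := by
  obtain ⟨G, rfl⟩ := sectionFieldEquiv.surjective δ
  rw [LinearEquiv.symm_apply_apply, LinearEquiv.symm_apply_eq]
  exact (sectionField_lpSMul a G).symm

theorem enorm_sectionFieldEquiv_symm (δ : VectorField gaussianProduct l2Dist) :
    ‖sectionFieldEquiv.symm δ‖ₑ = opNorm δ.1 := by
  obtain ⟨G, rfl⟩ := sectionFieldEquiv.surjective δ
  rw [LinearEquiv.symm_apply_apply]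
  exact (opNorm_sectionField G).symm

theorem formNorm_le_of_sectionInner {T : Lp HilbertL2 ⊤ gaussianProduct}
    {θ : VectorField gaussianProduct l2Dist →ₗ[ℝ] Lp ℝ ⊤ gaussianProduct}
    (h : ∀ δ, θ δ = sectionInner T (sectionFieldEquiv.symm δ)) : formNorm θ ≤ ‖T‖ₑ := by
  refine iSup₂_le fun δ hδ => ?_
  rw [h]
  refine (enorm_sectionInner_le _ _).trans ?_
  rw [enorm_sectionFieldEquiv_symm]
  exact (mul_le_mul_right hδ _).trans_eq (mul_one _)

/-- The fiberwise inner product of vector fields with a section. -/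
noncomputable def pairWith (T : Lp HilbertL2 ⊤ gaussianProduct) :
    VectorField gaussianProduct l2Dist →ₗ[ℝ] Lp ℝ ⊤ gaussianProduct where
  toFun δ := sectionInner T (sectionFieldEquiv.symm δ)
  map_add' δ ε := by rw [map_add, sectionInner_add_right]
  map_smul' c δ := by rw [map_smul, sectionInner_smul_right, RingHom.id_apply]

theorem pairWith_apply (T : Lp HilbertL2 ⊤ gaussianProduct)
    (δ : VectorField gaussianProduct l2Dist) :
    pairWith T δ = sectionInner T (sectionFieldEquiv.symm δ) := rfl

theorem pairWith_mem (T : Lp HilbertL2 ⊤ gaussianProduct) :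
    pairWith T ∈ OneForm gaussianProduct l2Dist := by
  refine ⟨fun a δ => ?_,
    (formNorm_le_of_sectionInner (pairWith_apply T)).trans_lt (enorm_lt_top (x := T))⟩
  rw [pairWith_apply, pairWith_apply, sectionFieldEquiv_symm_fieldSMul, sectionInner_lpSMul_right]

/-- The 1-form given by the fiberwise inner product with a section. -/
noncomputable def sectionForm :
    Lp HilbertL2 ⊤ gaussianProduct →ₗ[ℝ] OneForm gaussianProduct l2Dist where
  toFun T := ⟨pairWith T, pairWith_mem T⟩
  map_add' S T := Subtype.ext (LinearMap.ext fun δ =>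
    sectionInner_add_left S T (sectionFieldEquiv.symm δ))
  map_smul' c T := Subtype.ext (LinearMap.ext fun δ => sectionInner_smul_left c T
    (sectionFieldEquiv.symm δ))

theorem sectionForm_apply (T : Lp HilbertL2 ⊤ gaussianProduct)
    (δ : VectorField gaussianProduct l2Dist) :
    (sectionForm T).1 δ = sectionInner T (sectionFieldEquiv.symm δ) := rfl

/-- The form norm is a supremum over the unit ball, so `G` is rescaled to norm one. -/
theorem enorm_apply_le_formNorm_mul (θ : OneForm gaussianProduct l2Dist)
    (G : Lp HilbertL2 ⊤ gaussianProduct) :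
    ‖θ.1 (sectionFieldEquiv G)‖ₑ ≤ formNorm θ.1 * ‖G‖ₑ := by
  rcases eq_or_ne G 0 with rfl | hG
  · simp
  have h0 : ‖G‖ ≠ 0 := norm_ne_zero_iff.2 hG
  have h1 : ‖θ.1 (sectionFieldEquiv (‖G‖⁻¹ • G))‖ₑ ≤ formNorm θ.1 := by
    refine le_iSup₂_of_le _ ?_ le_rfl
    rw [← enorm_sectionFieldEquiv_symm, LinearEquiv.symm_apply_apply, enorm_smul, enorm_inv h0,
      enorm_norm, ENNReal.inv_mul_cancel (by simpa using hG) enorm_ne_top]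
  rw [map_smul, map_smul, enorm_smul, enorm_inv h0, enorm_norm] at h1
  rwa [ENNReal.inv_mul_le_iff (by simpa using hG) enorm_ne_top, mul_comm] at h1

theorem exists_sectionForm_eq (θ : OneForm gaussianProduct l2Dist) :
    ∃ T, sectionForm T = θ ∧ ‖T‖ₑ ≤ formNorm θ.1 := by
  obtain ⟨F, hF⟩ : ∃ F : ℝ≥0, (F : ℝ≥0∞) = formNorm θ.1 := ⟨_, ENNReal.coe_toNNReal θ.2.2.ne⟩
  obtain ⟨T, h1, h2⟩ := exists_sectionInner_eq (Λ := θ.1 ∘ₗ sectionFieldEquiv.toLinearMap) (F := F)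
    (fun a G => by
      change θ.1 (sectionField (a • G : Lp HilbertL2 ⊤ gaussianProduct)) = _
      rw [sectionField_lpSMul, θ.2.1]
      rfl)
    (fun G => by rw [hF]; exact enorm_apply_le_formNorm_mul θ G)
  refine ⟨T, Subtype.ext (LinearMap.ext fun δ => ?_), hF ▸ h1⟩
  obtain ⟨G, rfl⟩ := sectionFieldEquiv.surjective δ
  rw [sectionForm_apply, LinearEquiv.symm_apply_apply, ← h2]
  rfl

theorem sectionForm_injective : Function.Injective sectionForm := by
  rw [injective_iff_map_eq_zero]
  intro T hT
  have h : sectionInner T T = 0 := by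
    have := sectionForm_apply T (sectionFieldEquiv T)
    rw [sectionFieldEquiv.symm_apply_apply, hT] at this
    exact this.symm
  rw [lp_eq_zero_iff] at h
  refine Lp.eq_zero_iff_ae_eq_zero.2 ?_
  filter_upwards [h, coeFn_sectionInner T T] with x h1 h2
  rw [h1] at h2
  exact inner_self_eq_zero.1 h2.symm

/-- The bounded measurable sections are the 1-forms. -/
noncomputable def sectionFormEquiv :
    Lp HilbertL2 ⊤ gaussianProduct ≃ₗ[ℝ] OneForm gaussianProduct l2Dist :=
  LinearEquiv.ofBijective sectionForm
    ⟨sectionForm_injective, fun θ => (exists_sectionForm_eq θ).imp fun _ h => h.1⟩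

theorem formNorm_sectionForm (T : Lp HilbertL2 ⊤ gaussianProduct) :
    formNorm (sectionForm T).1 = ‖T‖ₑ := by
  refine (formNorm_le_of_sectionInner (sectionForm_apply T)).antisymm ?_
  obtain ⟨H, h1, h2⟩ := exists_sectionForm_eq (sectionForm T)
  rwa [sectionForm_injective h1] at h2

theorem sectionForm_lpSMul (a : Lp ℝ ⊤ gaussianProduct) (T : Lp HilbertL2 ⊤ gaussianProduct) :
    sectionForm (a • T : Lp HilbertL2 ⊤ gaussianProduct) = formSMul a (sectionForm T) :=
  Subtype.ext (LinearMap.ext fun _ => sectionInner_lpSMul_left a T _)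

/-- Every field is `⟨G, D·⟩` for a section `G`, so `(df)(δ) = δ(f) = ⟨G, Df⟩`: the inner product
with `Df`. -/
theorem exteriorDeriv_eq_sectionForm (f : Lip gaussianProduct l2Dist) :
    exteriorDeriv f = sectionForm (grossDeriv f) := by
  refine Subtype.ext (LinearMap.ext fun δ => ?_)
  obtain ⟨G, rfl⟩ := sectionFieldEquiv.surjective δ
  rw [sectionForm_apply, LinearEquiv.symm_apply_apply, sectionInner_comm]
  rfl

/-! ### Assembly of the isomorphisms -/

theorem sectionEquiv_apply {α : Type*} [MeasurableSpace α] {μ : Measure α} (g : WeakL2 μ) :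
    sectionEquiv μ g = sectionMap μ g := rfl

theorem sectionFormEquiv_apply (T : Lp HilbertL2 ⊤ gaussianProduct) :
    sectionFormEquiv T = sectionForm T := rfl

theorem sectionFormEquiv_symm_exteriorDeriv (f : Lip gaussianProduct l2Dist) :
    sectionFormEquiv.symm (exteriorDeriv f) = grossDeriv f := by
  rw [LinearEquiv.symm_apply_eq, sectionFormEquiv_apply, exteriorDeriv_eq_sectionForm]

/-- The isomorphism from the module of vector fields to `l²(L^∞)`. -/
noncomputable def fieldEquiv :
    VectorField gaussianProduct l2Dist ≃ₗ[ℝ] WeakL2 gaussianProduct :=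
  sectionFieldEquiv.symm.trans (sectionEquiv gaussianProduct).symm

theorem sectionEquiv_fieldEquiv (δ : VectorField gaussianProduct l2Dist) :
    sectionEquiv gaussianProduct (fieldEquiv δ) = sectionFieldEquiv.symm δ :=
  (sectionEquiv gaussianProduct).apply_symm_apply _

theorem fieldEquiv_fieldSMul (a : Lp ℝ ⊤ gaussianProduct) (δ : VectorField gaussianProduct l2Dist) :
    fieldEquiv (fieldSMul a δ) = weakL2SMul a (fieldEquiv δ) := by
  apply (sectionEquiv gaussianProduct).injective
  rw [sectionEquiv_fieldEquiv, sectionFieldEquiv_symm_fieldSMul, sectionEquiv_apply,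
    sectionMap_weakL2SMul, ← sectionEquiv_apply, sectionEquiv_fieldEquiv]

theorem weakL2Norm_fieldEquiv (δ : VectorField gaussianProduct l2Dist) :
    weakL2Norm (fieldEquiv δ) = opNorm δ.1 := by
  rw [← enorm_sectionMap, ← sectionEquiv_apply, sectionEquiv_fieldEquiv,
    enorm_sectionFieldEquiv_symm]

theorem sectionFormEquiv_symm_formSMul (a : Lp ℝ ⊤ gaussianProduct)
    (θ : OneForm gaussianProduct l2Dist) :
    sectionFormEquiv.symm (formSMul a θ) =
      (a • sectionFormEquiv.symm θ : Lp HilbertL2 ⊤ gaussianProduct) := by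
  have hT : sectionForm (sectionFormEquiv.symm θ) = θ := sectionFormEquiv.apply_symm_apply θ
  have h := sectionForm_lpSMul a (sectionFormEquiv.symm θ)
  rw [hT] at h
  exact sectionFormEquiv.injective ((sectionFormEquiv.apply_symm_apply _).trans h.symm)

theorem enorm_sectionFormEquiv_symm (θ : OneForm gaussianProduct l2Dist) :
    ‖sectionFormEquiv.symm θ‖ₑ = formNorm θ.1 := by
  obtain ⟨T, rfl⟩ := sectionFormEquiv.surjective θ
  rw [LinearEquiv.symm_apply_apply, sectionFormEquiv_apply, formNorm_sectionForm]

theorem apply_eq_inner_sectionFormEquiv_symm (θ : OneForm gaussianProduct l2Dist)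
    (δ : VectorField gaussianProduct l2Dist) :
    ∀ᵐ x ∂gaussianProduct, θ.1 δ x =
      inner ℝ (sectionFormEquiv.symm θ x) (sectionEquiv gaussianProduct (fieldEquiv δ) x) := by
  obtain ⟨T, rfl⟩ := sectionFormEquiv.surjective θ
  rw [LinearEquiv.symm_apply_apply, sectionEquiv_fieldEquiv, sectionFormEquiv_apply,
    sectionForm_apply]
  exact coeFn_sectionInner T _

/-- One direction is uniqueness of the Gross–Sobolev derivative, the other its existence for `f`;
both go through the identification of `df` with `Df`. -/
theorem isGrossSobolevDerivative_iff (f : Lip gaussianProduct l2Dist) (G : (ℕ → ℝ) → HilbertL2) :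
    IsGrossSobolevDerivative (f : Lp ℝ ⊤ gaussianProduct) G ↔
      G =ᵐ[gaussianProduct] sectionFormEquiv.symm (exteriorDeriv f) := by
  rw [sectionFormEquiv_symm_exteriorDeriv]
  exact ⟨fun hG => hG.unique (isGrossSobolevDerivative_grossDeriv f),
    fun hG => (isGrossSobolevDerivative_grossDeriv f).congr (ae_eq_refl _) hG.symm⟩

end MetricCalculus

/-- For `ℝ^ℕ` with the `l²` metric and the product Gaussian measure, `X(ℝ^ℕ)` is isometrically
isomorphic, as a module over `L^∞`, to `l²(L^∞)` (through `Φ`) and hence to the bounded measurable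
sections of the Hilbert bundle `ℝ^ℕ × l²(ℕ)` (through `S`, which sends `(g_n)` to
`x ↦ (g_n(x))`). Under this identification and the resulting identification `Θ` of the dual module
`Ω(ℝ^ℕ)` with the same sections, the exterior derivative is the Gross-Sobolev derivative. -/
theorem theorem48 :
    ∃ (Φ : MetricCalculus.VectorField MetricCalculus.gaussianProduct MetricCalculus.l2Dist ≃ₗ[ℝ]
          MetricCalculus.WeakL2 MetricCalculus.gaussianProduct)
      (S : MetricCalculus.WeakL2 MetricCalculus.gaussianProduct ≃ₗ[ℝ]
          Lp MetricCalculus.HilbertL2 ⊤ MetricCalculus.gaussianProduct)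
      (Θ : MetricCalculus.OneForm MetricCalculus.gaussianProduct MetricCalculus.l2Dist ≃ₗ[ℝ]
          Lp MetricCalculus.HilbertL2 ⊤ MetricCalculus.gaussianProduct),
      -- `Φ` is an isometric isomorphism of modules over `L^∞`
      (∀ a δ, Φ (MetricCalculus.fieldSMul a δ) = MetricCalculus.weakL2SMul a (Φ δ)) ∧
      (∀ δ, MetricCalculus.weakL2Norm (Φ δ) = MetricCalculus.opNorm δ.1) ∧
      -- `S` is an isometric isomorphism of modules over `L^∞`, given by the evident formula
      (∀ a g, S (MetricCalculus.weakL2SMul a g) = a • S g) ∧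
      (∀ g, ‖S g‖ₑ = MetricCalculus.weakL2Norm g) ∧
      (∀ g, ∀ᵐ x ∂MetricCalculus.gaussianProduct, ∀ n, S g x n = g.1 n x) ∧
      -- `Θ` is an isometric isomorphism of modules over `L^∞`, given by the fiberwise inner product
      (∀ a θ, Θ (MetricCalculus.formSMul a θ) = a • Θ θ) ∧
      (∀ θ, ‖Θ θ‖ₑ = MetricCalculus.formNorm θ.1) ∧
      (∀ θ δ, ∀ᵐ x ∂MetricCalculus.gaussianProduct, θ.1 δ x = inner ℝ (Θ θ x) (S (Φ δ) x)) ∧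
      -- the exterior derivative is the Gross-Sobolev derivative
      (∀ (f : MetricCalculus.Lip MetricCalculus.gaussianProduct MetricCalculus.l2Dist)
          (G : (ℕ → ℝ) → MetricCalculus.HilbertL2),
        MetricCalculus.IsGrossSobolevDerivative f.1 G ↔
          G =ᵐ[MetricCalculus.gaussianProduct] Θ (MetricCalculus.exteriorDeriv f)) := by
  exact ⟨MetricCalculus.fieldEquiv, MetricCalculus.sectionEquiv _,
    MetricCalculus.sectionFormEquiv.symm, MetricCalculus.fieldEquiv_fieldSMul,
    MetricCalculus.weakL2Norm_fieldEquiv, MetricCalculus.sectionMap_weakL2SMul,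
    MetricCalculus.enorm_sectionMap, MetricCalculus.sectionMap_apply,
    MetricCalculus.sectionFormEquiv_symm_formSMul, MetricCalculus.enorm_sectionFormEquiv_symm,
    MetricCalculus.apply_eq_inner_sectionFormEquiv_symm,
    MetricCalculus.isGrossSobolevDerivative_iff⟩
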